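/- **Setting.** Let $\Lambda$ be an abelian group with a finite measure $dx$ (for example the torus $\mathbb T^d$), and let $X=(X(x))_{x\in\Lambda}$ be a jointly measurable, centred real Gaussian process whose covariance is given by a kernel $K$: $\mathbb E[X(x)X(y)]=K(x-y)$ (so $K$ is even). Fix $\ell\in\mathbb R$ and $d\in\mathbb N$. **Diagrams.** $\mathbf F$ is the set of isomorphism classes of finite connected multigraphs $\Gamma=(V,E)$ with at least one edge and no self-connected vertex; $S_F(\Gamma)$ is the number of automorphisms of $\Gamma$ (a permutation of $V$ together with a permutation of $E$, compatible with endpoints). $\langle\mathcal F\rangle$ is the free commutative real algebra on $\mathbf F$; its monomials are the forests, its unit is the empty forest, and $S_F(\prod_i\Gamma_i^{r_i})=\prod_i r_i!\,S_F(\Gamma_i)^{r_i}$ for distinct $\Gamma_i$. Let $$\Pi_F(\Gamma)=\int_{\Lambda^{V}}\prod_{e\in E}K(x_{e_+}-x_{e_-})\,dx,\qquad \deg\Gamma=\ell|E|+d(|V|-1),$$ with $\Pi_F$ extended to an algebra morphism $\langle\mathcal F\rangle\to\mathbb R$. Set $$\Delta_F\Gamma=\sum_{\bar\Gamma}\bar\Gamma\otimes\Gamma/\bar\Gamma,$$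 where $\bar\Gamma$ runs over the subgraphs spanned by non-empty proper subsets of $E$ all of whose connected components have degree $\le0$ and for which the graph $\Gamma/\bar\Gamma$, obtained by contracting each component of $\bar\Gamma$ to a vertex, has no self-connected vertex. Let $\Delta_F^-$ be the algebra morphism with $\Delta_F^-\Gamma=1\otimes\Gamma+\Gamma\otimes1+\Delta_F\Gamma$. The twisted antipode $A_F$ is the algebra endomorphism of $\langle\mathcal F\rangle$ with $A_F(\Gamma)=0$ if $\deg\Gamma>0$ and $A_F(\Gamma)=-\Gamma-\mu(A_F\otimes\mathrm{id})\Delta_F\Gamma$ if $\deg\Gamma\le0$, where $\mu$ is multiplication. Put $\hat M_F=(\Pi_F(A_F(\cdot))\otimes\mathrm{id})\Delta_F^-$. **Multi-indices.** The counting map is $\Phi(\Gamma)=\prod_{v\in V}z_{k(v)}$, $k(v)$ being the number of edges at $v$, and $\mathbf M=\Phi(\mathbf F)$ is a set of monomials $z^\beta=\prod_{k}z_k^{\beta(k)}$. $\langle\mathcal M\rangle$ is the free commutative real algebra on $\mathbf M$, whose monomials are the forests of multi-indices (the forest product is not the product of monomials in the $z_k$); $\Phi$ extends to forests multiplicatively.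 Set $S_M(z^\beta)=\prod_k\beta(k)!\,(k!)^{\beta(k)}$, $S_M(\prod_i (z^{\beta_i})^{r_i})=\prod_i r_i!\,S_M(z^{\beta_i})^{r_i}$ for forests with distinct $z^{\beta_i}$, and $\deg z^\beta=\frac{\ell}{2}\sum_k k\beta(k)+d\big(\sum_k\beta(k)-1\big)$. With $D=\sum_k z_{k+1}\partial_{z_k}$, the insertion of a forest $s$ with members $z^{\beta_1},\dots,z^{\beta_n}$ into $z^\alpha\in\mathbf M$ is the polynomial $$s\star_M z^\alpha=\sum_{k_1,\dots,k_n\in\mathbb N}\Big(\prod_{i=1}^nD^{k_i}z^{\beta_i}\Big)\Big(\prod_{i=1}^n\partial_{z_{k_i}}\Big)z^\alpha ,$$ and, with $[z^\beta]$ denoting the coefficient of $z^\beta$, $$\Delta_M z^\beta=\sum_{s}\sum_{z^\alpha\in\mathbf M}\frac{S_M(z^\beta)}{S_M(s)S_M(z^\alpha)}\,[z^\beta]\big(s\star_M z^\alpha\big)\;s\otimes z^\alpha,$$ $s$ running over the non-empty forests all of whose members have degree $\le0$. (This is the dual of $\star_M$ for the inner product in which forests are orthogonal with squared norm $S_M$.)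 Let $\Delta_M^-$ be the algebra morphism with $\Delta_M^-z^\beta=1\otimes z^\beta+z^\beta\otimes1+\Delta_Mz^\beta$, and $A_M$ the algebra endomorphism of $\langle\mathcal M\rangle$ with $A_M(z^\beta)=0$ if $\deg z^\beta>0$ and $A_M(z^\beta)=-z^\beta-\mu(A_M\otimes\mathrm{id})\Delta_Mz^\beta$ if $\deg z^\beta\le0$. The valuation $\Pi_M:\langle\mathcal M\rangle\to\mathbb R$ is the algebra morphism determined recursively by $$\Pi_M(z^\beta)=\mathbb E\Big[\prod_k\Big(\int_\Lambda H_k(X(x))\,dx\Big)^{\beta(k)}\Big]-\sum_{s}\frac{1}{\prod_j r_j!}\prod_k\frac{\beta(k)!}{\beta_1(k)!\cdots\beta_n(k)!}\;\prod_{i=1}^n\Pi_M(z^{\beta_i}),$$ where $s$ runs over the (unordered) forests with $n\ge2$ members $z^{\beta_1},\dots,z^{\beta_n}\in\mathbf M$ such that $\sum_i\beta_i=\beta$, the $r_j$ are the multiplicities of the distinct members of $s$, and $H_k$ is the $k$-th Hermite polynomial with variance $\mathrm{Var}(X(x))$. Put $\hat M_M=(\Pi_M(A_M(\cdot))\otimes\mathrm{id})\Delta_M^-$.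 Finally $\mathcal P:\langle\mathcal M\rangle\to\langle\mathcal F\rangle$ is the linear map $$\mathcal P(s)=\sum_{F:\ \Phi(F)=s}\frac{S_M(s)}{S_F(F)}\,F\qquad(s\text{ a forest of multi-indices, }F\text{ forests of diagrams}).$$ **Theorem.** Multi-index renormalisation is equivalent to BPHZ renormalisation of diagrams: on $\langle\mathcal M\rangle$, in particular for every forest of multi-indices, $$\Pi_M\circ\hat M_M=\Pi_F\circ\hat M_F\circ\mathcal P .$$ -/

import Mathlib

open MeasureTheory ProbabilityTheory
open scoped TensorProduct

noncomputable section

namespace FeynmanRenorm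

/-! ### Feynman diagrams -/

/-- A concrete (labelled) connected vacuum Feynman diagram: a finite connected multigraph with at
least one edge and without self-connected vertices. The orientation `src, tgt` of an edge is
only a choice of a name for its two endpoints; it is ignored by isomorphisms. -/
structure Graph where
  V : Type
  E : Type
  [fintypeV : Fintype V]
  [fintypeE : Fintype E]
  src : E → V
  tgt : E → V
  src_ne_tgt : ∀ e, src e ≠ tgt e
  connected : ∀ u v, Relation.EqvGen (fun a b => ∃ e, src e = a ∧ tgt e = b) u v
  nonempty_E : Nonempty E

attribute [instance] Graph.fintypeV Graph.fintypeE

/-- An isomorphism: a bijection of vertices together with a bijection of edges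
respecting the (unordered) endpoints of each edge. -/
structure Graph.Iso (G H : Graph) where
  onV : G.V ≃ H.V
  onE : G.E ≃ H.E
  ends : ∀ e, s(H.src (onE e), H.tgt (onE e)) = s(onV (G.src e), onV (G.tgt e))

/-- Two diagrams are identified when they are isomorphic. -/
instance Graph.setoid : Setoid Graph where
  r G H := Nonempty (Graph.Iso G H)
  iseqv :=
    { refl := fun G => ⟨⟨Equiv.refl _, Equiv.refl _, fun _ => rfl⟩⟩
      symm := by
        rintro G H ⟨f⟩
        refine ⟨⟨f.onV.symm, f.onE.symm, fun e => ?_⟩⟩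
        have h := f.ends (f.onE.symm e)
        rw [Equiv.apply_symm_apply] at h
        have h2 := congrArg (Sym2.map f.onV.symm) h
        simpa using h2.symm
      trans := by
        rintro G H J ⟨f⟩ ⟨g⟩
        refine ⟨⟨f.onV.trans g.onV, f.onE.trans g.onE, fun e => ?_⟩⟩
        have h := congrArg (Sym2.map g.onV) (f.ends e)
        simp only [Sym2.map_mk] at h
        rw [Equiv.trans_apply, g.ends, h]
        rfl }

/-- The set of connected Feynman diagrams, up to isomorphism. -/
def Diagram : Type 1 := Quotient Graph.setoid

instance instDecEqDiagram : DecidableEq Diagram := Classical.decEq _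

/-- The diagram of a graph. -/
def Graph.diagram (G : Graph) : Diagram := Quotient.mk Graph.setoid G

/-- A representative of an isomorphism class. Everything below that is computed on this
representative is invariant under isomorphism (the valuation because the kernel is even). -/
def Diagram.graph (Γ : Diagram) : Graph := Quotient.out Γ

/-- A forest of diagrams, as a finite multiset: `F Γ` is the number of components equal to `Γ`.
The linear span of forests with the forest product is `MvPolynomial Diagram ℝ`, the forest `F`
being the monomial `MvPolynomial.monomial F 1` and the empty forest being `1`. -/
abbrev DiagramForest : Type 1 := Diagram →₀ ℕ

/-- The number of edges at a vertex. -/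
def Graph.arity (G : Graph) (v : G.V) : ℕ := Nat.card {e : G.E // G.src e = v ∨ G.tgt e = v}

/-- The degree `ℓ |E| + d (|V| - 1)` of a graph. -/
def Graph.deg (l : ℝ) (d : ℕ) (G : Graph) : ℝ :=
  l * Fintype.card G.E + d * ((Fintype.card G.V : ℝ) - 1)

/-- The degree of a diagram. -/
def Diagram.deg (l : ℝ) (d : ℕ) (Γ : Diagram) : ℝ := Γ.graph.deg l d

/-- The symmetry factor of a diagram: the number of its automorphisms (a permutation of the
vertices together with a permutation of the edges). -/
def Diagram.symm (Γ : Diagram) : ℕ := Nat.card (Graph.Iso Γ.graph Γ.graph)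

/-- The symmetry factor of a forest. -/
def symmF (F : DiagramForest) : ℕ := F.prod fun Γ r => r.factorial * Γ.symm ^ r

/-! ### Subgraphs, extraction and contraction

A subgraph without isolated vertices is determined by its set of edges `A`. -/

/-- Two vertices are related if they are connected through edges of `A`. The classes with an edge
are the connected components of the subgraph `A`, the other classes are single vertices. -/
def Graph.rel (G : Graph) (A : Finset G.E) : Setoid G.V :=
  Relation.EqvGen.setoid fun a b => ∃ e ∈ A, G.src e = a ∧ G.tgt e = b

lemma Graph.rel_edge (G : Graph) {A : Finset G.E} {e : G.E} (he : e ∈ A) :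
    Quotient.mk (G.rel A) (G.src e) = Quotient.mk (G.rel A) (G.tgt e) :=
  Quotient.sound (Relation.EqvGen.rel _ _ ⟨e, he, rfl, rfl⟩)

/-- The connected components of the subgraph with edge set `A`. -/
def Graph.Component (G : Graph) (A : Finset G.E) : Type :=
  {q : Quotient (G.rel A) // ∃ e ∈ A, Quotient.mk (G.rel A) (G.src e) = q}

instance Graph.instFiniteQuotient (G : Graph) (A : Finset G.E) : Finite (Quotient (G.rel A)) :=
  inferInstance

instance Graph.instFintypeQuotient (G : Graph) (A : Finset G.E) : Fintype (Quotient (G.rel A)) :=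
  Fintype.ofFinite _

instance Graph.instFintypeComponent (G : Graph) (A : Finset G.E) : Fintype (G.Component A) :=
  @Fintype.ofFinite _ (Subtype.finite)

/-- A connected component of a subgraph, as a Feynman diagram. -/
def Graph.component (G : Graph) (A : Finset G.E) (c : G.Component A) : Graph where
  V := {v : G.V // Quotient.mk (G.rel A) v = c.1}
  E := {e : G.E // e ∈ A ∧ Quotient.mk (G.rel A) (G.src e) = c.1}
  fintypeV := Fintype.ofFinite _
  fintypeE := Fintype.ofFinite _
  src e := ⟨G.src e.1, e.2.2⟩
  tgt e := ⟨G.tgt e.1, (G.rel_edge e.2.1).symm.trans e.2.2⟩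
  src_ne_tgt e h := G.src_ne_tgt e.1 (congrArg Subtype.val h)
  connected := by
    have key : ∀ a b, Relation.EqvGen (fun a b => ∃ e ∈ A, G.src e = a ∧ G.tgt e = b) a b →
        ∀ (ha : Quotient.mk (G.rel A) a = c.1) (hb : Quotient.mk (G.rel A) b = c.1),
        Relation.EqvGen (fun x y : {v : G.V // Quotient.mk (G.rel A) v = c.1} =>
          ∃ e : {e : G.E // e ∈ A ∧ Quotient.mk (G.rel A) (G.src e) = c.1},
            (⟨G.src e.1, e.2.2⟩ : {v : G.V // Quotient.mk (G.rel A) v = c.1}) = x ∧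
            (⟨G.tgt e.1, (G.rel_edge e.2.1).symm.trans e.2.2⟩ :
              {v : G.V // Quotient.mk (G.rel A) v = c.1}) = y) ⟨a, ha⟩ ⟨b, hb⟩ := by
      intro a b h
      induction h with
      | rel a b h =>
        intro ha hb
        obtain ⟨e, he, rfl, rfl⟩ := h
        exact Relation.EqvGen.rel _ _ ⟨⟨e, he, ha⟩, rfl, rfl⟩
      | refl a => intro ha hb; exact Relation.EqvGen.refl _
      | symm a b h ih => intro ha hb; exact Relation.EqvGen.symm _ _ (ih hb ha)
      | trans a b c' h1 h2 ih1 ih2 =>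
        intro ha hc
        have hb : Quotient.mk (G.rel A) b = c.1 :=
          (Quotient.sound (show (G.rel A).r b a from Relation.EqvGen.symm _ _ h1)).trans ha
        exact Relation.EqvGen.trans _ _ _ (ih1 ha hb) (ih2 hb hc)
    rintro ⟨u, hu⟩ ⟨v, hv⟩
    exact key u v (Quotient.exact (hu.trans hv.symm)) hu hv
  nonempty_E := by
    obtain ⟨e, he, h⟩ := c.2
    exact ⟨⟨e, he, h⟩⟩

/-- The graph obtained by contracting every component of the subgraph `A` to a single vertex,
provided that some edge remains and no self-connected vertex is created. -/
def Graph.contract (G : Graph) (A : Finset G.E) (hA : A ≠ Finset.univ)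
    (hloop : ∀ e, e ∉ A → ¬ (G.rel A).r (G.src e) (G.tgt e)) : Graph where
  V := Quotient (G.rel A)
  E := {e : G.E // e ∉ A}
  fintypeV := Fintype.ofFinite _
  fintypeE := Fintype.ofFinite _
  src e := Quotient.mk (G.rel A) (G.src e.1)
  tgt e := Quotient.mk (G.rel A) (G.tgt e.1)
  src_ne_tgt e h := hloop e.1 e.2 (Quotient.exact h)
  connected := by
    intro p q
    induction p using Quotient.inductionOn with | _ u => ?_
    induction q using Quotient.inductionOn with | _ v => ?_
    induction G.connected u v with
    | rel a b h =>
      obtain ⟨e, rfl, rfl⟩ := h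
      by_cases he : e ∈ A
      · rw [G.rel_edge he]; exact Relation.EqvGen.refl _
      · exact Relation.EqvGen.rel _ _ ⟨⟨e, he⟩, rfl, rfl⟩
    | refl a => exact Relation.EqvGen.refl _
    | symm a b _ ih => exact Relation.EqvGen.symm _ _ ih
    | trans a b c _ _ ih1 ih2 => exact Relation.EqvGen.trans _ _ _ ih1 ih2
  nonempty_E := by
    by_contra h
    apply hA
    ext e
    simpa using not_not.1 fun he => h ⟨⟨e, he⟩⟩

/-- The divergent proper subgraphs of `G` that can be extracted: non-empty proper sets of edges such
that every component has non-positive degree and the contracted graph is again a Feynman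
diagram (has no self-connected vertex). -/
def Graph.Extraction (l : ℝ) (d : ℕ) (G : Graph) : Type :=
  {A : Finset G.E // A.Nonempty ∧ A ≠ Finset.univ ∧
    (∀ e, e ∉ A → ¬ (G.rel A).r (G.src e) (G.tgt e)) ∧
    ∀ c : G.Component A, (G.component A c).deg l d ≤ 0}

instance Graph.instFintypeExtraction (l : ℝ) (d : ℕ) (G : Graph) : Fintype (G.Extraction l d) :=
  @Fintype.ofFinite _ (Subtype.finite)

/-- The components of an extracted subgraph. -/
abbrev Graph.Extraction.Comp {l : ℝ} {d : ℕ} {G : Graph} (A : G.Extraction l d) : Type :=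
  G.Component A.1

/-- A component of an extracted subgraph, as a diagram. -/
def Graph.Extraction.comp {l : ℝ} {d : ℕ} {G : Graph} (A : G.Extraction l d) (c : A.Comp) :
    Diagram := (G.component A.1 c).diagram

/-- The extracted forest. -/
def Graph.Extraction.forest {l : ℝ} {d : ℕ} {G : Graph} (A : G.Extraction l d) : DiagramForest :=
  ∑ c : A.Comp, Finsupp.single (A.comp c) 1

/-- The contracted diagram. -/
def Graph.Extraction.quot {l : ℝ} {d : ℕ} {G : Graph} (A : G.Extraction l d) : Diagram :=
  (G.contract A.1 A.2.2.1 A.2.2.2.1).diagram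

/-! ### BPHZ renormalisation of diagrams -/

/-- The reduced extraction-contraction coproduct of diagrams. -/
def coprodF (l : ℝ) (d : ℕ) (Γ : Diagram) :
    MvPolynomial Diagram ℝ ⊗[ℝ] MvPolynomial Diagram ℝ :=
  ∑ A : Γ.graph.Extraction l d, MvPolynomial.monomial A.forest 1 ⊗ₜ MvPolynomial.X A.quot

/-- The extraction-contraction coproduct, multiplicative for the forest product. -/
def fullCoprodF (l : ℝ) (d : ℕ) :
    MvPolynomial Diagram ℝ →ₐ[ℝ] MvPolynomial Diagram ℝ ⊗[ℝ] MvPolynomial Diagram ℝ :=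
  MvPolynomial.aeval fun Γ =>
    1 ⊗ₜ MvPolynomial.X Γ + MvPolynomial.X Γ ⊗ₜ 1 + coprodF l d Γ

lemma Graph.Iso.card_E {G H : Graph} (f : G.Iso H) : Fintype.card G.E = Fintype.card H.E :=
  Fintype.card_congr f.onE

lemma Graph.diagram_graph_iso (G : Graph) : Nonempty (G.diagram.graph.Iso G) :=
  Quotient.exact (Quotient.out_eq G.diagram)

lemma Graph.Extraction.card_comp_lt {l : ℝ} {d : ℕ} {G : Graph} (A : G.Extraction l d)
    (c : A.Comp) : Fintype.card (A.comp c).graph.E < Fintype.card G.E := by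
  obtain ⟨f⟩ := (G.component A.1 c).diagram_graph_iso
  have h1 : Fintype.card (A.comp c).graph.E = Fintype.card (G.component A.1 c).E := f.card_E
  rw [h1]
  have hA := A.2.2.1
  obtain ⟨e, he⟩ : ∃ e, e ∉ A.1 := by
    by_contra h
    push Not at h
    exact hA (Finset.eq_univ_iff_forall.2 h)
  let i : (G.component A.1 c).E → G.E := fun x => Subtype.val x
  refine Fintype.card_lt_of_injective_of_notMem i (fun x y h => Subtype.ext h) (b := e) ?_
  rintro ⟨x, rfl⟩
  exact he x.2.1

open Classical in
/-- The twisted antipode on a single diagram (zero on diagrams of positive degree), by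
recursion on the number of edges. -/
def antipodeFAux (l : ℝ) (d : ℕ) (Γ : Diagram) : MvPolynomial Diagram ℝ :=
  if Γ.deg l d ≤ 0 then
    -MvPolynomial.X Γ - ∑ A : Γ.graph.Extraction l d,
      (∏ c : A.Comp, antipodeFAux l d (A.comp c)) * MvPolynomial.X A.quot
  else 0
termination_by Fintype.card Γ.graph.E
decreasing_by exact A.card_comp_lt c

/-- The twisted antipode of diagrams, multiplicative for the forest product. It vanishes on
non-empty forests with a component of positive degree. -/
def antipodeF (l : ℝ) (d : ℕ) : MvPolynomial Diagram ℝ →ₐ[ℝ] MvPolynomial Diagram ℝ :=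
  MvPolynomial.aeval (antipodeFAux l d)

/-- The defining recursion of the twisted antipode in terms of the reduced coproduct. -/
theorem antipodeF_X (l : ℝ) (d : ℕ) (Γ : Diagram) (h : Γ.deg l d ≤ 0) :
    antipodeF l d (MvPolynomial.X Γ) = -MvPolynomial.X Γ -
      Algebra.TensorProduct.lmul' ℝ (Algebra.TensorProduct.map (antipodeF l d)
        (AlgHom.id ℝ (MvPolynomial Diagram ℝ)) (coprodF l d Γ)) := by
  have hmon : ∀ A : Γ.graph.Extraction l d, antipodeF l d (MvPolynomial.monomial A.forest 1) =
      ∏ c : A.Comp, antipodeFAux l d (A.comp c) := by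
    intro A
    rw [Graph.Extraction.forest, MvPolynomial.monomial_sum_one, map_prod]
    refine Finset.prod_congr rfl fun c _ => ?_
    exact MvPolynomial.aeval_X _ _
  rw [antipodeF, MvPolynomial.aeval_X, antipodeFAux, if_pos h, coprodF, map_sum, map_sum]
  congr 1
  refine Finset.sum_congr rfl fun A _ => ?_
  rw [Algebra.TensorProduct.map_tmul, Algebra.TensorProduct.lmul'_apply_tmul, ← antipodeF, hmon]
  rfl

/-- The valuation of a diagram for the kernel `K`. -/
def Diagram.valuation {Λ : Type*} [AddCommGroup Λ] [MeasurableSpace Λ] (μ : Measure Λ)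
    (K : Λ → ℝ) (Γ : Diagram) : ℝ :=
  ∫ x : Γ.graph.V → Λ, ∏ e, K (x (Γ.graph.src e) - x (Γ.graph.tgt e)) ∂(Measure.pi fun _ => μ)

/-- The valuation, extended to forests multiplicatively and linearly. -/
def valuationF {Λ : Type*} [AddCommGroup Λ] [MeasurableSpace Λ] (μ : Measure Λ) (K : Λ → ℝ) :
    MvPolynomial Diagram ℝ →ₐ[ℝ] ℝ :=
  MvPolynomial.aeval (Diagram.valuation μ K)

/-- The BPHZ renormalisation of diagrams `(Π_F (A_F ·) ⊗ id) Δ_F⁻`. -/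
def renormF {Λ : Type*} [AddCommGroup Λ] [MeasurableSpace Λ] (μ : Measure Λ) (K : Λ → ℝ)
    (l : ℝ) (d : ℕ) : MvPolynomial Diagram ℝ →ₐ[ℝ] MvPolynomial Diagram ℝ :=
  (Algebra.TensorProduct.lid ℝ (MvPolynomial Diagram ℝ)).toAlgHom.comp
    ((Algebra.TensorProduct.map ((valuationF μ K).comp (antipodeF l d))
      (AlgHom.id ℝ (MvPolynomial Diagram ℝ))).comp (fullCoprodF l d))

/-! ### Multi-indices -/

/-- The counting map, on the level of exponents: the number of vertices of each arity. -/
def Diagram.countExp (Γ : Diagram) : ℕ →₀ ℕ :=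
  ∑ v : Γ.graph.V, Finsupp.single (Γ.graph.arity v) 1

/-- The set of multi-indices `z^β` that come from a Feynman diagram. -/
def MIndex : Type := {β : ℕ →₀ ℕ // ∃ Γ : Diagram, Γ.countExp = β}

instance instDecEqMIndex : DecidableEq MIndex := Classical.decEq _

/-- The exponent `β` of `z^β`. -/
abbrev MIndex.exp (β : MIndex) : ℕ →₀ ℕ := β.1

/-- The counting map. -/
def Diagram.count (Γ : Diagram) : MIndex := ⟨Γ.countExp, Γ, rfl⟩

/-- A forest of multi-indices, as a finite multiset. The linear span of
forests with the forest product is `MvPolynomial MIndex ℝ`. -/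
abbrev MForest : Type := MIndex →₀ ℕ

/-- The norm `|z^β| = ∑ β(k)`. -/
def MIndex.norm (β : MIndex) : ℕ := β.exp.sum fun _ r => r

/-- The number of half-edges `∑ k β(k)`. -/
def MIndex.halfEdges (β : MIndex) : ℕ := β.exp.sum fun k r => r * k

/-- The degree of a multi-index. -/
def MIndex.deg (l : ℝ) (d : ℕ) (β : MIndex) : ℝ :=
  l / 2 * (β.halfEdges : ℝ) + d * ((β.norm : ℝ) - 1)

/-- The symmetry factor `∏ β(k)! (k!)^β(k)`. -/
def MIndex.symm (β : MIndex) : ℕ := β.exp.prod fun k r => r.factorial * k.factorial ^ r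

/-- The symmetry factor of a forest. -/
def symmM (s : MForest) : ℕ := s.prod fun β r => r.factorial * β.symm ^ r

/-- The derivation `D = ∑ z_{k+1} ∂_{z_k}`. -/
def derivD : Derivation ℝ (MvPolynomial ℕ ℝ) (MvPolynomial ℕ ℝ) :=
  MvPolynomial.mkDerivation ℝ fun k => MvPolynomial.X (k + 1)

lemma pderiv_left_comm (i j : ℕ) (p : MvPolynomial ℕ ℝ) :
    MvPolynomial.pderiv i (MvPolynomial.pderiv j p) =
      MvPolynomial.pderiv j (MvPolynomial.pderiv i p) := by
  have h : ⁅(MvPolynomial.pderiv i : Derivation ℝ (MvPolynomial ℕ ℝ) (MvPolynomial ℕ ℝ)),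
      (MvPolynomial.pderiv j : Derivation ℝ (MvPolynomial ℕ ℝ) (MvPolynomial ℕ ℝ))⁆ = 0 := by
    apply MvPolynomial.derivation_ext
    intro k
    simp only [Derivation.commutator_apply, MvPolynomial.pderiv_X, Derivation.zero_apply]
    classical
    rw [Pi.single_apply, Pi.single_apply]
    split_ifs <;> simp
  have h2 := congrArg (fun D => D p) h
  simpa [Derivation.commutator_apply, sub_eq_zero] using h2

instance instLeftCommPderiv :
    LeftCommutative fun (k : ℕ) (p : MvPolynomial ℕ ℝ) => MvPolynomial.pderiv k p :=
  ⟨fun i j p => pderiv_left_comm i j p⟩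

/-- The iterated derivative `∏ ∂_{z_k}` over a multiset of `k`. -/
def iterPderiv (κ : Multiset ℕ) (p : MvPolynomial ℕ ℝ) : MvPolynomial ℕ ℝ :=
  κ.foldr (fun k q => MvPolynomial.pderiv k q) p

/-- The members `i = 1, …, n` of a forest, counted with multiplicity. -/
abbrev MForest.Index (s : MForest) : Type := Σ β : s.support, Fin (s β)

/-- The simultaneous insertion
`∑_{k_1, …, k_n} (∏ D^{k_i} z^{β_i}) (∏ ∂_{z_{k_i}}) z^α` of the forest `s = ∏ z^{β_i}` into `z^α`.
Only those `k_i` are listed for which `z^α` contains `z_{k_i}`; the other terms vanish. -/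
def insertM (s : MForest) (α : MIndex) : MvPolynomial ℕ ℝ :=
  ∑ k : MForest.Index s → α.exp.support,
    (∏ i : MForest.Index s,
      (fun p => derivD p)^[(k i : ℕ)] (MvPolynomial.monomial i.1.1.exp 1)) *
    iterPderiv (Finset.univ.val.map fun i => (k i : ℕ)) (MvPolynomial.monomial α.exp 1)

/-- The coefficient of `s ⊗ z^α` in the coproduct of `z^β` dual to the insertion product,
determined by `⟨s ⋆ z^α, z^β⟩ = ⟨s ⊗ z^α, Δ z^β⟩`, where
forests are orthogonal with squared norm equal to the symmetry factor. -/
def coeffE (s : MForest) (α β : MIndex) : ℝ :=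
  (β.symm : ℝ) / ((symmM s : ℝ) * (α.symm : ℝ)) * (insertM s α).coeff β.exp

lemma Graph.arity_pos (G : Graph) (v : G.V) : 0 < G.arity v := by
  obtain ⟨e⟩ := G.nonempty_E
  have key : ∀ a b, Relation.EqvGen (fun a b => ∃ e, G.src e = a ∧ G.tgt e = b) a b →
      a = b ∨ ((∃ e, G.src e = a ∨ G.tgt e = a) ∧ ∃ e, G.src e = b ∨ G.tgt e = b) := by
    intro a b h
    induction h with
    | rel a b h => obtain ⟨e, rfl, rfl⟩ := h; exact Or.inr ⟨⟨e, Or.inl rfl⟩, e, Or.inr rfl⟩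
    | refl a => exact Or.inl rfl
    | symm a b _ ih => grind
    | trans a b c _ _ ih1 ih2 => grind
  have h : ∃ e, G.src e = v ∨ G.tgt e = v := by
    rcases key (G.src e) v (G.connected _ _) with h | h
    · exact ⟨e, Or.inl h⟩
    · exact h.2
  obtain ⟨e', he'⟩ := h
  have : Nonempty {e : G.E // G.src e = v ∨ G.tgt e = v} := ⟨⟨e', he'⟩⟩
  exact Nat.card_pos

lemma Diagram.halfEdges_count (Γ : Diagram) :
    Γ.count.halfEdges = ∑ v, Γ.graph.arity v := by
  have h : Γ.count.halfEdges = Finsupp.weight (fun k : ℕ => k) Γ.countExp := by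
    simp [MIndex.halfEdges, Finsupp.weight_apply, Diagram.count]
  rw [h, Diagram.countExp, map_sum]
  exact Finset.sum_congr rfl fun v _ => by simp [Finsupp.weight_apply]

lemma MIndex.halfEdges_pos (β : MIndex) : 0 < β.halfEdges := by
  obtain ⟨b, Γ, rfl⟩ := β
  change 0 < Γ.count.halfEdges
  rw [Γ.halfEdges_count]
  obtain ⟨e⟩ := Γ.graph.nonempty_E
  exact Finset.sum_pos (fun v _ => Γ.graph.arity_pos v) ⟨Γ.graph.src e, Finset.mem_univ _⟩

lemma MIndex.exp_zero (β : MIndex) : β.exp 0 = 0 := by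
  obtain ⟨b, Γ, rfl⟩ := β
  change Γ.countExp 0 = 0
  rw [Diagram.countExp, Finsupp.finsetSum_apply]
  refine Finset.sum_eq_zero fun v _ => ?_
  rw [Finsupp.single_apply, if_neg (Γ.graph.arity_pos v).ne']

lemma MIndex.finite_halfEdges_le (W : ℕ) : {β : MIndex | β.halfEdges ≤ W}.Finite := by
  have hfin : (Set.Iic (∑ k ∈ Finset.range (W + 1), Finsupp.single k W : ℕ →₀ ℕ)).Finite :=
    Set.finite_Iic _
  refine Set.Finite.of_finite_image (f := MIndex.exp) (hfin.subset ?_)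
    (fun x _ y _ h => Subtype.ext h)
  rintro _ ⟨β, hβ, rfl⟩
  change β.halfEdges ≤ W at hβ
  rw [Set.mem_Iic]
  intro k
  rw [Finsupp.finsetSum_apply]
  rcases Nat.eq_zero_or_pos (β.exp k) with h0 | h0
  · rw [h0]; exact Nat.zero_le _
  have hk : k ≠ 0 := by rintro rfl; rw [β.exp_zero] at h0; exact lt_irrefl _ h0
  have hle : β.exp k * k ≤ W :=
    le_trans (Finset.single_le_sum (f := fun k => β.exp k * k) (fun _ _ => Nat.zero_le _)
      (Finsupp.mem_support_iff.2 h0.ne')) hβ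
  have h1 : k ≤ W := le_trans (Nat.le_mul_of_pos_left k h0) hle
  have h2 : β.exp k ≤ W := le_trans (Nat.le_mul_of_pos_right _ (Nat.pos_of_ne_zero hk)) hle
  refine le_trans h2 (le_trans (by simp)
    (Finset.single_le_sum (f := fun j => (Finsupp.single j W : ℕ →₀ ℕ) k)
    (fun _ _ => Nat.zero_le _) (Finset.mem_range.2 (Nat.lt_succ_of_le h1))))

/-- The number of half-edges of a forest. -/
def halfEdgesForest (s : MForest) : ℕ := s.sum fun γ r => r * γ.halfEdges

lemma le_halfEdgesForest (s : MForest) (γ : MIndex) (hγ : γ ∈ s.support) :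
    s γ * γ.halfEdges ≤ halfEdgesForest s :=
  Finset.single_le_sum (f := fun γ => s γ * γ.halfEdges) (fun _ _ => Nat.zero_le _) hγ

lemma finite_forest_halfEdges_le (W : ℕ) : {s : MForest | halfEdgesForest s ≤ W}.Finite := by
  have hfin : (Set.Iic (∑ γ ∈ (MIndex.finite_halfEdges_le W).toFinset,
      Finsupp.single γ W : MForest)).Finite := Set.finite_Iic _
  refine hfin.subset fun s hs => ?_
  change halfEdgesForest s ≤ W at hs
  rw [Set.mem_Iic]
  intro γ
  rw [Finsupp.finsetSum_apply]
  rcases Nat.eq_zero_or_pos (s γ) with h0 | h0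
  · rw [h0]; exact Nat.zero_le _
  have hle := le_trans (le_halfEdgesForest s γ (Finsupp.mem_support_iff.2 h0.ne')) hs
  have h1 : γ.halfEdges ≤ W := le_trans (Nat.le_mul_of_pos_left _ h0) hle
  have h2 : s γ ≤ W := le_trans (Nat.le_mul_of_pos_right _ γ.halfEdges_pos) hle
  refine le_trans h2 (le_trans (by simp)
    (Finset.single_le_sum (f := fun j => (Finsupp.single j W : MForest) γ)
    (fun _ _ => Nat.zero_le _) ((MIndex.finite_halfEdges_le W).mem_toFinset.2 h1)))

/-- The weight giving `z_k` the weight `k`. -/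
abbrev arityWeight : ℕ → ℤ := fun k => (k : ℤ)

lemma weight_exp (β : MIndex) : Finsupp.weight arityWeight β.exp = (β.halfEdges : ℤ) := by
  simp [Finsupp.weight_apply, MIndex.halfEdges, Finsupp.sum]

lemma derivD_homog {p : MvPolynomial ℕ ℝ} {n : ℤ}
    (h : p.IsWeightedHomogeneous arityWeight n) :
    (derivD p).IsWeightedHomogeneous arityWeight (n + 1) := by
  rw [p.as_sum, map_sum]
  refine MvPolynomial.IsWeightedHomogeneous.sum _ _ _ fun m hm => ?_
  have hw : Finsupp.weight arityWeight m = n := h (MvPolynomial.mem_support_iff.1 hm)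
  rw [derivD, MvPolynomial.mkDerivation_monomial]
  refine Submodule.smul_mem (MvPolynomial.weightedHomogeneousSubmodule ℝ arityWeight (n + 1)) _ ?_
  refine MvPolynomial.IsWeightedHomogeneous.sum _ _ _ fun k hk => ?_
  have h1 : Finsupp.weight arityWeight (m - Finsupp.single k 1) = n - k := by
    have h2 := Finsupp.weight_sub_single_add (w := arityWeight) (Finsupp.mem_support_iff.1 hk)
    rw [hw] at h2
    change _ + (k : ℤ) = n at h2
    linarith
  have h3 := (MvPolynomial.isWeightedHomogeneous_monomial (R := ℝ) arityWeight _
    ((m k : ℕ) : ℝ) h1).mul (MvPolynomial.isWeightedHomogeneous_X ℝ arityWeight (k + 1))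
  have h4 : (n - k + arityWeight (k + 1) : ℤ) = n + 1 := by
    simp only [arityWeight]; push_cast; ring
  rw [h4] at h3
  exact h3

lemma iter_derivD_homog {p : MvPolynomial ℕ ℝ} {n : ℤ}
    (h : p.IsWeightedHomogeneous arityWeight n) (k : ℕ) :
    ((fun p => derivD p)^[k] p).IsWeightedHomogeneous arityWeight (n + k) := by
  induction k with
  | zero => simpa using h
  | succ k ih =>
    rw [Function.iterate_succ_apply']
    have := derivD_homog ih
    rwa [add_assoc, ← Nat.cast_succ] at this

lemma iterPderiv_homog (κ : Multiset ℕ) {p : MvPolynomial ℕ ℝ} {n : ℤ}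
    (h : p.IsWeightedHomogeneous arityWeight n) :
    (iterPderiv κ p).IsWeightedHomogeneous arityWeight (n - (κ.map arityWeight).sum) := by
  induction κ using Multiset.induction_on with
  | empty => simpa [iterPderiv] using h
  | cons k κ ih =>
    rw [iterPderiv, Multiset.foldr_cons]
    refine MvPolynomial.IsWeightedHomogeneous.pderiv ih ?_
    rw [Multiset.map_cons, Multiset.sum_cons]; ring

lemma sum_index (s : MForest) :
    ∑ i : MForest.Index s, (i.1.1.halfEdges : ℤ) = halfEdgesForest s := by
  rw [Fintype.sum_sigma]
  simp only [Finset.sum_const, Finset.card_univ, Fintype.card_fin, nsmul_eq_mul]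
  rw [halfEdgesForest, Finsupp.sum, Nat.cast_sum,
    ← Finset.sum_coe_sort s.support fun γ => ((s γ * γ.halfEdges : ℕ) : ℤ)]
  simp

lemma insertM_homog (s : MForest) (α : MIndex) : (insertM s α).IsWeightedHomogeneous arityWeight
    ((halfEdgesForest s : ℤ) + α.halfEdges) := by
  refine MvPolynomial.IsWeightedHomogeneous.sum _ _ _ fun k _ => ?_
  have h1 : (∏ i : MForest.Index s, (fun p => derivD p)^[(k i : ℕ)]
      (MvPolynomial.monomial i.1.1.exp (1 : ℝ))).IsWeightedHomogeneous arityWeight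
      (∑ i : MForest.Index s, ((i.1.1.halfEdges : ℤ) + (k i : ℕ))) :=
    MvPolynomial.IsWeightedHomogeneous.prod _ _ _ fun i _ =>
      iter_derivD_homog (MvPolynomial.isWeightedHomogeneous_monomial _ _ _ (weight_exp _)) _
  have h2 := h1.mul (iterPderiv_homog (Finset.univ.val.map fun i => (k i : ℕ))
    (MvPolynomial.isWeightedHomogeneous_monomial arityWeight _ (1 : ℝ) (weight_exp α)))
  convert h2 using 1
  rw [Finset.sum_add_distrib, sum_index, Multiset.map_map]
  change _ = _ + ((α.halfEdges : ℤ) - ∑ i : MForest.Index s, ((k i : ℕ) : ℤ))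
  ring

lemma halfEdges_of_coeffE {s : MForest} {α β : MIndex} (h : coeffE s α β ≠ 0) :
    β.halfEdges = halfEdgesForest s + α.halfEdges := by
  have h1 := insertM_homog s α (right_ne_zero_of_mul h)
  rw [weight_exp] at h1
  exact_mod_cast h1

/-- The terms of the reduced coproduct of `z^β`: non-empty forests `s` of multi-indices of
non-positive degree and multi-indices `z^α` for which the coefficient does not vanish. -/
def termsM (l : ℝ) (d : ℕ) (β : MIndex) : Set (MForest × MIndex) :=
  {p | p.1 ≠ 0 ∧ (∀ γ ∈ p.1.support, γ.deg l d ≤ 0) ∧ coeffE p.1 p.2 β ≠ 0}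

lemma termsM_finite (l : ℝ) (d : ℕ) (β : MIndex) : (termsM l d β).Finite := by
  refine ((finite_forest_halfEdges_le β.halfEdges).prod
    (MIndex.finite_halfEdges_le β.halfEdges)).subset ?_
  rintro ⟨s, α⟩ ⟨_, _, h⟩
  have h1 : β.halfEdges = halfEdgesForest s + α.halfEdges := halfEdges_of_coeffE h
  exact ⟨by change halfEdgesForest s ≤ _; omega, by change α.halfEdges ≤ _; omega⟩

instance instFintypeTermsM (l : ℝ) (d : ℕ) (β : MIndex) : Fintype (termsM l d β) :=
  (termsM_finite l d β).fintype

/-- The reduced extraction-contraction coproduct of multi-indices. -/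
def coprodM (l : ℝ) (d : ℕ) (β : MIndex) :
    MvPolynomial MIndex ℝ ⊗[ℝ] MvPolynomial MIndex ℝ :=
  ∑ p : termsM l d β,
    coeffE p.1.1 p.1.2 β • (MvPolynomial.monomial p.1.1 1 ⊗ₜ MvPolynomial.X p.1.2)

/-- The extraction-contraction coproduct, multiplicative for the forest product. -/
def fullCoprodM (l : ℝ) (d : ℕ) :
    MvPolynomial MIndex ℝ →ₐ[ℝ] MvPolynomial MIndex ℝ ⊗[ℝ] MvPolynomial MIndex ℝ :=
  MvPolynomial.aeval fun β =>
    1 ⊗ₜ MvPolynomial.X β + MvPolynomial.X β ⊗ₜ 1 + coprodM l d β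

lemma termsM_lt {l : ℝ} {d : ℕ} {β : MIndex} (p : termsM l d β) (γ : p.1.1.support) :
    γ.1.halfEdges < β.halfEdges := by
  have h1 := halfEdges_of_coeffE p.2.2.2
  have h2 := le_halfEdgesForest p.1.1 γ.1 γ.2
  have h3 := Nat.le_mul_of_pos_left γ.1.halfEdges
    (Nat.pos_of_ne_zero (Finsupp.mem_support_iff.1 γ.2))
  have h4 := p.1.2.halfEdges_pos
  omega

open Classical in
/-- The twisted antipode on a single multi-index (zero on those of positive degree). -/
def antipodeMAux (l : ℝ) (d : ℕ) (β : MIndex) : MvPolynomial MIndex ℝ :=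
  if β.deg l d ≤ 0 then
    -MvPolynomial.X β - ∑ p : termsM l d β,
      coeffE p.1.1 p.1.2 β •
        ((∏ γ : p.1.1.support, antipodeMAux l d γ.1 ^ p.1.1 γ.1) * MvPolynomial.X p.1.2)
  else 0
termination_by β.halfEdges
decreasing_by exact termsM_lt p γ

/-- The twisted antipode of multi-indices, multiplicative for the forest product. It vanishes on
non-empty forests with a component of positive degree. -/
def antipodeM (l : ℝ) (d : ℕ) : MvPolynomial MIndex ℝ →ₐ[ℝ] MvPolynomial MIndex ℝ :=
  MvPolynomial.aeval (antipodeMAux l d)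

/-- The defining recursion of the twisted antipode in terms of the reduced coproduct. -/
theorem antipodeM_X (l : ℝ) (d : ℕ) (β : MIndex) (h : β.deg l d ≤ 0) :
    antipodeM l d (MvPolynomial.X β) = -MvPolynomial.X β -
      Algebra.TensorProduct.lmul' ℝ (Algebra.TensorProduct.map (antipodeM l d)
        (AlgHom.id ℝ (MvPolynomial MIndex ℝ)) (coprodM l d β)) := by
  have hmon : ∀ s : MForest, antipodeM l d (MvPolynomial.monomial s 1) =
      ∏ γ : s.support, antipodeMAux l d γ.1 ^ s γ.1 := by
    intro s
    rw [antipodeM, MvPolynomial.aeval_monomial, map_one, one_mul, Finsupp.prod,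
      ← Finset.prod_coe_sort]
  rw [antipodeM, MvPolynomial.aeval_X, antipodeMAux, if_pos h, coprodM, map_sum, map_sum]
  congr 1
  refine Finset.sum_congr rfl fun p _ => ?_
  rw [map_smul, map_smul, Algebra.TensorProduct.map_tmul, Algebra.TensorProduct.lmul'_apply_tmul,
    ← antipodeM, hmon]
  rfl

/-! ### From multi-indices to diagrams -/

lemma Diagram.norm_count (Γ : Diagram) : Γ.count.norm = Fintype.card Γ.graph.V := by
  have h : Γ.count.norm = Finsupp.weight (fun _ : ℕ => 1) Γ.countExp := by
    simp [MIndex.norm, Finsupp.weight_apply, Diagram.count]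
  rw [h, Diagram.countExp, map_sum]
  simp [Finsupp.weight_apply]

lemma Diagram.card_E_le (Γ : Diagram) : Fintype.card Γ.graph.E ≤ Γ.count.halfEdges := by
  rw [Γ.halfEdges_count]
  let f : Γ.graph.E → Σ v : Γ.graph.V, {e : Γ.graph.E // Γ.graph.src e = v ∨ Γ.graph.tgt e = v} :=
    fun e => ⟨Γ.graph.src e, e, Or.inl rfl⟩
  have hf : Function.Injective f := fun e e' h => by
    have := congrArg (fun x => (x.2 : Γ.graph.E)) h
    exact this
  have h := Nat.card_le_card_of_injective f hf
  rw [Nat.card_eq_fintype_card, Nat.card_sigma] at h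
  exact h

lemma Diagram.eq_of_iso {Γ Δ : Diagram} (f : Γ.graph.Iso Δ.graph) : Γ = Δ :=
  (Quotient.out_eq Γ).symm.trans
    ((Quotient.sound (s := Graph.setoid) (Nonempty.intro f)).trans (Quotient.out_eq Δ))

lemma Diagram.finite_card (n m : ℕ) : {Γ : Diagram |
    Fintype.card Γ.graph.V = n ∧ Fintype.card Γ.graph.E = m}.Finite := by
  let S := {Γ : Diagram // Fintype.card Γ.graph.V = n ∧ Fintype.card Γ.graph.E = m}
  let eV : ∀ Γ : S, Γ.1.graph.V ≃ Fin n := fun Γ => Fintype.equivFinOfCardEq Γ.2.1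
  let eE : ∀ Γ : S, Γ.1.graph.E ≃ Fin m := fun Γ => Fintype.equivFinOfCardEq Γ.2.2
  let f : S → (Fin m → Fin n) × (Fin m → Fin n) := fun Γ =>
    (fun i => eV Γ (Γ.1.graph.src ((eE Γ).symm i)), fun i => eV Γ (Γ.1.graph.tgt ((eE Γ).symm i)))
  have hf : Function.Injective f := by
    intro Γ Δ h
    have h1 := fun i => congrFun (congrArg Prod.fst h) i
    have h2 := fun i => congrFun (congrArg Prod.snd h) i
    apply Subtype.ext
    refine Diagram.eq_of_iso
      ⟨(eV Γ).trans (eV Δ).symm, (eE Γ).trans (eE Δ).symm, fun e => ?_⟩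
    have h3 := h1 (eE Γ e)
    have h4 := h2 (eE Γ e)
    simp only [f, Equiv.symm_apply_apply] at h3 h4
    simp only [Equiv.trans_apply]
    rw [h3, h4, Equiv.symm_apply_apply, Equiv.symm_apply_apply]
  exact Set.finite_coe_iff.1 (show Finite S from Finite.of_injective f hf)

lemma Diagram.finite_count (β : MIndex) : {Γ : Diagram | Γ.count = β}.Finite := by
  refine ((Set.finite_Iic β.norm).biUnion fun n _ =>
    (Set.finite_Iic β.halfEdges).biUnion fun m _ => Diagram.finite_card n m).subset ?_
  rintro Γ rfl
  simp only [Set.mem_iUnion]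
  exact ⟨_, Γ.norm_count.ge, _, Γ.card_E_le, rfl, rfl⟩

/-- The forests of diagrams whose image under the counting map is the forest `s`. -/
def lifts (s : MForest) : Set DiagramForest := {F | F.mapDomain Diagram.count = s}

lemma lifts_finite (s : MForest) : (lifts s).Finite := by
  have hT : {Γ : Diagram | Γ.count ∈ s.support}.Finite := by
    refine (s.support.finite_toSet.biUnion fun β _ => Diagram.finite_count β).subset ?_
    intro Γ h
    simp only [Set.mem_iUnion]
    exact ⟨_, h, rfl⟩
  have hfin : (Set.Iic (∑ Γ ∈ hT.toFinset,
      Finsupp.single Γ (s Γ.count) : DiagramForest)).Finite := Set.finite_Iic _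
  refine hfin.subset fun F hF => ?_
  change F.mapDomain Diagram.count = s at hF
  rw [Set.mem_Iic]
  intro Γ
  rw [Finsupp.finsetSum_apply]
  rcases Nat.eq_zero_or_pos (F Γ) with h0 | h0
  · rw [h0]; exact Nat.zero_le _
  have h1 : F Γ ≤ s Γ.count := by
    rw [← hF, Finsupp.mapDomain_apply_eq_sum]
    exact Finset.single_le_sum (f := fun Γ => F Γ) (fun _ _ => Nat.zero_le _)
      (by simp [h0.ne'])
  have h2 : Γ.count ∈ s.support := Finsupp.mem_support_iff.2 (h0.trans_le h1).ne'
  refine le_trans h1 (le_trans (by simp)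
    (Finset.single_le_sum (f := fun j => (Finsupp.single j (s j.count) : DiagramForest) Γ)
    (fun _ _ => Nat.zero_le _) (hT.mem_toFinset.2 h2)))

instance instFintypeLifts (s : MForest) : Fintype (lifts s) := (lifts_finite s).fintype

/-- The linear map sending a forest of multi-indices to the sum of all the forests of diagrams
above it, with coefficients the quotients of the symmetry factors. -/
def liftP : MvPolynomial MIndex ℝ →ₗ[ℝ] MvPolynomial Diagram ℝ :=
  (MvPolynomial.basisMonomials MIndex ℝ).constr ℝ fun s =>
    ∑ F : lifts s, ((symmM s : ℝ) / (symmF F.1 : ℝ)) • MvPolynomial.monomial F.1 (1 : ℝ)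

/-! ### Valuation and renormalisation of multi-indices -/

/-- The Hermite polynomial `(-v)^n exp (x² / 2v) dⁿ/dxⁿ exp (-x² / 2v)` with variance `v`. (For
`v = 0` this is `1` if `n = 0` and `0` otherwise.) -/
def hermiteVar (n : ℕ) (v x : ℝ) : ℝ :=
  (-v) ^ n * Real.exp (x ^ 2 / (2 * v)) *
    iteratedDeriv n (fun y : ℝ => Real.exp (-y ^ 2 / (2 * v))) x

/-- The moment `𝔼 [∏_k (∫ H_k(X(x)) dx)^β(k)]`. -/
def moment {Λ Ω : Type*} [MeasurableSpace Λ] [MeasurableSpace Ω] (μ : Measure Λ) (P : Measure Ω)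
    (X : Λ → Ω → ℝ) (β : MIndex) : ℝ :=
  ∫ ω, β.exp.prod (fun k r => (∫ x, hermiteVar k (Var[X x; P]) (X x ω) ∂μ) ^ r) ∂P

/-- The forests of at least two multi-indices with `∑ β_i = β`. -/
def decomps (β : MIndex) : Set MForest :=
  {s | 2 ≤ (s.sum fun _ r => r) ∧ (s.sum fun γ r => r • γ.exp) = β.exp}

lemma halfEdgesForest_of_decomps {β : MIndex} {s : MForest} (h : s ∈ decomps β) :
    halfEdgesForest s = β.halfEdges := by
  have hw : ∀ γ : MIndex, γ.halfEdges = Finsupp.weight (fun k : ℕ => k) γ.exp := fun γ => by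
    simp [MIndex.halfEdges, Finsupp.weight_apply]
  rw [hw, ← h.2, halfEdgesForest, Finsupp.sum, Finsupp.sum, map_sum]
  exact Finset.sum_congr rfl fun γ _ => by rw [map_nsmul, ← hw, smul_eq_mul]

lemma decomps_finite (β : MIndex) : (decomps β).Finite :=
  (finite_forest_halfEdges_le β.halfEdges).subset fun _ h => (halfEdgesForest_of_decomps h).le

instance instFintypeDecomps (β : MIndex) : Fintype (decomps β) := (decomps_finite β).fintype

lemma decomps_lt {β : MIndex} (s : decomps β) (γ : s.1.support) :
    γ.1.halfEdges < β.halfEdges := by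
  have h0 := halfEdgesForest_of_decomps s.2
  have hγ : 0 < s.1 γ.1 := Nat.pos_of_ne_zero (Finsupp.mem_support_iff.1 γ.2)
  have h2 : (2 : ℕ) ≤ ∑ γ ∈ s.1.support, s.1 γ := s.2.1
  have hp := γ.1.halfEdges_pos
  rw [← h0, halfEdgesForest, Finsupp.sum, ← Finset.add_sum_erase _ _ γ.2]
  rw [← Finset.add_sum_erase _ _ γ.2] at h2
  have h3 : ∑ x ∈ s.1.support.erase γ.1, s.1 x ≤
      ∑ x ∈ s.1.support.erase γ.1, s.1 x * x.halfEdges :=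
    Finset.sum_le_sum fun x _ => Nat.le_mul_of_pos_right _ x.halfEdges_pos
  rcases Nat.lt_or_ge 1 (s.1 γ.1) with h4 | h4
  · nlinarith
  · have h5 : s.1 γ.1 = 1 := le_antisymm h4 hγ
    rw [h5] at h2 ⊢
    omega

/-- The product `∏ β(k)!`. -/
def MIndex.expFactorial (β : MIndex) : ℕ := β.exp.prod fun _ r => r.factorial

/-- The multinomial coefficient `∏_k β(k)! / ∏_i ∏_k β_i(k)!`, divided by `∏ r_j!` where the `r_j`
are the multiplicities of the distinct `β_i`: the number of ways to distribute the vertices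
of `z^β` into unordered groups of the types `β_i`. -/
def groupings (β : MIndex) (s : MForest) : ℝ :=
  (β.expFactorial : ℝ) / (s.prod fun γ r => (r.factorial : ℝ) * (γ.expFactorial : ℝ) ^ r)

/-- The valuation of a multi-index: the moment minus the contributions of all ways to
split `z^β` into at least two groups (that is, the joint cumulant), by recursion. -/
def MIndex.valuation {Λ Ω : Type*} [MeasurableSpace Λ] [MeasurableSpace Ω] (μ : Measure Λ)
    (P : Measure Ω) (X : Λ → Ω → ℝ) (β : MIndex) : ℝ :=
  moment μ P X β - ∑ s : decomps β,
    groupings β s.1 * ∏ γ : s.1.support, MIndex.valuation μ P X γ.1 ^ s.1 γ.1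
termination_by β.halfEdges
decreasing_by exact decomps_lt s γ

/-- The valuation, extended to forests multiplicatively and linearly. -/
def valuationM {Λ Ω : Type*} [MeasurableSpace Λ] [MeasurableSpace Ω] (μ : Measure Λ)
    (P : Measure Ω) (X : Λ → Ω → ℝ) : MvPolynomial MIndex ℝ →ₐ[ℝ] ℝ :=
  MvPolynomial.aeval (MIndex.valuation μ P X)

/-- The multi-index renormalisation `(Π_M (A_M ·) ⊗ id) Δ_M⁻`. -/
def renormM {Λ Ω : Type*} [MeasurableSpace Λ] [MeasurableSpace Ω] (μ : Measure Λ)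
    (P : Measure Ω) (X : Λ → Ω → ℝ) (l : ℝ) (d : ℕ) :
    MvPolynomial MIndex ℝ →ₐ[ℝ] MvPolynomial MIndex ℝ :=
  (Algebra.TensorProduct.lid ℝ (MvPolynomial MIndex ℝ)).toAlgHom.comp
    ((Algebra.TensorProduct.map ((valuationM μ P X).comp (antipodeM l d))
      (AlgHom.id ℝ (MvPolynomial MIndex ℝ))).comp (fullCoprodM l d))

end FeynmanRenorm

end

/-! The lift `𝒫` sends a multi-index to the sum of the diagrams above it, weighted by quotients of
symmetry factors, and it turns out to intertwine everything that the two renormalisations are made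
of. It is multiplicative for the forest product (`liftP_eq_liftAlg`): removing one component of a
forest in all possible ways accounts for the factorials in the symmetry factors. Hence it suffices
that it intertwines the coproducts and the valuations on a single multi-index; the antipodes
then follow by induction on the number of half-edges (`liftAlg_antipodeM`).

For the coproducts (`map_liftAlg_coprodM`), the dual statement is that inserting multi-indices
enumerates the insertions of diagrams: `D^k` reattaches `k` edges in all ways to the vertices of an
inserted diagram, and the derivatives `∂_{z_k}` select the vertices that are replaced
(`insertM_eq_sum`). An insertion together with an isomorphism onto a graph `G` is the same as a set
of edges of `G` with an identification of the subgraph it spans and of the contracted graph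
(`card_insertion_eq`). The identifications are counted by symmetry factors
(`ForestEmb.card_eq_of_forest`, `Graph.card_iso`), so that dividing by the symmetry
factor of `G` and summing over all `G` above `z^β` gives the coefficient of the coproduct
(`sum_extractions`).

For the valuations (`valuationM_eq`), the moments of the integrated Hermite polynomials are computed
by Wick's formula (`integral_hermiteProd`, from Gaussian integration by parts): a coefficient of a
power of a quadratic form, that is, a sum over the pairings of the legs that join distinct
vertices. A pairing contributes the product of the valuations of its connected components
(`Pairing.integral_prod_kernel`). Counting the pairings that form a given forest
(`Pairing.card_forest_eq`) shows that the moment is the sum over all splittings of `z^β` of the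
valuations of their lifts (`moment_eq_sum`), which is the recursion of the multi-index
valuation. -/

noncomputable section

namespace FeynmanRenorm

/-! ### Gaussian integration by parts -/

section Gaussian

open scoped ENNReal NNReal

lemma memLp_eval {V Ω : Type*} [MeasurableSpace Ω] {P : Measure Ω} [IsProbabilityMeasure P]
    {Y : V → Ω → ℝ} (h : ∀ v, ∀ p : ℝ≥0∞, p ≠ ∞ → MemLp (Y v) p P) (q : MvPolynomial V ℝ) :
    ∀ p : ℝ≥0∞, p ≠ ∞ → MemLp (fun ω => MvPolynomial.eval (fun v => Y v ω) q) p P := by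
  induction q using MvPolynomial.induction_on with
  | C a => intro p _; simpa using memLp_const a
  | add q r hq hr => intro p hp; simp only [map_add]; exact (hq p hp).add (hr p hp)
  | mul_X q v hq =>
    intro p hp
    have : ENNReal.HolderTriple (2 * p) (2 * p) p := ⟨by
      rw [ENNReal.mul_inv (by simp) (by simp), ← two_mul, ← mul_assoc,
        ENNReal.mul_inv_cancel (by simp) (by simp), one_mul]⟩
    have h2 : 2 * p ≠ ∞ := ENNReal.mul_ne_top (by simp) hp
    simpa using (h v _ h2).mul' (hq _ h2) (r := p)

lemma integrable_eval {V Ω : Type*} [MeasurableSpace Ω] {P : Measure Ω} [IsProbabilityMeasure P]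
    {Y : V → Ω → ℝ} (h : ∀ v, ∀ p : ℝ≥0∞, p ≠ ∞ → MemLp (Y v) p P) (q : MvPolynomial V ℝ) :
    Integrable (fun ω => MvPolynomial.eval (fun v => Y v ω) q) P :=
  memLp_one_iff_integrable.1 (memLp_eval h q 1 (by simp))

lemma integrable_pow_gaussianReal (v : ℝ≥0) (n : ℕ) :
    Integrable (fun x : ℝ => x ^ n) (gaussianReal 0 v) := by
  have := integrable_eval (P := gaussianReal 0 v) (Y := fun _ : Unit => id)
    (fun _ p hp => memLp_id_gaussianReal' p hp) (MvPolynomial.X () ^ n)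
  simpa using this

/-- Stein's identity for monomials of a centred Gaussian variable. -/
lemma integral_pow_succ_gaussianReal (v : ℝ≥0) (n : ℕ) :
    ∫ x, x ^ (n + 1) ∂(gaussianReal 0 v) = v * (n * ∫ x, x ^ (n - 1) ∂(gaussianReal 0 v)) := by
  by_cases hv : v = 0
  · subst hv; simp
  have hv' : (v : ℝ) ≠ 0 := by exact_mod_cast hv
  have hint : ∀ n : ℕ, Integrable (fun x : ℝ => x ^ n * gaussianPDFReal 0 v x) := by
    intro n
    have h := integrable_pow_gaussianReal v n
    rw [gaussianReal_of_var_ne_zero _ hv,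
      integrable_withDensity_iff (measurable_gaussianPDF _ _)
        (ae_of_all _ fun x => by simp [gaussianPDF])] at h
    refine h.congr (ae_of_all _ fun x => ?_)
    simp [gaussianPDF, ENNReal.toReal_ofReal (gaussianPDFReal_nonneg 0 v x)]
  have hd : ∀ x, HasDerivAt (gaussianPDFReal 0 v) (-(x / v) * gaussianPDFReal 0 v x) x := by
    intro x
    rw [gaussianPDFReal_def]
    have h1 : HasDerivAt (fun x : ℝ => -(x - 0) ^ 2 / (2 * v)) (-(x / v)) x := by
      have := ((((hasDerivAt_id x).sub_const 0).pow 2).neg).div_const (2 * (v : ℝ))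
      refine this.congr_deriv ?_
      simp
      field_simp
    refine ((h1.exp).const_mul (√(2 * Real.pi * v))⁻¹).congr_deriv ?_
    ring
  have key := integral_mul_deriv_eq_deriv_mul_of_integrable (u := fun x : ℝ => x ^ n)
    (u' := fun x => n * x ^ (n - 1)) (v := gaussianPDFReal 0 v)
    (v' := fun x => -(x / v) * gaussianPDFReal 0 v x)
    (fun x _ => hasDerivAt_pow n x) (fun x _ => hd x)
    ((hint (n + 1)).const_mul (-(v : ℝ)⁻¹) |>.congr (ae_of_all _ fun x => by
      simp only [Pi.mul_apply]; field_simp; try ring))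
    ((hint (n - 1)).const_mul (n : ℝ) |>.congr (ae_of_all _ fun x => by
      simp only [Pi.mul_apply]; ring))
    (hint n)
  rw [integral_gaussianReal_eq_integral_smul hv, integral_gaussianReal_eq_integral_smul hv]
  simp only [smul_eq_mul]
  have h1 : ∫ x, gaussianPDFReal 0 v x * x ^ (n + 1) =
      -(v : ℝ) * ∫ x : ℝ, x ^ n * (-(x / v) * gaussianPDFReal 0 v x) := by
    rw [← integral_const_mul]
    refine integral_congr_ae (ae_of_all _ fun x => ?_)
    simp only
    field_simp
    try ring
  rw [h1, key, ← integral_const_mul (n : ℝ)]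
  simp only [neg_mul_neg]
  congr 2
  ext x
  ring

/-- Gaussian integration by parts for a pair of independent arguments, of which only the Gaussian
variable `Z` is differentiated. -/
lemma integral_mul_eval_of_indep {T Ω : Type*} [MeasurableSpace Ω] {P : Measure Ω}
    [IsProbabilityMeasure P] {Z : Ω → ℝ} {U : T → Ω → ℝ} {v : ℝ≥0} (hZ : AEMeasurable Z P)
    (hlaw : P.map Z = gaussianReal 0 v)
    (hU : ∀ t, ∀ p : ℝ≥0∞, p ≠ ∞ → MemLp (U t) p P)
    (hind : IndepFun Z (fun ω t => U t ω) P) (q : Polynomial (MvPolynomial T ℝ)) :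
    ∫ ω, Z ω * (q.map (MvPolynomial.eval fun t => U t ω)).eval (Z ω) ∂P =
      v * ∫ ω, (q.derivative.map (MvPolynomial.eval fun t => U t ω)).eval (Z ω) ∂P := by
  have hZint : ∀ n : ℕ, Integrable (fun ω => Z ω ^ n) P := by
    intro n
    have := integrable_pow_gaussianReal v n
    rw [← hlaw] at this
    exact this.comp_aemeasurable hZ
  have hZmom : ∀ n : ℕ, ∫ ω, Z ω ^ n ∂P = ∫ x, x ^ n ∂(gaussianReal 0 v) := by
    intro n
    rw [← hlaw, integral_map hZ (by fun_prop)]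
  have hindep : ∀ (n : ℕ) (r : MvPolynomial T ℝ),
      IndepFun (fun ω => Z ω ^ n) (fun ω => MvPolynomial.eval (fun t => U t ω) r) P := by
    intro n r
    refine hind.comp (φ := fun x => x ^ n) (ψ := fun u => MvPolynomial.eval u r)
      (by fun_prop) ?_
    induction r using MvPolynomial.induction_on with
    | C a => simp
    | add q r hq hr => simp only [map_add]; exact hq.add hr
    | mul_X q t hq =>
      simp only [map_mul, MvPolynomial.eval_X]; exact hq.mul (measurable_pi_apply t)
  have hint : ∀ (n : ℕ) (r : MvPolynomial T ℝ),
      Integrable (fun ω => Z ω ^ n * MvPolynomial.eval (fun t => U t ω) r) P := fun n r =>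
    (hindep n r).integrable_mul (hZint n) (integrable_eval hU r)
  have hmul : ∀ (n : ℕ) (r : MvPolynomial T ℝ),
      ∫ ω, Z ω ^ n * MvPolynomial.eval (fun t => U t ω) r ∂P =
        (∫ x, x ^ n ∂(gaussianReal 0 v)) * ∫ ω, MvPolynomial.eval (fun t => U t ω) r ∂P := by
    intro n r
    rw [← hZmom]
    exact (hindep n r).integral_mul_eq_mul_integral (hZint n).1 (integrable_eval hU r).1
  have hints : ∀ (n : ℕ) (q : Polynomial (MvPolynomial T ℝ)), Integrable
      (fun ω => Z ω ^ n * (q.map (MvPolynomial.eval fun t => U t ω)).eval (Z ω)) P := by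
    intro n q
    induction q using Polynomial.induction_on' with
    | add q r hq hr =>
      simp only [Polynomial.map_add, Polynomial.eval_add, mul_add]; exact hq.add hr
    | monomial k r =>
      refine (hint (n + k) r).congr (ae_of_all _ fun ω => ?_)
      simp [Polynomial.map_monomial]; ring
  induction q using Polynomial.induction_on' with
  | add q r hq hr =>
    have h1 := hints 1 q
    have h2 := hints 1 r
    have h3 := hints 0 q.derivative
    have h4 := hints 0 r.derivative
    simp only [pow_one, pow_zero, one_mul] at h1 h2 h3 h4
    simp only [Polynomial.map_add, Polynomial.eval_add, Polynomial.derivative_add, mul_add]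
    rw [integral_add h1 h2, integral_add h3 h4, hq, hr]
    ring
  | monomial k r =>
    have e1 : ∀ ω, Z ω * (((Polynomial.monomial k) r).map
        (MvPolynomial.eval fun t => U t ω)).eval (Z ω) =
        Z ω ^ (k + 1) * MvPolynomial.eval (fun t => U t ω) r := fun ω => by
      simp [Polynomial.map_monomial]; ring
    have e2 : ∀ ω, ((((Polynomial.monomial k) r).derivative).map
        (MvPolynomial.eval fun t => U t ω)).eval (Z ω) =
        k * (Z ω ^ (k - 1) * MvPolynomial.eval (fun t => U t ω) r) := fun ω => by
      simp [Polynomial.map_monomial, Polynomial.derivative_monomial]; ring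
    simp only [e1, e2]
    rw [integral_const_mul, hmul, hmul, integral_pow_succ_gaussianReal]
    ring

/-- The chain rule for the substitution of `X w + c w * Z` for the variables. -/
lemma derivative_shift {V : Type*} [Fintype V] (c : V → ℝ) (q : MvPolynomial V ℝ) :
    (MvPolynomial.aeval (fun w => Polynomial.C (MvPolynomial.X w) +
      Polynomial.C (MvPolynomial.C (c w)) * Polynomial.X) q :
      Polynomial (MvPolynomial V ℝ)).derivative =
    ∑ w, Polynomial.C (MvPolynomial.C (c w)) * MvPolynomial.aeval (fun w =>
      Polynomial.C (MvPolynomial.X w) + Polynomial.C (MvPolynomial.C (c w)) * Polynomial.X)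
        (MvPolynomial.pderiv w q) := by
  classical
  set φ : MvPolynomial V ℝ →ₐ[ℝ] Polynomial (MvPolynomial V ℝ) :=
    MvPolynomial.aeval fun w =>
      Polynomial.C (MvPolynomial.X w) + Polynomial.C (MvPolynomial.C (c w)) * Polynomial.X with hφ
  have hX : ∀ t, φ (MvPolynomial.X t) = Polynomial.C (MvPolynomial.X t) +
    Polynomial.C (MvPolynomial.C (c t)) * Polynomial.X := fun t => by simp [hφ]
  clear_value φ
  induction q using MvPolynomial.induction_on with
  | C a =>
    rw [← MvPolynomial.algebraMap_eq, AlgHom.commutes]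
    simp [Polynomial.algebraMap_apply]
  | add q r hq hr => simp only [map_add, hq, hr, mul_add, Finset.sum_add_distrib]
  | mul_X q t hq =>
    have h1 : ∀ w, φ (MvPolynomial.pderiv w (q * MvPolynomial.X t)) =
        φ q * (if w = t then 1 else 0) + φ (MvPolynomial.X t) * φ (MvPolynomial.pderiv w q) := by
      intro w
      rw [Derivation.leibniz, map_add, smul_eq_mul, smul_eq_mul, map_mul, map_mul,
        MvPolynomial.pderiv_X, Pi.single_apply]
      simp only [eq_comm (a := t)]
      split_ifs <;> simp
    have h2 : (φ (MvPolynomial.X t)).derivative = Polynomial.C (MvPolynomial.C (c t)) := by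
      simp [hX]
    simp only [h1, map_mul, Polynomial.derivative_mul, hq, h2, mul_add, Finset.sum_add_distrib,
      Finset.sum_mul, mul_ite, mul_one, mul_zero, Finset.sum_ite_eq', Finset.mem_univ, if_true]
    have h3 : ∀ w, Polynomial.C (MvPolynomial.C (c w)) * φ (MvPolynomial.pderiv w q) *
        φ (MvPolynomial.X t) = Polynomial.C (MvPolynomial.C (c w)) *
          (φ (MvPolynomial.X t) * φ (MvPolynomial.pderiv w q)) := fun w => by
      rw [mul_assoc, mul_comm (φ (MvPolynomial.X t))]
    rw [Finset.sum_congr rfl fun w _ => h3 w, add_comm, mul_comm (φ q)]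

/-- Gaussian integration by parts (Stein's lemma, Isserlis' recursion) for polynomials of a centred
Gaussian family, which may be degenerate. The other variables are split into their regression on
`Y v` and an independent part. -/
theorem integral_mul_eval_gaussian {V Ω : Type*} [Fintype V] [MeasurableSpace Ω] {P : Measure Ω}
    [IsProbabilityMeasure P] {Y : V → Ω → ℝ} (hY : IsGaussianProcess Y P)
    (hmean : ∀ v, P[Y v] = 0) (v : V) (p : MvPolynomial V ℝ) :
    ∫ ω, Y v ω * MvPolynomial.eval (fun w => Y w ω) p ∂P =
      ∑ w, (∫ ω, Y v ω * Y w ω ∂P) *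
        ∫ ω, MvPolynomial.eval (fun w => Y w ω) (MvPolynomial.pderiv w p) ∂P := by
  have hL : ∀ w, ∀ q : ℝ≥0∞, q ≠ ∞ → MemLp (Y w) q P := fun w q hq =>
    (hY.hasGaussianLaw_eval w).memLp hq
  have hL2 : ∀ w, MemLp (Y w) 2 P := fun w => hL w 2 (by simp)
  have hcov : ∀ w, cov[Y v, Y w; P] = ∫ ω, Y v ω * Y w ω ∂P := fun w => by
    rw [covariance_eq_sub (hL2 v) (hL2 w), hmean, hmean]; simp
  have hvar : Var[Y v; P] = ∫ ω, Y v ω * Y v ω ∂P := by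
    rw [← hcov, covariance_self (hL2 v).1.aemeasurable]
  by_cases hv : Var[Y v; P] = 0
  · have h0 : ∀ᵐ ω ∂P, Y v ω = 0 := by
      have := ae_eq_integral_of_variance_eq_zero (hL2 v) hv
      simpa [hmean] using this
    rw [integral_eq_zero_of_ae (h0.mono fun ω h => by simp [h])]
    refine (Finset.sum_eq_zero fun w _ => ?_).symm
    rw [integral_eq_zero_of_ae (h0.mono fun ω h => by simp [h]), zero_mul]
  set c : V → ℝ := fun w => (∫ ω, Y v ω * Y w ω ∂P) / Var[Y v; P] with hc
  set U : V → Ω → ℝ := fun w ω => Y w ω - c w * Y v ω with hUdef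
  have hU : ∀ t, ∀ q : ℝ≥0∞, q ≠ ∞ → MemLp (U t) q P := fun t q hq =>
    (hL t q hq).sub ((hL v q hq).const_mul _)
  have hproc : IsGaussianProcess (Sum.elim (fun _ : Unit => Y v) U) P := by
    classical
    refine hY.of_isGaussianProcess fun s => ?_
    rcases s with s | w
    · exact ⟨{v}, ContinuousLinearMap.proj ⟨v, by simp⟩, fun ω => rfl⟩
    · exact ⟨{v, w}, ContinuousLinearMap.proj ⟨w, by simp⟩ -
        c w • ContinuousLinearMap.proj ⟨v, by simp⟩, fun ω => rfl⟩
  have hind : IndepFun (Y v) (fun ω t => U t ω) P := by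
    have h := hproc.indepFun_of_covariance_eq_zero
      (fun _ => (hL2 v).1.aemeasurable) (fun t => (hU t 2 (by simp)).1.aemeasurable) ?_
    · exact h.comp (φ := fun f : Unit → ℝ => f ()) (ψ := id) (by fun_prop) measurable_id
    · intro _ t
      have h1 : cov[Y v, fun ω => Y t ω - c t * Y v ω; P] = 0 := by
        rw [covariance_fun_sub_right (hL2 v) (hL2 t) ((hL2 v).const_mul _),
          covariance_const_mul_right, covariance_self (hL2 v).1.aemeasurable, hcov, hc]
        field_simp
        ring
      exact h1
  have hlaw : P.map (Y v) = gaussianReal 0 Var[Y v; P].toNNReal := by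
    rw [(hY.hasGaussianLaw_eval v).map_eq_gaussianReal, hmean]
  -- expand `p (U + c Z)` as a polynomial in `Z`
  let φ : MvPolynomial V ℝ →ₐ[ℝ] Polynomial (MvPolynomial V ℝ) :=
    MvPolynomial.aeval fun w =>
      Polynomial.C (MvPolynomial.X w) + Polynomial.C (MvPolynomial.C (c w)) * Polynomial.X
  have hφ : ∀ (q : MvPolynomial V ℝ) ω,
      ((φ q).map (MvPolynomial.eval fun t => U t ω)).eval (Y v ω) =
        MvPolynomial.eval (fun w => Y w ω) q := by
    intro q ω
    induction q using MvPolynomial.induction_on with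
    | C a =>
      have : φ (MvPolynomial.C a) = Polynomial.C (MvPolynomial.C a) := by
        simp [φ, MvPolynomial.algebraMap_eq, Polynomial.algebraMap_apply]
      simp [this]
    | add q r hq hr => simp [hq, hr]
    | mul_X q t hq => simp [hq, φ, U]
  have hder : ∀ q : MvPolynomial V ℝ, (φ q).derivative =
      ∑ w, Polynomial.C (MvPolynomial.C (c w)) * φ (MvPolynomial.pderiv w q) :=
    derivative_shift c
  have key := integral_mul_eval_of_indep (hL2 v).1.aemeasurable hlaw hU hind (φ p)
  simp only [hφ, hder, Polynomial.map_sum, Polynomial.eval_finsetSum, Polynomial.map_mul,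
    Polynomial.map_C, MvPolynomial.eval_C, Polynomial.eval_mul, Polynomial.eval_C] at key
  rw [key, integral_finsetSum _ fun w _ => (integrable_eval hL _).const_mul _, Finset.mul_sum]
  refine Finset.sum_congr rfl fun w _ => ?_
  rw [integral_const_mul, Real.coe_toNNReal _ (variance_nonneg _ _), hc]
  field_simp

end Gaussian

/-! ### Hermite polynomials and Wick's formula -/

section Wick

/-- The Hermite polynomials with variance `v`, by their recursion. In contrast to `hermiteVar` they
are the monomials for `v = 0`. -/
def hermitePoly (v : ℝ) : ℕ → Polynomial ℝ
  | 0 => 1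
  | n + 1 => Polynomial.X * hermitePoly v n - Polynomial.C v * (hermitePoly v n).derivative

lemma derivative_hermitePoly_succ (v : ℝ) (n : ℕ) :
    (hermitePoly v (n + 1)).derivative = (n + 1 : ℕ) * hermitePoly v n := by
  induction n with
  | zero => simp [hermitePoly]
  | succ n ih =>
    rw [hermitePoly]
    simp only [Polynomial.derivative_sub, Polynomial.derivative_mul, Polynomial.derivative_X,
      Polynomial.derivative_C, ih, Polynomial.derivative_natCast, zero_mul, zero_add, one_mul]
    rw [hermitePoly]
    push_cast
    ring

lemma derivative_hermitePoly (v : ℝ) (n : ℕ) :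
    (hermitePoly v n).derivative = (n : ℕ) * hermitePoly v (n - 1) := by
  cases n with
  | zero => simp [hermitePoly]
  | succ n => exact derivative_hermitePoly_succ v n

lemma hermiteVar_eq_eval {v : ℝ} (hv : v ≠ 0) (n : ℕ) (x : ℝ) :
    hermiteVar n v x = (hermitePoly v n).eval x := by
  have key : ∀ n : ℕ, iteratedDeriv n (fun y : ℝ => Real.exp (-y ^ 2 / (2 * v))) =
      fun y => (-v)⁻¹ ^ n * ((hermitePoly v n).eval y * Real.exp (-y ^ 2 / (2 * v))) := by
    intro n
    induction n with
    | zero => ext y; simp [hermitePoly]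
    | succ n ih =>
      rw [iteratedDeriv_succ, ih]
      ext y
      have h1 : HasDerivAt (fun y : ℝ => -y ^ 2 / (2 * v)) (-(y / v)) y := by
        have := (((hasDerivAt_id y).pow 2).neg).div_const (2 * v)
        refine this.congr_deriv ?_
        simp
        field_simp
      have h2 := (((hermitePoly v n).hasDerivAt y).mul h1.exp).const_mul ((-v)⁻¹ ^ n)
      refine Eq.trans (HasDerivAt.deriv h2) ?_
      simp only [hermitePoly, Polynomial.eval_sub, Polynomial.eval_mul, Polynomial.eval_X,
        Polynomial.eval_C, pow_succ]
      generalize (-v)⁻¹ ^ n = c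
      field_simp
      ring
  rw [hermiteVar, key]
  have h1 : Real.exp (x ^ 2 / (2 * v)) * Real.exp (-x ^ 2 / (2 * v)) = 1 := by
    rw [← Real.exp_add, neg_div, add_neg_cancel, Real.exp_zero]
  have h2 : (-v) ^ n * (-v)⁻¹ ^ n = 1 := by
    rw [← mul_pow, mul_inv_cancel₀ (neg_ne_zero.2 hv), one_pow]
  calc _ = ((-v) ^ n * (-v)⁻¹ ^ n) * (Real.exp (x ^ 2 / (2 * v)) * Real.exp (-x ^ 2 / (2 * v))) *
        (hermitePoly v n).eval x := by ring
    _ = _ := by rw [h1, h2]; ring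

lemma hermiteVar_zero (n : ℕ) (hn : n ≠ 0) (x : ℝ) : hermiteVar n 0 x = 0 := by
  simp [hermiteVar, hn]

/-- The Leibniz rule for a finite product. -/
lemma derivation_prod {R A ι : Type*} [CommRing R] [CommRing A] [Algebra R A] [DecidableEq ι]
    (D : Derivation R A A) (s : Finset ι) (f : ι → A) :
    D (∏ i ∈ s, f i) = ∑ i ∈ s, (∏ j ∈ s.erase i, f j) * D (f i) := by
  induction s using Finset.induction_on with
  | empty => simp
  | insert i s hi ih =>
    rw [Finset.prod_insert hi, Derivation.leibniz, ih, Finset.sum_insert hi,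
      Finset.erase_insert hi, smul_eq_mul, smul_eq_mul, add_comm, Finset.mul_sum]
    congr 1
    refine Finset.sum_congr rfl fun j hj => ?_
    have hij : i ≠ j := fun h => hi (h ▸ hj)
    rw [Finset.erase_insert_of_ne hij, Finset.prod_insert (by simp [hi]), mul_assoc]

variable {V : Type*} [Fintype V]

/-- The product of the Hermite polynomials `H_{a v}` in independent variables. -/
def hermiteProd (σ : ℝ) (a : V →₀ ℕ) : MvPolynomial V ℝ :=
  ∏ v, Polynomial.aeval (MvPolynomial.X v) (hermitePoly σ (a v))

lemma eval_hermiteProd (σ : ℝ) (a : V →₀ ℕ) (y : V → ℝ) :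
    MvPolynomial.eval y (hermiteProd σ a) = ∏ v, (hermitePoly σ (a v)).eval (y v) := by
  rw [hermiteProd, map_prod]
  refine Finset.prod_congr rfl fun v _ => ?_
  have := Polynomial.hom_eval₂ (hermitePoly σ (a v)) (algebraMap ℝ (MvPolynomial V ℝ))
    (MvPolynomial.eval y) (MvPolynomial.X v)
  rw [← Polynomial.aeval_def] at this
  rw [this, MvPolynomial.eval_X, Polynomial.eval, Polynomial.eval₂_congr _ rfl rfl]
  ext r
  simp [MvPolynomial.algebraMap_eq]

variable [DecidableEq V]

lemma pderiv_hermiteProd (σ : ℝ) (a : V →₀ ℕ) (w : V) :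
    MvPolynomial.pderiv w (hermiteProd σ a) =
      (a w : MvPolynomial V ℝ) * hermiteProd σ (a - Finsupp.single w 1) := by
  rw [hermiteProd, derivation_prod, Finset.sum_eq_single w]
  · rw [Derivation.map_aeval, MvPolynomial.pderiv_X_self, smul_eq_mul, mul_one,
      derivative_hermitePoly, hermiteProd, ← Finset.prod_erase_mul _ _ (Finset.mem_univ w)]
    have : ∏ v ∈ Finset.univ.erase w, Polynomial.aeval (MvPolynomial.X v : MvPolynomial V ℝ)
        (hermitePoly σ ((a - Finsupp.single w 1 : V →₀ ℕ) v)) =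
        ∏ v ∈ Finset.univ.erase w, Polynomial.aeval (MvPolynomial.X v)
        (hermitePoly σ (a v)) := by
      refine Finset.prod_congr rfl fun v hv => ?_
      have hne : w ≠ v := (Finset.ne_of_mem_erase hv).symm
      simp [hne]
    rw [this]
    simp
    ring
  · intro v _ hv
    rw [Derivation.map_aeval, MvPolynomial.pderiv_X_of_ne hv, smul_zero, mul_zero]
  · simp

lemma hermiteProd_add_single (σ : ℝ) (a : V →₀ ℕ) (v : V) :
    hermiteProd σ (a + Finsupp.single v 1) = MvPolynomial.X v * hermiteProd σ a -
      MvPolynomial.C σ * MvPolynomial.pderiv v (hermiteProd σ a) := by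
  have hder : MvPolynomial.pderiv v (hermiteProd σ a) =
      (∏ w ∈ Finset.univ.erase v, Polynomial.aeval (MvPolynomial.X w) (hermitePoly σ (a w))) *
        Polynomial.aeval (MvPolynomial.X v) (hermitePoly σ (a v)).derivative := by
    rw [hermiteProd, derivation_prod, Finset.sum_eq_single v]
    · rw [Derivation.map_aeval, MvPolynomial.pderiv_X_self, smul_eq_mul, mul_one]
    · intro w _ hw
      rw [Derivation.map_aeval, MvPolynomial.pderiv_X_of_ne hw, smul_zero, mul_zero]
    · simp
  rw [hder, hermiteProd, hermiteProd, ← Finset.prod_erase_mul _ _ (Finset.mem_univ v),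
    ← Finset.prod_erase_mul (a := v) _ _ (Finset.mem_univ v)]
  have : ∏ w ∈ Finset.univ.erase v, Polynomial.aeval (MvPolynomial.X w : MvPolynomial V ℝ)
      (hermitePoly σ ((a + Finsupp.single v 1 : V →₀ ℕ) w)) =
      ∏ w ∈ Finset.univ.erase v, Polynomial.aeval (MvPolynomial.X w) (hermitePoly σ (a w)) := by
    refine Finset.prod_congr rfl fun w hw => ?_
    have hne : v ≠ w := (Finset.ne_of_mem_erase hw).symm
    simp [hne]
  rw [this]
  simp [hermitePoly, MvPolynomial.algebraMap_eq]
  ring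

/-- The quadratic form `½ ∑ B v w X_v X_w`. -/
def quadForm (B : V → V → ℝ) : MvPolynomial V ℝ :=
  ∑ p : V × V, MvPolynomial.C (B p.1 p.2 / 2) * (MvPolynomial.X p.1 * MvPolynomial.X p.2)

lemma pderiv_quadForm (B : V → V → ℝ) (hB : ∀ v w, B v w = B w v) (v : V) :
    MvPolynomial.pderiv v (quadForm B) =
      ∑ w, MvPolynomial.C (B v w) * MvPolynomial.X w := by
  have h : ∀ p : V × V, MvPolynomial.pderiv v
      (MvPolynomial.C (B p.1 p.2 / 2) * (MvPolynomial.X p.1 * MvPolynomial.X p.2)) =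
      (if p.2 = v then MvPolynomial.C (B p.1 v / 2) * MvPolynomial.X p.1 else 0) +
      (if p.1 = v then MvPolynomial.C (B v p.2 / 2) * MvPolynomial.X p.2 else 0) := by
    intro p
    rw [MvPolynomial.pderiv_C_mul, Derivation.leibniz, MvPolynomial.pderiv_X,
      MvPolynomial.pderiv_X, Pi.single_apply, Pi.single_apply, smul_eq_mul, smul_eq_mul, mul_add]
    congr 1
    · split_ifs with h <;> simp [h]
    · split_ifs with h <;> simp [h]
  rw [quadForm, map_sum, Finset.sum_congr rfl fun p _ => h p, Finset.sum_add_distrib,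
    Fintype.sum_prod_type, Fintype.sum_prod_type_right]
  simp only [Finset.sum_ite_eq', Finset.mem_univ, if_true]
  rw [← Finset.sum_add_distrib]
  refine Finset.sum_congr rfl fun w _ => ?_
  rw [hB w v, ← add_mul, ← map_add, add_halves]

/-- Wick's formula for Hermite polynomials of centred Gaussian variables of equal variance: only
pairs of distinct vertices are contracted. -/
theorem integral_hermiteProd {Ω : Type*} [MeasurableSpace Ω] {P : Measure Ω}
    [IsProbabilityMeasure P] {Y : V → Ω → ℝ} (hY : IsGaussianProcess Y P)
    (hmean : ∀ v, P[Y v] = 0) {σ : ℝ} (hσ : ∀ v, ∫ ω, Y v ω * Y v ω ∂P = σ) (m : ℕ)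
    (a : V →₀ ℕ) (ha : ∑ v, a v = 2 * m) :
    ∫ ω, MvPolynomial.eval (fun v => Y v ω) (hermiteProd σ a) ∂P =
      (∏ v, ((a v).factorial : ℝ)) * (MvPolynomial.coeff a (quadForm (fun v w =>
        if v = w then 0 else ∫ ω, Y v ω * Y w ω ∂P) ^ m) / m.factorial) := by
  set B : V → V → ℝ := fun v w => if v = w then 0 else ∫ ω, Y v ω * Y w ω ∂P with hB
  have hBs : ∀ v w, B v w = B w v := fun v w => by
    simp only [hB, eq_comm (a := v), mul_comm (Y v _)]
  have hL : ∀ w, ∀ q : ENNReal, q ≠ ⊤ → MemLp (Y w) q P := fun w q hq =>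
    (hY.hasGaussianLaw_eval w).memLp hq
  induction m generalizing a with
  | zero =>
    have h0 : a = 0 := by
      ext v
      have := Finset.sum_eq_zero_iff.1 ha v (Finset.mem_univ v)
      simpa using this
    subst h0
    simp [hermiteProd, hermitePoly]
  | succ m ih =>
    -- A leg at `v` is integrated by parts; its contractions with the other legs at `v` cancel
    -- against the lower-order term of the Hermite recursion, so only off-diagonal ones remain.
    obtain ⟨v, hv⟩ : ∃ v, a v ≠ 0 := by
      by_contra! h
      simp [h] at ha
    obtain ⟨a, rfl⟩ : ∃ b : V →₀ ℕ, a = b + Finsupp.single v 1 := ⟨a - Finsupp.single v 1, by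
      ext w
      by_cases h : v = w
      · subst h; simp; omega
      · simp [h]⟩
    have hsum : ∑ w, a w = 2 * m + 1 := by
      simp only [Finsupp.add_apply, Finset.sum_add_distrib, Finsupp.single_apply,
        Finset.sum_ite_eq, Finset.mem_univ, if_true] at ha
      omega
    have hfac : ∏ w, (((a + Finsupp.single v 1 : V →₀ ℕ) w).factorial : ℝ) =
        (a v + 1) * ∏ w, ((a w).factorial : ℝ) := by
      rw [← Finset.mul_prod_erase _ _ (Finset.mem_univ v),
        ← Finset.mul_prod_erase _ (fun w => ((a w).factorial : ℝ)) (Finset.mem_univ v)]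
      have : ∏ w ∈ Finset.univ.erase v, (((a + Finsupp.single v 1 : V →₀ ℕ) w).factorial : ℝ) =
          ∏ w ∈ Finset.univ.erase v, ((a w).factorial : ℝ) := by
        refine Finset.prod_congr rfl fun w hw => ?_
        have hne : v ≠ w := (Finset.ne_of_mem_erase hw).symm
        simp [hne]
      rw [this]
      simp [Nat.factorial_succ]
      ring
    have hfac2 : ∀ w, a w ≠ 0 → (a w : ℝ) * ∏ u, (((a - Finsupp.single w 1 : V →₀ ℕ) u).factorial : ℝ) =
        ∏ w, ((a w).factorial : ℝ) := by
      intro w hw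
      rw [← Finset.mul_prod_erase _ _ (Finset.mem_univ w),
        ← Finset.mul_prod_erase _ (fun w => ((a w).factorial : ℝ)) (Finset.mem_univ w)]
      have : ∏ u ∈ Finset.univ.erase w, (((a - Finsupp.single w 1 : V →₀ ℕ) u).factorial : ℝ) =
          ∏ u ∈ Finset.univ.erase w, ((a u).factorial : ℝ) := by
        refine Finset.prod_congr rfl fun u hu => ?_
        have hne : w ≠ u := (Finset.ne_of_mem_erase hu).symm
        simp [hne]
      rw [this, ← mul_assoc]
      congr 1
      simp only [Finsupp.coe_tsub, Pi.sub_apply, Finsupp.single_eq_same]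
      exact_mod_cast Nat.mul_factorial_pred hw
    have hstep : ∫ ω, MvPolynomial.eval (fun w => Y w ω)
        (hermiteProd σ (a + Finsupp.single v 1)) ∂P = ∑ w, B v w * ∫ ω, MvPolynomial.eval
          (fun w => Y w ω) (MvPolynomial.pderiv w (hermiteProd σ a)) ∂P := by
      rw [hermiteProd_add_single]
      have h1 := integral_mul_eval_gaussian hY hmean v (hermiteProd σ a)
      have i1 : Integrable (fun ω => Y v ω * MvPolynomial.eval (fun w => Y w ω)
          (hermiteProd σ a)) P := by
        have := integrable_eval hL (MvPolynomial.X v * hermiteProd σ a)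
        simpa only [map_mul, MvPolynomial.eval_X] using this
      have i2 := integrable_eval hL (MvPolynomial.pderiv v (hermiteProd σ a))
      simp only [map_sub, map_mul, MvPolynomial.eval_X, MvPolynomial.eval_C]
      rw [integral_sub i1 (i2.const_mul _), h1, integral_const_mul,
        ← Finset.add_sum_erase _ _ (Finset.mem_univ v), hσ, add_sub_cancel_left,
        ← Finset.add_sum_erase Finset.univ (fun w => B v w * _) (Finset.mem_univ v)]
      simp only [hB, if_true, zero_mul, zero_add]
      refine Finset.sum_congr rfl fun w hw => ?_
      rw [if_neg (Finset.ne_of_mem_erase hw).symm]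
    have hterm : ∀ w, B v w * ∫ ω, MvPolynomial.eval
          (fun w => Y w ω) (MvPolynomial.pderiv w (hermiteProd σ a)) ∂P =
        (∏ w, ((a w).factorial : ℝ)) / m.factorial *
          MvPolynomial.coeff a (MvPolynomial.C (B v w) * MvPolynomial.X w * quadForm B ^ m) := by
      intro w
      rw [mul_assoc, MvPolynomial.coeff_C_mul, MvPolynomial.coeff_X_mul', pderiv_hermiteProd]
      simp only [map_mul, map_natCast]
      rw [integral_const_mul]
      by_cases hw : a w = 0
      · simp [hw]
      · rw [if_pos (by simpa using hw), ih]
        · rw [← hfac2 w hw]; ring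
        · have : ∑ u, (a - Finsupp.single w 1 : V →₀ ℕ) u + 1 = ∑ u, a u := by
            have hle : Finsupp.single w 1 ≤ a := by
              rw [Finsupp.single_le_iff]; omega
            conv_rhs => rw [← tsub_add_cancel_of_le hle]
            simp only [Finsupp.add_apply, Finset.sum_add_distrib, Finsupp.single_apply,
              Finset.sum_ite_eq, Finset.mem_univ, if_true]
          omega
    rw [hstep, Finset.sum_congr rfl fun w _ => hterm w, ← Finset.mul_sum, hfac]
    -- The power of the quadratic form obeys the same recursion, by differentiating it in `v`.
    have hcoef := MvPolynomial.coeff_pderiv (i := v) (quadForm B ^ (m + 1)) a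
    rw [MvPolynomial.pderiv_pow, pderiv_quadForm B hBs] at hcoef
    have h2 : ((m + 1 : ℕ) : MvPolynomial V ℝ) * quadForm B ^ (m + 1 - 1) *
        ∑ w, MvPolynomial.C (B v w) * MvPolynomial.X w =
        MvPolynomial.C ((m + 1 : ℕ) : ℝ) *
          ∑ w, MvPolynomial.C (B v w) * MvPolynomial.X w * quadForm B ^ m := by
      rw [← Finset.sum_mul, map_natCast]
      simp only [Nat.add_sub_cancel]
      ring
    rw [h2, MvPolynomial.coeff_C_mul, MvPolynomial.coeff_sum] at hcoef
    have h3 : (m.factorial : ℝ) ≠ 0 := by positivity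
    rw [Nat.factorial_succ]
    push_cast at hcoef ⊢
    field_simp
    linear_combination hcoef

end Wick

/-! ### Counting isomorphisms -/

section Counting

/-- The number of times each value is taken. -/
def fiberCount {I D : Type*} [Fintype I] (f : I → D) : D →₀ ℕ := ∑ i, Finsupp.single (f i) 1

lemma fiberCount_apply {I D : Type*} [Fintype I] (f : I → D) (d : D) :
    fiberCount f d = Nat.card {i // f i = d} := by
  classical
  rw [fiberCount, Finsupp.finsetSum_apply, Nat.card_eq_fintype_card, Fintype.card_subtype]
  simp [Finsupp.single_apply]

lemma fiberCount_comp_equiv {I J D : Type*} [Fintype I] [Fintype J] (g : J → D) (e : I ≃ J) :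
    fiberCount (fun i => g (e i)) = fiberCount g :=
  Fintype.sum_equiv e _ _ fun _ => rfl

lemma exists_equiv_of_fiberCount {I J D : Type*} [Fintype I] [Fintype J] {f : I → D} {g : J → D}
    (h : fiberCount f = fiberCount g) : ∃ e : I ≃ J, ∀ i, g (e i) = f i := by
  have h1 : ∀ d, Nonempty ({i // f i = d} ≃ {j // g j = d}) := fun d => by
    refine (Finite.card_eq).1 ?_
    rw [← fiberCount_apply, ← fiberCount_apply, h]
  exact ⟨Equiv.ofFiberEquiv fun d => (h1 d).some, Equiv.ofFiberEquiv_map _⟩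

/-- The number of bijections compatible with two colourings: the colour classes are matched, and
each may be permuted. -/
lemma card_equiv_of_fiberCount {I J D : Type*} [Fintype I] [Fintype J] {f : I → D} {g : J → D}
    (h : fiberCount f = fiberCount g) :
    Nat.card {e : I ≃ J // ∀ i, g (e i) = f i} = (fiberCount f).prod fun _ r => r.factorial := by
  classical
  obtain ⟨e₀, he₀⟩ := exists_equiv_of_fiberCount h
  have e1 : {e : I ≃ J // ∀ i, g (e i) = f i} ≃ {p : Equiv.Perm I // f ∘ p = f} :=
    { toFun := fun e => ⟨e.1.trans e₀.symm, by
        ext i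
        have := he₀ (e₀.symm (e.1 i))
        rw [Equiv.apply_symm_apply] at this
        simp [← this, e.2 i]⟩
      invFun := fun p => ⟨p.1.trans e₀, fun i => by
        rw [Equiv.trans_apply, he₀]; exact congrFun p.2 i⟩
      left_inv := fun e => by ext; simp
      right_inv := fun p => by ext; simp }
  rw [Nat.card_congr e1, Nat.card_eq_fintype_card, DomMulAct.stabilizer_card']
  have hs : (fiberCount f).support = Finset.univ.image f := by
    ext d
    rw [Finsupp.mem_support_iff, fiberCount_apply, Nat.card_ne_zero, Finset.mem_image]
    constructor
    · rintro ⟨⟨i, hi⟩, _⟩; exact ⟨i, Finset.mem_univ _, hi⟩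
    · rintro ⟨i, _, hi⟩; exact ⟨⟨⟨i, hi⟩⟩, inferInstance⟩
  rw [Finsupp.prod, hs]
  refine Finset.prod_congr rfl fun d _ => ?_
  rw [fiberCount_apply, Nat.card_eq_fintype_card]

/-- The members of a finite multiset, given by multiplicities. -/
abbrev Members {D : Type*} (F : D →₀ ℕ) : Type _ := Σ d : F.support, Fin (F d)

lemma fiberCount_members {D : Type*} (F : D →₀ ℕ) :
    fiberCount (fun i : Members F => i.1.1) = F := by
  classical
  rw [fiberCount, Fintype.sum_sigma]
  simp only [Finset.sum_const, Finset.card_univ, Fintype.card_fin]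
  rw [Finset.sum_coe_sort F.support fun d => F d • Finsupp.single d 1]
  ext d
  simpa [Finsupp.finsetSum_apply, Finsupp.single_apply] using Eq.symm

lemma prod_fiberCount {I D M : Type*} [Fintype I] [CommMonoid M] (f : I → D) (g : D → M) :
    (fiberCount f).prod (fun d r => g d ^ r) = ∏ i, g (f i) := by
  rw [fiberCount, ← Finsupp.prod_finsetSum_index (fun _ => pow_zero _) (fun _ _ _ => pow_add _ _ _)]
  exact Finset.prod_congr rfl fun i _ => by simp

end Counting

namespace Graph.Iso

@[ext]
lemma ext' {G H : Graph} {f g : G.Iso H} (h1 : ∀ v, f.onV v = g.onV v)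
    (h2 : ∀ e, f.onE e = g.onE e) : f = g := by
  obtain ⟨fV, fE, _⟩ := f
  obtain ⟨gV, gE, _⟩ := g
  obtain rfl : fV = gV := Equiv.ext h1
  obtain rfl : fE = gE := Equiv.ext h2
  rfl

instance (G H : Graph) : Finite (G.Iso H) :=
  Finite.of_injective (fun f : G.Iso H => (f.onV, f.onE)) fun f g h => by
    have h1 := congrArg Prod.fst h
    have h2 := congrArg Prod.snd h
    exact ext' (fun v => congrArg (· v) h1) (fun e => congrArg (· e) h2)

/-- The inverse isomorphism. -/
def symm {G H : Graph} (f : G.Iso H) : H.Iso G where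
  onV := f.onV.symm
  onE := f.onE.symm
  ends e := by
    have h := f.ends (f.onE.symm e)
    rw [Equiv.apply_symm_apply] at h
    have h2 := congrArg (Sym2.map f.onV.symm) h
    simpa using h2.symm

/-- The composition of isomorphisms. -/
def trans {G H J : Graph} (f : G.Iso H) (g : H.Iso J) : G.Iso J where
  onV := f.onV.trans g.onV
  onE := f.onE.trans g.onE
  ends e := by
    have h := congrArg (Sym2.map g.onV) (f.ends e)
    simp only [Sym2.map_mk] at h
    rw [Equiv.trans_apply, g.ends, h]
    rfl

/-- Isomorphisms between isomorphic graphs correspond to each other. -/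
def congr {G G' H H' : Graph} (f : G.Iso G') (g : H.Iso H') : G.Iso H ≃ G'.Iso H' where
  toFun k := (f.symm.trans k).trans g
  invFun k := (f.trans k).trans g.symm
  left_inv k := by ext <;> simp [symm, trans]
  right_inv k := by ext <;> simp [symm, trans]

lemma diagram_eq {G H : Graph} (f : G.Iso H) : G.diagram = H.diagram :=
  Quotient.sound (s := Graph.setoid) ⟨f⟩

end Graph.Iso

lemma Graph.exists_iso_of_diagram_eq {G H : Graph} (h : G.diagram = H.diagram) :
    Nonempty (G.Iso H) :=
  Quotient.exact (s := Graph.setoid) h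

lemma Diagram.diagram_graph (Γ : Diagram) : Γ.graph.diagram = Γ := Quotient.out_eq Γ

lemma Graph.card_iso (G H : Graph) (h : G.diagram = H.diagram) :
    Nat.card (G.Iso H) = G.diagram.symm := by
  obtain ⟨f⟩ := G.diagram_graph_iso
  obtain ⟨g⟩ := Graph.exists_iso_of_diagram_eq h
  exact (Nat.card_congr (Graph.Iso.congr f (f.trans g))).symm

lemma Graph.isEmpty_iso (G H : Graph) (h : G.diagram ≠ H.diagram) : IsEmpty (G.Iso H) :=
  ⟨fun f => h f.diagram_eq⟩

lemma Diagram.symm_pos (Γ : Diagram) : 0 < Γ.symm := by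
  have : Nonempty (Γ.graph.Iso Γ.graph) := ⟨⟨Equiv.refl _, Equiv.refl _, fun _ => rfl⟩⟩
  exact Nat.card_pos

lemma symmF_pos (F : DiagramForest) : 0 < symmF F :=
  Finset.prod_pos fun Γ _ => Nat.mul_pos (Nat.factorial_pos _) (pow_pos Γ.symm_pos _)

/-! ### Forests of components -/

/-- The forest of the connected components of the subgraph with edge set `A`. -/
def Graph.componentForest (G : Graph) (A : Finset G.E) : DiagramForest :=
  fiberCount fun c : G.Component A => (G.component A c).diagram

/-- An identification of the disjoint union of the graphs `Γ i` with the subgraph of `G` with edge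
set `A` (without isolated vertices). -/
@[ext]
structure ForestEmb {I : Type*} (Γ : I → Graph) (G : Graph) (A : Finset G.E) where
  onV : (Σ i, (Γ i).V) → G.V
  onE : (Σ i, (Γ i).E) → G.E
  injV : Function.Injective onV
  injE : Function.Injective onE
  mem_iff : ∀ e, e ∈ A ↔ ∃ x, onE x = e
  ends : ∀ i e, s(G.src (onE ⟨i, e⟩), G.tgt (onE ⟨i, e⟩)) =
    s(onV ⟨i, (Γ i).src e⟩, onV ⟨i, (Γ i).tgt e⟩)

namespace ForestEmb

variable {I : Type*} {Γ : I → Graph} {G : Graph} {A : Finset G.E}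

lemma onE_mem (φ : ForestEmb Γ G A) (x : Σ i, (Γ i).E) : φ.onE x ∈ A := (φ.mem_iff _).2 ⟨x, rfl⟩

lemma rel_of_mem {A : Finset G.E} {e : G.E} (he : e ∈ A) {x y : G.V}
    (h : s(G.src e, G.tgt e) = s(x, y)) : G.rel A x y := by
  have h0 : G.rel A (G.src e) (G.tgt e) := Relation.EqvGen.rel _ _ ⟨e, he, rfl, rfl⟩
  rcases Sym2.eq_iff.1 h with ⟨rfl, rfl⟩ | ⟨rfl, rfl⟩
  · exact h0
  · exact (G.rel A).symm h0

lemma rel_onV (φ : ForestEmb Γ G A) (i : I) (u u' : (Γ i).V) :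
    G.rel A (φ.onV ⟨i, u⟩) (φ.onV ⟨i, u'⟩) := by
  induction (Γ i).connected u u' with
  | rel a b h =>
    obtain ⟨e, rfl, rfl⟩ := h
    exact rel_of_mem (φ.onE_mem ⟨i, e⟩) (φ.ends i e)
  | refl a => exact (G.rel A).refl _
  | symm a b _ ih => exact (G.rel A).symm ih
  | trans a b c _ _ ih1 ih2 => exact (G.rel A).trans ih1 ih2

/-- The classes of `G.rel A` are single vertices and the vertex sets of the `Γ i`. -/
lemma rel_iff (φ : ForestEmb Γ G A) (x y : G.V) : G.rel A x y ↔
    x = y ∨ ∃ i u u', φ.onV ⟨i, u⟩ = x ∧ φ.onV ⟨i, u'⟩ = y := by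
  constructor
  · intro h
    change Relation.EqvGen _ x y at h
    induction h with
    | rel a b h =>
      obtain ⟨e, he, rfl, rfl⟩ := h
      obtain ⟨⟨i, x⟩, rfl⟩ := (φ.mem_iff e).1 he
      right
      rcases Sym2.eq_iff.1 (φ.ends i x) with ⟨h1, h2⟩ | ⟨h1, h2⟩
      · exact ⟨i, _, _, h1.symm, h2.symm⟩
      · exact ⟨i, _, _, h1.symm, h2.symm⟩
    | refl a => exact Or.inl rfl
    | symm a b _ ih =>
      rcases ih with rfl | ⟨i, u, u', h1, h2⟩
      · exact Or.inl rfl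
      · exact Or.inr ⟨i, u', u, h2, h1⟩
    | trans a b c _ _ ih1 ih2 =>
      rcases ih1 with rfl | ⟨i, u, u', h1, h2⟩
      · exact ih2
      rcases ih2 with rfl | ⟨j, w, w', h3, h4⟩
      · exact Or.inr ⟨i, u, u', h1, h2⟩
      obtain ⟨rfl, hw⟩ := Sigma.mk.inj_iff.1 (φ.injV (h2.trans h3.symm))
      exact Or.inr ⟨i, u, w', h1, h4⟩
  · rintro (rfl | ⟨i, u, u', rfl, rfl⟩)
    · exact (G.rel A).refl _
    · exact φ.rel_onV i u u'

/-- The embedding given by isomorphisms with the components. -/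
def ofIso (e : I ≃ G.Component A) (f : ∀ i, (Γ i).Iso (G.component A (e i))) :
    ForestEmb Γ G A where
  onV x := ((f x.1).onV x.2).1
  onE x := ((f x.1).onE x.2).1
  injV := by
    rintro ⟨i, u⟩ ⟨j, w⟩ h
    have hi := ((f i).onV u).2
    have hj := ((f j).onV w).2
    obtain rfl : i = j := e.injective (Subtype.ext (hi.symm.trans ((congrArg _ h).trans hj)))
    exact congrArg _ ((f i).onV.injective (Subtype.ext h))
  injE := by
    rintro ⟨i, u⟩ ⟨j, w⟩ h
    have hi := ((f i).onE u).2.2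
    have hj := ((f j).onE w).2.2
    obtain rfl : i = j := e.injective (Subtype.ext (hi.symm.trans
      ((congrArg (fun e => Quotient.mk (G.rel A) (G.src e)) h).trans hj)))
    exact congrArg _ ((f i).onE.injective (Subtype.ext h))
  mem_iff a := by
    constructor
    · intro ha
      obtain ⟨i, hi⟩ := e.surjective ⟨Quotient.mk (G.rel A) (G.src a), a, ha, rfl⟩
      obtain ⟨x, hx⟩ := (f i).onE.surjective ⟨a, ha, by rw [hi]⟩
      exact ⟨⟨i, x⟩, congrArg Subtype.val hx⟩
    · rintro ⟨⟨i, x⟩, rfl⟩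
      exact ((f i).onE x).2.1
  ends i x := by
    exact congrArg (Sym2.map Subtype.val) ((f i).ends x)

lemma ofIso_injective : Function.Injective
    fun p : (Σ e : I ≃ G.Component A, ∀ i, (Γ i).Iso (G.component A (e i))) =>
      ofIso p.1 p.2 := by
  rintro ⟨e, f⟩ ⟨e', f'⟩ h
  have hV : ∀ i u, ((f i).onV u).1 = ((f' i).onV u).1 := fun i u =>
    congrFun (congrArg ForestEmb.onV h) ⟨i, u⟩
  have hE : ∀ i u, ((f i).onE u).1 = ((f' i).onE u).1 := fun i u =>
    congrFun (congrArg ForestEmb.onE h) ⟨i, u⟩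
  obtain rfl : e = e' := by
    ext i
    obtain ⟨x⟩ := (Γ i).nonempty_E
    have h1 := ((f i).onV ((Γ i).src x)).2
    have h2 := ((f' i).onV ((Γ i).src x)).2
    rw [← hV] at h2
    exact Subtype.ext (h1.symm.trans h2)
  congr 1
  funext i
  exact Graph.Iso.ext' (fun v => Subtype.ext (hV i v)) (fun e => Subtype.ext (hE i e))

lemma ofIso_surjective : Function.Surjective
    fun p : (Σ e : I ≃ G.Component A, ∀ i, (Γ i).Iso (G.component A (e i))) =>
      ofIso p.1 p.2 := by
  intro φ
  have hmk : ∀ i u u', Quotient.mk (G.rel A) (φ.onV ⟨i, u⟩) = Quotient.mk _ (φ.onV ⟨i, u'⟩) :=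
    fun i u u' => Quotient.sound (φ.rel_onV i u u')
  have hsrc : ∀ i x u, Quotient.mk (G.rel A) (G.src (φ.onE ⟨i, x⟩)) =
      Quotient.mk _ (φ.onV ⟨i, u⟩) := by
    intro i x u
    have := φ.ends i x
    rcases Sym2.eq_iff.1 this with ⟨h1, h2⟩ | ⟨h1, h2⟩
    · rw [h1]; exact hmk _ _ _
    · rw [h1]; exact hmk _ _ _
  have hpt : ∀ i, ∃ u : (Γ i).V, True := fun i => by
    obtain ⟨x⟩ := (Γ i).nonempty_E
    exact ⟨(Γ i).src x, trivial⟩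
  choose pt _ using hpt
  let c : I → G.Component A := fun i => ⟨Quotient.mk _ (φ.onV ⟨i, pt i⟩), by
    obtain ⟨x⟩ := (Γ i).nonempty_E
    exact ⟨_, φ.onE_mem ⟨i, x⟩, hsrc i x _⟩⟩
  have hc : Function.Bijective c := by
    constructor
    · intro i j h
      have h1 := Quotient.exact (congrArg Subtype.val h)
      rcases (φ.rel_iff _ _).1 h1 with h2 | ⟨k, u, u', h2, h3⟩
      · exact congrArg Sigma.fst (φ.injV h2)
      · exact (congrArg Sigma.fst (φ.injV h2)).symm.trans (congrArg Sigma.fst (φ.injV h3))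
    · rintro ⟨q, a, ha, rfl⟩
      obtain ⟨⟨i, x⟩, rfl⟩ := (φ.mem_iff a).1 ha
      exact ⟨i, Subtype.ext (hsrc i x _).symm⟩
  have hV : ∀ i, Function.Bijective (fun u : (Γ i).V =>
      (⟨φ.onV ⟨i, u⟩, hmk _ _ _⟩ : (G.component A (c i)).V)) := by
    intro i
    constructor
    · intro u u' h
      have := φ.injV (congrArg Subtype.val h)
      simpa using this
    · rintro ⟨v, hv⟩
      rcases (φ.rel_iff _ _).1 (Quotient.exact hv) with h | ⟨k, u, u', h1, h2⟩
      · exact ⟨_, Subtype.ext h.symm⟩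
      · obtain ⟨rfl, _⟩ := Sigma.mk.inj_iff.1 (φ.injV h2)
        exact ⟨u, Subtype.ext h1⟩
  have hE : ∀ i, Function.Bijective (fun x : (Γ i).E =>
      (⟨φ.onE ⟨i, x⟩, φ.onE_mem _, hsrc i x _⟩ : (G.component A (c i)).E)) := by
    intro i
    constructor
    · intro u u' h
      have := φ.injE (congrArg Subtype.val h)
      simpa using this
    · rintro ⟨a, ha, hq⟩
      obtain ⟨⟨j, x⟩, rfl⟩ := (φ.mem_iff a).1 ha
      obtain rfl : j = i := hc.1 (Subtype.ext ((hsrc j x _).symm.trans hq))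
      exact ⟨x, rfl⟩
  refine ⟨⟨Equiv.ofBijective c hc, fun i => ⟨Equiv.ofBijective _ (hV i), Equiv.ofBijective _ (hE i),
    fun x => ?_⟩⟩, rfl⟩
  apply Sym2.map.injective (f := Subtype.val) Subtype.val_injective
  exact φ.ends i x

lemma card_eq_of_forest {I : Type*} [Fintype I] (Γ : I → Graph) (G : Graph) (A : Finset G.E)
    (h : fiberCount (fun i => (Γ i).diagram) = G.componentForest A) :
    Nat.card (ForestEmb Γ G A) = symmF (G.componentForest A) := by
  classical
  rw [← Nat.card_congr (Equiv.ofBijective _ ⟨ofIso_injective, ofIso_surjective⟩), Nat.card_sigma]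
  have h1 : ∀ e : I ≃ G.Component A, Nat.card (∀ i, (Γ i).Iso (G.component A (e i))) =
      if ∀ i, (G.component A (e i)).diagram = (Γ i).diagram then ∏ i, (Γ i).diagram.symm else 0 := by
    intro e
    rw [Nat.card_pi]
    split_ifs with h
    · exact Finset.prod_congr rfl fun i _ => Graph.card_iso _ _ (h i).symm
    · push Not at h
      obtain ⟨i, hi⟩ := h
      refine Finset.prod_eq_zero (Finset.mem_univ i) ?_
      have := Graph.isEmpty_iso (Γ i) (G.component A (e i)) hi.symm
      exact Nat.card_of_isEmpty
  rw [Finset.sum_congr rfl fun e _ => h1 e, ← Finset.sum_filter, Finset.sum_const, smul_eq_mul,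
    ← Fintype.card_subtype, ← Nat.card_eq_fintype_card, card_equiv_of_fiberCount h, ← h]
  rw [← prod_fiberCount (fun i => (Γ i).diagram) Diagram.symm, symmF, ← Finsupp.prod_mul]

end ForestEmb

/-! ### Insertion of diagrams, and its duality with extraction and contraction -/

/-- The data needed to insert graphs `Γ i` into a graph `H`: distinct vertices of `H` to be replaced
by them, and for every edge at such a vertex the vertex of `Γ i` to which it is reattached. -/
abbrev Insertion {I : Type} (Γ : I → Graph) (H : Graph) : Type :=
  Σ j : I ↪ H.V, ∀ i, {e : H.E // H.src e = j i ∨ H.tgt e = j i} → (Γ i).V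

namespace Insertion

variable {I : Type} {Γ : I → Graph} {H : Graph}

/-- The vertices after insertion: those of the inserted graphs and those not replaced. -/
abbrev Vert (s : Insertion Γ H) : Type := (Σ i, (Γ i).V) ⊕ {v : H.V // v ∉ Set.range s.1}

/-- The vertex of `H` which a vertex comes from. -/
def proj (s : Insertion Γ H) : s.Vert → H.V := Sum.elim (fun x => s.1 x.1) Subtype.val

open Classical in
/-- The vertex to which the edge `e` at `v` is attached after insertion. -/
def place (s : Insertion Γ H) (e : H.E) (v : H.V) (h : H.src e = v ∨ H.tgt e = v) : s.Vert :=
  if hv : ∃ i, s.1 i = v then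
    Sum.inl ⟨hv.choose, s.2 hv.choose ⟨e, by rw [hv.choose_spec]; exact h⟩⟩
  else Sum.inr ⟨v, hv⟩

lemma place_at (s : Insertion Γ H) (e : H.E) (i : I) (h : H.src e = s.1 i ∨ H.tgt e = s.1 i) :
    s.place e (s.1 i) h = Sum.inl ⟨i, s.2 i ⟨e, h⟩⟩ := by
  have hv : ∃ k, s.1 k = s.1 i := ⟨i, rfl⟩
  have key : ∀ k (hk : s.1 k = s.1 i) (h' : H.src e = s.1 k ∨ H.tgt e = s.1 k),
      (Sum.inl ⟨k, s.2 k ⟨e, h'⟩⟩ : s.Vert) = Sum.inl ⟨i, s.2 i ⟨e, h⟩⟩ := by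
    intro k hk h'
    obtain rfl := s.1.injective hk
    rfl
  rw [place, dif_pos hv]
  exact key _ hv.choose_spec _

lemma place_of_notMem (s : Insertion Γ H) (e : H.E) (v : H.V) (h : H.src e = v ∨ H.tgt e = v)
    (hv : v ∉ Set.range s.1) : s.place e v h = Sum.inr ⟨v, hv⟩ :=
  dif_neg hv

lemma proj_place (s : Insertion Γ H) (e : H.E) (v : H.V) (h : H.src e = v ∨ H.tgt e = v) :
    s.proj (s.place e v h) = v := by
  by_cases hv : v ∈ Set.range s.1
  · obtain ⟨i, rfl⟩ := hv
    rw [place_at]; rfl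
  · rw [place_of_notMem _ _ _ _ hv]; rfl

lemma proj_eq_iff (s : Insertion Γ H) (w w' : s.Vert) : s.proj w = s.proj w' ↔
    w = w' ∨ ∃ i u u', w = Sum.inl ⟨i, u⟩ ∧ w' = Sum.inl ⟨i, u'⟩ := by
  constructor
  · intro h
    rcases w with ⟨i, u⟩ | ⟨v, hv⟩ <;> rcases w' with ⟨i', u'⟩ | ⟨v', hv'⟩
    · obtain rfl := s.1.injective h
      exact Or.inr ⟨i, u, u', rfl, rfl⟩
    · exact absurd ⟨i, h⟩ hv'
    · exact absurd ⟨i', h.symm⟩ hv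
    · left
      congr 2
  · rintro (rfl | ⟨i, u, u', rfl, rfl⟩) <;> rfl

lemma proj_surjective (s : Insertion Γ H) : Function.Surjective s.proj := by
  intro v
  by_cases hv : v ∈ Set.range s.1
  · obtain ⟨i, rfl⟩ := hv
    obtain ⟨x⟩ := (Γ i).nonempty_E
    exact ⟨Sum.inl ⟨i, (Γ i).src x⟩, rfl⟩
  · exact ⟨Sum.inr ⟨v, hv⟩, rfl⟩

variable [Fintype I]

/-- The graph obtained by insertion. -/
abbrev graph (s : Insertion Γ H) : Graph where
  V := s.Vert
  E := (Σ i, (Γ i).E) ⊕ H.E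
  fintypeV := Fintype.ofFinite _
  fintypeE := inferInstance
  src := Sum.elim (fun x => Sum.inl ⟨x.1, (Γ x.1).src x.2⟩)
    fun e => s.place e (H.src e) (Or.inl rfl)
  tgt := Sum.elim (fun x => Sum.inl ⟨x.1, (Γ x.1).tgt x.2⟩)
    fun e => s.place e (H.tgt e) (Or.inr rfl)
  src_ne_tgt := by
    rintro (⟨i, x⟩ | e) h
    · simp only [Sum.elim_inl, Sum.inl.injEq, Sigma.mk.inj_iff, heq_eq_eq, true_and] at h
      exact (Γ i).src_ne_tgt x h
    · have := congrArg s.proj h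
      simp only [Sum.elim_inr, proj_place] at this
      exact H.src_ne_tgt e this
  connected := by
    set R : s.Vert → s.Vert → Prop := fun a b => ∃ y : (Σ i, (Γ i).E) ⊕ H.E,
      Sum.elim (fun x : Σ i, (Γ i).E => (Sum.inl ⟨x.1, (Γ x.1).src x.2⟩ : s.Vert))
        (fun e => s.place e (H.src e) (Or.inl rfl)) y = a ∧
      Sum.elim (fun x : Σ i, (Γ i).E => (Sum.inl ⟨x.1, (Γ x.1).tgt x.2⟩ : s.Vert))
        (fun e => s.place e (H.tgt e) (Or.inr rfl)) y = b with hR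
    have hfib : ∀ w w', s.proj w = s.proj w' → Relation.EqvGen R w w' := by
      intro w w' h
      rcases (s.proj_eq_iff w w').1 h with rfl | ⟨i, u, u', rfl, rfl⟩
      · exact Relation.EqvGen.refl _
      clear h
      suffices ∀ a b, Relation.EqvGen (fun a b => ∃ e, (Γ i).src e = a ∧ (Γ i).tgt e = b) a b →
          Relation.EqvGen R (Sum.inl ⟨i, a⟩) (Sum.inl ⟨i, b⟩) from this u u' ((Γ i).connected _ _)
      intro a b h
      induction h with
      | rel a b h =>
        obtain ⟨e, rfl, rfl⟩ := h
        exact Relation.EqvGen.rel _ _ ⟨Sum.inl ⟨i, e⟩, rfl, rfl⟩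
      | refl a => exact Relation.EqvGen.refl _
      | symm a b _ ih => exact Relation.EqvGen.symm _ _ ih
      | trans a b c _ _ ih1 ih2 => exact Relation.EqvGen.trans _ _ _ ih1 ih2
    have key : ∀ a b, Relation.EqvGen (fun a b => ∃ e, H.src e = a ∧ H.tgt e = b) a b →
        ∀ w w', s.proj w = a → s.proj w' = b → Relation.EqvGen R w w' := by
      intro a b h
      induction h with
      | rel a b h =>
        obtain ⟨e, rfl, rfl⟩ := h
        intro w w' hw hw'
        refine Relation.EqvGen.trans _ _ _ (hfib w _ (hw.trans (s.proj_place e _ (Or.inl rfl)).symm))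
          (Relation.EqvGen.trans _ _ _ ?_
            (hfib _ w' (hw'.trans (s.proj_place e _ (Or.inr rfl)).symm).symm))
        exact Relation.EqvGen.rel _ _ ⟨Sum.inr e, rfl, rfl⟩
      | refl a => intro w w' hw hw'; exact hfib _ _ (hw.trans hw'.symm)
      | symm a b _ ih => intro w w' hw hw'; exact Relation.EqvGen.symm _ _ (ih _ _ hw' hw)
      | trans a b c _ _ ih1 ih2 =>
        intro w w' hw hw'
        obtain ⟨x, hx⟩ := s.proj_surjective b
        exact Relation.EqvGen.trans _ _ _ (ih1 w x hw hx) (ih2 x w' hx hw')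
    exact fun w w' => key _ _ (H.connected _ _) w w' rfl rfl
  nonempty_E := by
    obtain ⟨e⟩ := H.nonempty_E
    exact ⟨Sum.inr e⟩

end Insertion

/-- An exhibition of `G` as the result of inserting the graphs `Γ i` into `H`: the embedding of the
`Γ i`, the projection of the vertices of `G` onto those of `H`, and the edges of `H` in `G`. It
amounts to an insertion and an isomorphism of its result with `G`, and also to an extractable
subgraph of `G` with identifications of its components and of its contraction. -/
@[ext]
structure Exhibit {I : Type} (Γ : I → Graph) (H G : Graph) where
  onV : (Σ i, (Γ i).V) → G.V
  onE : (Σ i, (Γ i).E) → G.E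
  proj : G.V → H.V
  edge : H.E → G.E
  injV : Function.Injective onV
  bijE : Function.Bijective (Sum.elim onE edge)
  ends : ∀ i e, s(G.src (onE ⟨i, e⟩), G.tgt (onE ⟨i, e⟩)) =
    s(onV ⟨i, (Γ i).src e⟩, onV ⟨i, (Γ i).tgt e⟩)
  ends_edge : ∀ e, s(proj (G.src (edge e)), proj (G.tgt (edge e))) = s(H.src e, H.tgt e)
  surj : Function.Surjective proj
  proj_eq_iff : ∀ x y, proj x = proj y ↔
    x = y ∨ ∃ i u u', onV ⟨i, u⟩ = x ∧ onV ⟨i, u'⟩ = y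

namespace Exhibit

variable {I : Type} [Fintype I] {Γ : I → Graph} {H G : Graph}

/-- The exhibition given by an insertion. -/
def ofInsertion (s : Insertion Γ H) (f : s.graph.Iso G) : Exhibit Γ H G where
  onV x := f.onV (Sum.inl x)
  onE x := f.onE (Sum.inl x)
  proj v := s.proj (f.onV.symm v)
  edge e := f.onE (Sum.inr e)
  injV x y h := Sum.inl_injective (f.onV.injective h)
  bijE := by
    have : Sum.elim (fun x => f.onE (Sum.inl x)) (fun e => f.onE (Sum.inr e)) = f.onE := by
      funext x
      cases x <;> rfl
    rw [this]
    exact f.onE.bijective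
  ends i e := f.ends (Sum.inl ⟨i, e⟩)
  ends_edge e := by
    have := congrArg (Sym2.map fun v => s.proj (f.onV.symm v)) (f.ends (Sum.inr e))
    simp only [Sym2.map_mk, Equiv.symm_apply_apply] at this
    rw [this]
    exact congrArg₂ (fun a b => s(a, b)) (s.proj_place e _ (Or.inl rfl))
      (s.proj_place e _ (Or.inr rfl))
  surj := s.proj_surjective.comp f.onV.symm.surjective
  proj_eq_iff x y := by
    rw [s.proj_eq_iff]
    refine or_congr f.onV.symm.injective.eq_iff ?_
    refine exists_congr fun i => exists_congr fun u => exists_congr fun u' => and_congr ?_ ?_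
    · exact f.onV.symm_apply_eq.trans eq_comm
    · exact f.onV.symm_apply_eq.trans eq_comm

lemma ofInsertion_injective : Function.Injective
    fun p : (Σ s : Insertion Γ H, s.graph.Iso G) => ofInsertion p.1 p.2 := by
  rintro ⟨s, f⟩ ⟨t, g⟩ h
  have hV : ∀ x, f.onV (Sum.inl x) = g.onV (Sum.inl x) := fun x =>
    congrFun (congrArg Exhibit.onV h) x
  have hE : ∀ x, f.onE (Sum.inl x) = g.onE (Sum.inl x) := fun x =>
    congrFun (congrArg Exhibit.onE h) x
  have hP : ∀ x, s.proj (f.onV.symm x) = t.proj (g.onV.symm x) := fun x =>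
    congrFun (congrArg Exhibit.proj h) x
  have hX : ∀ x, f.onE (Sum.inr x) = g.onE (Sum.inr x) := fun x =>
    congrFun (congrArg Exhibit.edge h) x
  have hj : ∀ i, s.1 i = t.1 i := by
    intro i
    obtain ⟨x⟩ := (Γ i).nonempty_E
    have h1 := hP (f.onV (Sum.inl ⟨i, (Γ i).src x⟩))
    rw [Equiv.symm_apply_apply, hV, Equiv.symm_apply_apply] at h1
    exact h1
  obtain ⟨j, att⟩ := s
  obtain ⟨j', att'⟩ := t
  obtain rfl : j = j' := Function.Embedding.ext hj
  have hplace : ∀ (e : H.E) (v : H.V) (hv : H.src e = v ∨ H.tgt e = v),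
      f.onV (Insertion.place ⟨j, att⟩ e v hv) = g.onV (Insertion.place ⟨j, att'⟩ e v hv) := by
    intro e v hv
    -- both are the end of the same edge which lies over `v`
    have m1 : f.onV (Insertion.place ⟨j, att⟩ e v hv) ∈
        s(G.src (f.onE (Sum.inr e)), G.tgt (f.onE (Sum.inr e))) := by
      rw [f.ends]
      rcases hv with rfl | rfl
      · exact Sym2.mem_mk_left _ _
      · exact Sym2.mem_mk_right _ _
    have m2 : g.onV (Insertion.place ⟨j, att'⟩ e v hv) ∈
        s(G.src (f.onE (Sum.inr e)), G.tgt (f.onE (Sum.inr e))) := by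
      rw [hX, g.ends]
      rcases hv with rfl | rfl
      · exact Sym2.mem_mk_left _ _
      · exact Sym2.mem_mk_right _ _
    have p1 : Insertion.proj ⟨j, att⟩ (f.onV.symm (f.onV (Insertion.place ⟨j, att⟩ e v hv))) =
        v := by rw [Equiv.symm_apply_apply]; exact Insertion.proj_place _ _ _ _
    have p2 : Insertion.proj ⟨j, att⟩ (f.onV.symm (g.onV (Insertion.place ⟨j, att'⟩ e v hv))) =
        v := by rw [hP, Equiv.symm_apply_apply]; exact Insertion.proj_place _ _ _ _
    have hne := H.src_ne_tgt e
    have hee := (ofInsertion ⟨j, att⟩ f).ends_edge e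
    by_contra hcon
    have := (Sym2.mem_and_mem_iff hcon).1 ⟨m1, m2⟩
    have h2 := congrArg (Sym2.map fun x => Insertion.proj ⟨j, att⟩ (f.onV.symm x)) this
    simp only [Sym2.map_mk] at h2
    rw [p1, p2] at h2
    have h3 := hee.symm.trans h2
    rw [Sym2.eq_iff] at h3
    rcases h3 with ⟨h4, h5⟩ | ⟨h4, h5⟩ <;> exact hne (h4.trans h5.symm)
  obtain rfl : att = att' := by
    funext i ⟨e, he⟩
    have h1 := hplace e (j i) he
    rw [Insertion.place_at ⟨j, att⟩ e i he, Insertion.place_at ⟨j, att'⟩ e i he, hV] at h1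
    have h2 := Sum.inl_injective (g.onV.injective h1)
    simpa using h2
  congr 1
  refine Graph.Iso.ext' ?_ ?_
  · rintro (x | ⟨v, hv⟩)
    · exact hV x
    · apply f.onV.symm.injective
      have h1 := hP (g.onV (Sum.inr ⟨v, hv⟩))
      rw [Equiv.symm_apply_apply] at h1
      rw [Equiv.symm_apply_apply]
      rcases (Insertion.proj_eq_iff ⟨j, att⟩ (f.onV.symm (g.onV (Sum.inr ⟨v, hv⟩)))
        (Sum.inr ⟨v, hv⟩)).1 h1 with h2 | ⟨i, u, u', h2, h3⟩
      · exact h2.symm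
      · cases h3
  · rintro (x | x)
    · exact hE x
    · exact hX x

lemma ofInsertion_surjective : Function.Surjective
    fun p : (Σ s : Insertion Γ H, s.graph.Iso G) => ofInsertion p.1 p.2 := by
  intro D
  have hpt : ∀ i, ∃ u : (Γ i).V, True := fun i => by
    obtain ⟨x⟩ := (Γ i).nonempty_E
    exact ⟨(Γ i).src x, trivial⟩
  choose pt _ using hpt
  have hproj : ∀ i u u', D.proj (D.onV ⟨i, u⟩) = D.proj (D.onV ⟨i, u'⟩) := fun i u u' =>
    (D.proj_eq_iff _ _).2 (Or.inr ⟨i, u, u', rfl, rfl⟩)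
  let j : I ↪ H.V := ⟨fun i => D.proj (D.onV ⟨i, pt i⟩), fun i i' h => by
    rcases (D.proj_eq_iff _ _).1 h with h1 | ⟨k, u, u', h1, h2⟩
    · exact congrArg Sigma.fst (D.injV h1)
    · exact (congrArg Sigma.fst (D.injV h1)).symm.trans (congrArg Sigma.fst (D.injV h2))⟩
  have hend : ∀ (e : H.E) (v : H.V), (H.src e = v ∨ H.tgt e = v) →
      ∃ x ∈ s(G.src (D.edge e), G.tgt (D.edge e)), D.proj x = v := by
    intro e v hv
    have h1 : v ∈ s(D.proj (G.src (D.edge e)), D.proj (G.tgt (D.edge e))) := by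
      rw [D.ends_edge]
      rcases hv with rfl | rfl
      · exact Sym2.mem_mk_left _ _
      · exact Sym2.mem_mk_right _ _
    rcases Sym2.mem_iff.1 h1 with h2 | h2
    · exact ⟨_, Sym2.mem_mk_left _ _, h2.symm⟩
    · exact ⟨_, Sym2.mem_mk_right _ _, h2.symm⟩
  have hatt : ∀ i (e : {e : H.E // H.src e = j i ∨ H.tgt e = j i}),
      ∃ u, D.onV ⟨i, u⟩ ∈ s(G.src (D.edge e), G.tgt (D.edge e)) := by
    rintro i ⟨e, he⟩
    obtain ⟨x, hx, hxv⟩ := hend e _ he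
    rcases (D.proj_eq_iff x (D.onV ⟨i, pt i⟩)).1 hxv with rfl | ⟨k, u, u', h1, h2⟩
    · exact ⟨_, hx⟩
    · obtain ⟨rfl, _⟩ := Sigma.mk.inj_iff.1 (D.injV h2)
      exact ⟨u, h1 ▸ hx⟩
  choose att hatt using hatt
  let s : Insertion Γ H := ⟨j, att⟩
  choose pre hpre using D.surj
  let F : s.Vert → G.V := Sum.elim D.onV fun v => pre v.1
  have hFproj : ∀ w, D.proj (F w) = s.proj w := by
    rintro (⟨i, u⟩ | ⟨v, hv⟩)
    · exact hproj _ _ _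
    · exact hpre v
  have hF : Function.Bijective F := by
    constructor
    · intro w w' h
      have h1 : s.proj w = s.proj w' := by rw [← hFproj, ← hFproj, h]
      rcases (s.proj_eq_iff w w').1 h1 with h2 | ⟨i, u, u', rfl, rfl⟩
      · exact h2
      · exact congrArg Sum.inl (D.injV h)
    · intro x
      by_cases hx : D.proj x ∈ Set.range j
      · obtain ⟨i, hi⟩ := hx
        rcases (D.proj_eq_iff x (D.onV ⟨i, pt i⟩)).1 hi.symm with h1 | ⟨k, u, u', h1, h2⟩
        · exact ⟨Sum.inl ⟨i, pt i⟩, h1.symm⟩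
        · exact ⟨Sum.inl ⟨k, u⟩, h1⟩
      · refine ⟨Sum.inr ⟨D.proj x, hx⟩, ?_⟩
        rcases (D.proj_eq_iff (pre (D.proj x)) x).1 (hpre _) with h1 | ⟨k, u, u', h1, h2⟩
        · exact h1
        · exact absurd ⟨k, by rw [← h2]; exact hproj _ _ _⟩ hx
  have hplace : ∀ (e : H.E) (v : H.V) (hv : H.src e = v ∨ H.tgt e = v),
      F (s.place e v hv) ∈ s(G.src (D.edge e), G.tgt (D.edge e)) := by
    intro e v hv
    by_cases hr : v ∈ Set.range s.1
    · obtain ⟨i, rfl⟩ := hr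
      rw [s.place_at]
      exact hatt i ⟨e, hv⟩
    · rw [s.place_of_notMem _ _ _ hr]
      obtain ⟨x, hx, hxv⟩ := hend e v hv
      rcases (D.proj_eq_iff x (pre v)).1 (hxv.trans (hpre v).symm) with h1 | ⟨k, u, u', h1, h2⟩
      · subst h1; exact hx
      · exact absurd ⟨k, by rw [← hxv, ← h1]; exact hproj _ _ _⟩ hr
  let f : s.graph.Iso G :=
    { onV := Equiv.ofBijective F hF
      onE := Equiv.ofBijective _ D.bijE
      ends := by
        rintro (⟨i, x⟩ | e)
        · exact D.ends i x
        · have hne : F (s.place e (H.src e) (Or.inl rfl)) ≠ F (s.place e (H.tgt e) (Or.inr rfl)) := by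
            intro h
            have := congrArg D.proj h
            rw [hFproj, hFproj, s.proj_place, s.proj_place] at this
            exact H.src_ne_tgt e this
          exact (Sym2.mem_and_mem_iff hne).1 ⟨hplace e _ _, hplace e _ _⟩ }
  refine ⟨⟨s, f⟩, ?_⟩
  apply Exhibit.ext
  · rfl
  · rfl
  · funext x
    obtain ⟨w, rfl⟩ := f.onV.surjective x
    change s.proj (f.onV.symm (f.onV w)) = _
    rw [Equiv.symm_apply_apply]
    exact (hFproj w).symm
  · rfl

end Exhibit

/-- The sets of edges that can be contracted. -/
abbrev Graph.Contractible (G : Graph) : Type :=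
  {A : Finset G.E // A ≠ Finset.univ ∧ ∀ e, e ∉ A → ¬ (G.rel A).r (G.src e) (G.tgt e)}

/-- The contraction of a contractible set of edges. -/
abbrev Graph.Contractible.quot {G : Graph} (A : G.Contractible) : Graph :=
  G.contract A.1 A.2.1 A.2.2

namespace Exhibit

variable {I : Type} {Γ : I → Graph} {H G : Graph}

/-- The exhibition given by an extraction. -/
def ofExtraction (A : G.Contractible) (φ : ForestEmb Γ G A.1) (χ : H.Iso A.quot) :
    Exhibit Γ H G where
  onV := φ.onV
  onE := φ.onE
  proj v := χ.onV.symm (Quotient.mk (G.rel A.1) v)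
  edge e := (χ.onE e).1
  injV := φ.injV
  bijE := by
    constructor
    · rintro (x | e) (y | e') h
      · exact congrArg Sum.inl (φ.injE h)
      · refine absurd (φ.onE_mem x) ?_
        have : φ.onE x = (χ.onE e').1 := h
        rw [this]; exact (χ.onE e').2
      · refine absurd (φ.onE_mem y) ?_
        have : (χ.onE e).1 = φ.onE y := h
        rw [← this]; exact (χ.onE e).2
      · exact congrArg Sum.inr (χ.onE.injective (Subtype.ext h))
    · intro e
      by_cases he : e ∈ A.1
      · obtain ⟨x, hx⟩ := (φ.mem_iff e).1 he
        exact ⟨Sum.inl x, hx⟩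
      · obtain ⟨x, hx⟩ := χ.onE.surjective ⟨e, he⟩
        exact ⟨Sum.inr x, congrArg Subtype.val hx⟩
  ends := φ.ends
  ends_edge e := by
    have := congrArg (Sym2.map χ.onV.symm) (χ.ends e)
    simp only [Sym2.map_mk, Equiv.symm_apply_apply] at this
    exact this
  surj v := by
    obtain ⟨x, hx⟩ := Quotient.exists_rep (χ.onV v)
    exact ⟨x, (congrArg χ.onV.symm hx).trans (χ.onV.symm_apply_apply v)⟩
  proj_eq_iff x y :=
    χ.onV.symm.injective.eq_iff.trans (Quotient.eq.trans (φ.rel_iff x y))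

lemma ofExtraction_injective : Function.Injective
    fun p : (Σ A : G.Contractible, ForestEmb Γ G A.1 × H.Iso A.quot) =>
      ofExtraction p.1 p.2.1 p.2.2 := by
  rintro ⟨A, φ, χ⟩ ⟨B, φ', χ'⟩ h
  have hV : φ.onV = φ'.onV := congrArg Exhibit.onV h
  have hE : φ.onE = φ'.onE := congrArg Exhibit.onE h
  have hP : ∀ x, χ.onV.symm (Quotient.mk (G.rel A.1) x) =
    χ'.onV.symm (Quotient.mk (G.rel B.1) x) := fun x => congrFun (congrArg Exhibit.proj h) x
  have hX : ∀ x, (χ.onE x).1 = (χ'.onE x).1 := fun x => congrFun (congrArg Exhibit.edge h) x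
  obtain rfl : A = B := by
    apply Subtype.ext
    ext e
    rw [φ.mem_iff, φ'.mem_iff, hE]
  obtain rfl : φ = φ' := ForestEmb.ext hV hE
  obtain rfl : χ = χ' := by
    refine Graph.Iso.ext' (fun v => ?_) (fun e => Subtype.ext (hX e))
    apply χ'.onV.symm.injective
    rw [Equiv.symm_apply_apply]
    obtain ⟨x, hx⟩ := Quotient.exists_rep (χ.onV v)
    rw [← hx, ← hP, hx, Equiv.symm_apply_apply]
  rfl

lemma ofExtraction_surjective : Function.Surjective
    fun p : (Σ A : G.Contractible, ForestEmb Γ G A.1 × H.Iso A.quot) =>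
      ofExtraction p.1 p.2.1 p.2.2 := by
  classical
  intro D
  let A : Finset G.E := Finset.univ.filter fun e => ∃ x, D.onE x = e
  have hAmem : ∀ e, e ∈ A ↔ ∃ x, D.onE x = e := fun e => by simp [A]
  let φ : ForestEmb Γ G A := ⟨D.onV, D.onE, D.injV,
    fun x y h => Sum.inl_injective (D.bijE.1 h), hAmem, D.ends⟩
  have hedge : ∀ e, D.edge e ∉ A := by
    intro e he
    obtain ⟨x, hx⟩ := (hAmem _).1 he
    cases D.bijE.1 (a₁ := Sum.inl x) (a₂ := Sum.inr e) hx
  have hrel : ∀ x y, G.rel A x y ↔ D.proj x = D.proj y := fun x y => by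
    rw [φ.rel_iff, D.proj_eq_iff]
  have hA : A ≠ Finset.univ := by
    intro h
    obtain ⟨e⟩ := H.nonempty_E
    exact hedge e (h ▸ Finset.mem_univ _)
  have hnot : ∀ e, e ∉ A → ∃ e', D.edge e' = e := by
    intro e he
    obtain ⟨x | x, hx⟩ := D.bijE.2 e
    · exact absurd ((hAmem e).2 ⟨x, hx⟩) he
    · exact ⟨x, hx⟩
  have hloop : ∀ e, e ∉ A → ¬ (G.rel A).r (G.src e) (G.tgt e) := by
    intro e he h
    obtain ⟨e', rfl⟩ := hnot e he
    have h1 := (hrel _ _).1 h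
    have h2 := D.ends_edge e'
    rw [h1, Sym2.eq_iff] at h2
    rcases h2 with ⟨h3, h4⟩ | ⟨h3, h4⟩
    · exact H.src_ne_tgt e' (h3.symm.trans h4)
    · exact H.src_ne_tgt e' (h4.symm.trans h3)
  let k : Quotient (G.rel A) → H.V := Quotient.lift D.proj fun x y h => (hrel x y).1 h
  have hk : Function.Bijective k := by
    constructor
    · intro p q h
      induction p using Quotient.inductionOn with | _ x => ?_
      induction q using Quotient.inductionOn with | _ y => ?_
      exact Quotient.sound ((hrel x y).2 h)
    · intro v
      obtain ⟨x, hx⟩ := D.surj v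
      exact ⟨Quotient.mk _ x, hx⟩
  have hb : Function.Bijective (fun e => (⟨D.edge e, hedge e⟩ : {e : G.E // e ∉ A})) := by
    constructor
    · intro e e' h
      exact Sum.inr_injective (D.bijE.1 (a₁ := Sum.inr e) (a₂ := Sum.inr e')
        (congrArg Subtype.val h))
    · rintro ⟨e, he⟩
      obtain ⟨e', rfl⟩ := hnot e he
      exact ⟨e', rfl⟩
  let χ : H.Iso (G.contract A hA hloop) :=
    { onV := (Equiv.ofBijective k hk).symm
      onE := Equiv.ofBijective _ hb
      ends := fun e => by
        apply Sym2.map.injective (Equiv.ofBijective k hk).injective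
        exact (D.ends_edge e).trans (congrArg₂ (fun a b => s(a, b))
          ((Equiv.ofBijective k hk).apply_symm_apply _).symm
          ((Equiv.ofBijective k hk).apply_symm_apply _).symm) }
  exact ⟨⟨⟨A, hA, hloop⟩, φ, χ⟩, rfl⟩

end Exhibit

/-- The duality of insertion with extraction and contraction, as an identity between numbers. -/
theorem card_insertion_eq {I : Type} [Fintype I] (Γ : I → Graph) (H G : Graph) :
    Nat.card (Σ s : Insertion Γ H, s.graph.Iso G) =
      Nat.card (Σ A : G.Contractible, ForestEmb Γ G A.1 × H.Iso A.quot) :=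
  (Nat.card_congr (Equiv.ofBijective _
    ⟨Exhibit.ofInsertion_injective, Exhibit.ofInsertion_surjective⟩)).trans
  (Nat.card_congr (Equiv.ofBijective _
    ⟨Exhibit.ofExtraction_injective, Exhibit.ofExtraction_surjective⟩)).symm

/-! ### Insertion of multi-indices as a sum over insertions of diagrams -/

section Arity

lemma Graph.Iso.arity {G H : Graph} (f : G.Iso H) (v : G.V) : H.arity (f.onV v) = G.arity v := by
  refine (Nat.card_congr (f.onE.subtypeEquiv fun e => ?_)).symm
  have h1 : ∀ (a b c : G.V), (a = c ∨ b = c) ↔ c ∈ s(a, b) := fun a b c => by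
    rw [Sym2.mem_iff, eq_comm, @eq_comm _ b]
  have h2 : ∀ (a b c : H.V), (a = c ∨ b = c) ↔ c ∈ s(a, b) := fun a b c => by
    rw [Sym2.mem_iff, eq_comm, @eq_comm _ b]
  rw [h1, h2, f.ends, Sym2.mem_iff, Sym2.mem_iff, f.onV.injective.eq_iff, f.onV.injective.eq_iff]

lemma Graph.countExp_diagram (G : Graph) : G.diagram.countExp = fiberCount G.arity := by
  obtain ⟨f⟩ := G.diagram_graph_iso
  rw [← fiberCount_comp_equiv G.arity f.onV]
  exact Finset.sum_congr rfl fun v _ => congrArg (Finsupp.single · 1) (f.arity v).symm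

variable {I : Type} {Γ : I → Graph} {H : Graph}

lemma Insertion.place_eq_inl_iff (s : Insertion Γ H) (e : H.E) (v : H.V)
    (h : H.src e = v ∨ H.tgt e = v) (i : I) (u : (Γ i).V) :
    s.place e v h = Sum.inl ⟨i, u⟩ ↔ ∃ hv : s.1 i = v, s.2 i ⟨e, by rw [hv]; exact h⟩ = u := by
  constructor
  · intro hp
    have hv : s.1 i = v := by
      rw [← s.proj_place e v h, hp]; rfl
    subst hv
    rw [s.place_at] at hp
    have h2 := Sum.inl_injective hp
    exact ⟨rfl, by simpa using h2⟩
  · rintro ⟨rfl, rfl⟩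
    exact s.place_at _ _ _

lemma Insertion.place_eq_inr_iff (s : Insertion Γ H) (e : H.E) (v : H.V)
    (h : H.src e = v ∨ H.tgt e = v) (w : {v : H.V // v ∉ Set.range s.1}) :
    s.place e v h = Sum.inr w ↔ v = w.1 := by
  constructor
  · intro hp
    rw [← s.proj_place e v h, hp]; rfl
  · rintro rfl
    exact s.place_of_notMem _ _ _ w.2

variable [Fintype I]

lemma Insertion.arity_inl (s : Insertion Γ H) (i : I) (u : (Γ i).V) :
    s.graph.arity (Sum.inl ⟨i, u⟩) = (Γ i).arity u + Nat.card {x // s.2 i x = u} := by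
  have hf : ∀ x : (Γ i).E, (Γ i).src x = u ∨ (Γ i).tgt x = u →
      (s.graph.src (Sum.inl ⟨i, x⟩) = Sum.inl ⟨i, u⟩ ∨
        s.graph.tgt (Sum.inl ⟨i, x⟩) = Sum.inl ⟨i, u⟩) := by
    rintro x (rfl | rfl)
    · exact Or.inl rfl
    · exact Or.inr rfl
  have hg : ∀ x : {x // s.2 i x = u}, (s.graph.src (Sum.inr x.1.1) = Sum.inl ⟨i, u⟩ ∨
        s.graph.tgt (Sum.inr x.1.1) = Sum.inl ⟨i, u⟩) := by
    rintro ⟨⟨e, he⟩, hx⟩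
    rcases he with he' | he'
    · exact Or.inl ((s.place_eq_inl_iff e _ (Or.inl rfl) i u).2 ⟨he'.symm, hx⟩)
    · exact Or.inr ((s.place_eq_inl_iff e _ (Or.inr rfl) i u).2 ⟨he'.symm, hx⟩)
  let φ : {x : (Γ i).E // (Γ i).src x = u ∨ (Γ i).tgt x = u} ⊕ {x // s.2 i x = u} →
      {e : s.graph.E // s.graph.src e = Sum.inl ⟨i, u⟩ ∨ s.graph.tgt e = Sum.inl ⟨i, u⟩} :=
    Sum.elim (fun x => ⟨Sum.inl ⟨i, x.1⟩, hf x.1 x.2⟩) (fun x => ⟨Sum.inr x.1.1, hg x⟩)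
  have hφ : Function.Bijective φ := by
    constructor
    · rintro (⟨x, hx⟩ | ⟨⟨x, hx⟩, hx'⟩) (⟨y, hy⟩ | ⟨⟨y, hy⟩, hy'⟩) h
      · have := Sum.inl_injective (congrArg Subtype.val h)
        obtain rfl : x = y := by simpa using this
        rfl
      · cases congrArg Subtype.val h
      · cases congrArg Subtype.val h
      · obtain rfl : x = y := Sum.inr_injective (congrArg Subtype.val h)
        rfl
    · rintro ⟨⟨k, x⟩ | e, he⟩
      · have hk : k = i := by
          rcases he with he | he <;> exact congrArg Sigma.fst (Sum.inl_injective he)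
        subst hk
        have hx : (Γ k).src x = u ∨ (Γ k).tgt x = u := by
          refine he.imp (fun he => ?_) (fun he => ?_)
          · have := Sum.inl_injective he; simpa using this
          · have := Sum.inl_injective he; simpa using this
        exact ⟨Sum.inl ⟨x, hx⟩, rfl⟩
      · rcases id he with h1 | h1
        · obtain ⟨hv, hu⟩ := (s.place_eq_inl_iff e _ (Or.inl rfl) i u).1 h1
          exact ⟨Sum.inr ⟨⟨e, _⟩, hu⟩, rfl⟩
        · obtain ⟨hv, hu⟩ := (s.place_eq_inl_iff e _ (Or.inr rfl) i u).1 h1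
          exact ⟨Sum.inr ⟨⟨e, _⟩, hu⟩, rfl⟩
  rw [Graph.arity, ← Nat.card_congr (Equiv.ofBijective φ hφ), Nat.card_sum]
  rfl

lemma Insertion.arity_inr (s : Insertion Γ H) (v : {v : H.V // v ∉ Set.range s.1}) :
    s.graph.arity (Sum.inr v) = H.arity v.1 := by
  have hg : ∀ e : H.E, (s.graph.src (Sum.inr e) = Sum.inr v ∨ s.graph.tgt (Sum.inr e) = Sum.inr v) ↔
      (H.src e = v.1 ∨ H.tgt e = v.1) := fun e =>
    or_congr (s.place_eq_inr_iff e _ (Or.inl rfl) v) (s.place_eq_inr_iff e _ (Or.inr rfl) v)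
  let φ : {e : H.E // H.src e = v.1 ∨ H.tgt e = v.1} →
      {e : s.graph.E // s.graph.src e = Sum.inr v ∨ s.graph.tgt e = Sum.inr v} :=
    fun e => ⟨Sum.inr e.1, (hg e.1).2 e.2⟩
  have hφ : Function.Bijective φ := by
    constructor
    · rintro ⟨x, hx⟩ ⟨y, hy⟩ h
      obtain rfl : x = y := Sum.inr_injective (congrArg Subtype.val h)
      rfl
    · rintro ⟨⟨k, x⟩ | e, he⟩
      · rcases he with he | he <;> cases he
      · exact ⟨⟨e, (hg e).1 he⟩, rfl⟩
  exact (Nat.card_congr (Equiv.ofBijective φ hφ)).symm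

end Arity

section Expansion

open Classical

/-- The monomial `∏ z_{a u}`. -/
def zMonomial {U : Type*} [Fintype U] (a : U → ℕ) : MvPolynomial ℕ ℝ :=
  ∏ u, MvPolynomial.X (a u)

lemma monomial_fiberCount {U : Type*} [Fintype U] (a : U → ℕ) :
    MvPolynomial.monomial (fiberCount a) (1 : ℝ) = zMonomial a :=
  MvPolynomial.monomial_sum_one _ _

lemma derivD_zMonomial {U : Type*} [Fintype U] (a : U → ℕ) :
    derivD (zMonomial a) = ∑ u, zMonomial fun w => a w + if u = w then 1 else 0 := by
  rw [zMonomial, derivation_prod]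
  refine Finset.sum_congr rfl fun u _ => ?_
  rw [zMonomial, ← Finset.prod_erase_mul _ _ (Finset.mem_univ u)]
  congr 1
  · refine Finset.prod_congr rfl fun w hw => ?_
    rw [if_neg (Finset.ne_of_mem_erase hw).symm, add_zero]
  · rw [derivD, MvPolynomial.mkDerivation_X, if_pos rfl]

/-- `D ^ k` adds `k` labelled edges in all possible ways. -/
lemma iterate_derivD_zMonomial {U : Type*} [Fintype U] (a : U → ℕ) (k : ℕ) :
    (fun p => derivD p)^[k] (zMonomial a) =
      ∑ f : Fin k → U, zMonomial fun u => a u + ∑ x, if f x = u then 1 else 0 := by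
  induction k with
  | zero => simp
  | succ k ih =>
    rw [Function.iterate_succ_apply', ih, map_sum,
      ← (Fin.consEquiv fun _ : Fin (k + 1) => U).sum_comp, Fintype.sum_prod_type_right]
    refine Finset.sum_congr rfl fun f _ => ?_
    rw [derivD_zMonomial]
    refine Finset.sum_congr rfl fun u _ => ?_
    congr 1
    funext w
    simp [Fin.sum_univ_succ, Fin.consEquiv]
    ring

lemma iterate_derivD_zMonomial' {U κ : Type*} [Fintype U] [Fintype κ] [DecidableEq κ] (a : U → ℕ) :
    (fun p => derivD p)^[Nat.card κ] (zMonomial a) =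
      ∑ f : κ → U, zMonomial fun u => a u + Nat.card {x // f x = u} := by
  rw [iterate_derivD_zMonomial,
    ← (Equiv.arrowCongr (Finite.equivFin κ) (Equiv.refl U)).sum_comp]
  refine Finset.sum_congr rfl fun f _ => ?_
  congr 1
  funext u
  have h : Nat.card {x // f x = u} = ∑ x, if f x = u then 1 else 0 := by
    rw [Nat.card_eq_fintype_card, Fintype.card_subtype]
    simp
  rw [h, ← (Finite.equivFin κ).sum_comp]
  simp

/-- Applying derivatives removes distinct vertices in all possible ways. -/
lemma iterPderiv_zMonomial {V : Type*} [Fintype V] (a : V → ℕ) (I : Type*) [Fintype I] :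
    ∀ k : I → ℕ, iterPderiv (Finset.univ.val.map k) (zMonomial a) =
      ∑ j : I ↪ V, if ∀ i, a (j i) = k i then
        ∏ v with v ∉ Set.range j, MvPolynomial.X (a v) else 0 := by
  refine Fintype.induction_empty_option (P := fun (I : Type _) _ =>
    ∀ k : I → ℕ, iterPderiv (Finset.univ.val.map k) (zMonomial a) =
      ∑ j : I ↪ V, if ∀ i, a (j i) = k i then
        ∏ v with v ∉ Set.range j, MvPolynomial.X (a v) else 0) ?_ ?_ ?_ I
  · intro α β _ e ih k
    let _ := Fintype.ofEquiv _ e.symm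
    have h1 : Finset.univ.val.map k = Finset.univ.val.map (k ∘ e) := by
      rw [← Multiset.map_map, ← Finset.map_univ_equiv e, Finset.map_val]
      rfl
    rw [h1, ih, ← (Equiv.embeddingCongr e (Equiv.refl V)).sum_comp]
    refine Finset.sum_congr rfl fun j _ => ?_
    have h2 : Set.range ((Equiv.embeddingCongr e (Equiv.refl V)) j) = Set.range j := by
      ext v
      simp [e.symm.surjective.exists]
    simp only [h2]
    congr 1
    refine propext (e.forall_congr fun i => ?_)
    simp
  · intro k
    simp [iterPderiv, zMonomial]
  · intro α _ ih k
    have h1 : (Finset.univ : Finset (Option α)).val.map k =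
        k none ::ₘ Finset.univ.val.map (fun x => k (some x)) := by
      have : (Finset.univ : Finset (Option α)).val = none ::ₘ Finset.univ.val.map some := rfl
      rw [this, Multiset.map_cons, Multiset.map_map]
      rfl
    have h2 : ∀ (κ : Multiset ℕ) n p, iterPderiv (n ::ₘ κ) p =
        MvPolynomial.pderiv n (iterPderiv κ p) := fun κ n p => by
      rw [iterPderiv, Multiset.foldr_cons]; rfl
    rw [h1, h2, ih, map_sum, ← (Function.Embedding.optionEmbeddingEquiv α V).symm.sum_comp,
      Fintype.sum_sigma]
    refine Finset.sum_congr rfl fun j _ => ?_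
    rw [apply_ite (MvPolynomial.pderiv (k none)), map_zero, derivation_prod]
    have h3 : ∀ v : ↥(Set.range j)ᶜ, Set.range ((Function.Embedding.optionEmbeddingEquiv α V).symm
        ⟨j, v⟩ : Option α ↪ V) = insert v.1 (Set.range j) := by
      intro v
      ext w
      simp [Option.exists, eq_comm]
    have h5 : ∀ v : ↥(Set.range j)ᶜ,
        ((Function.Embedding.optionEmbeddingEquiv α V).symm ⟨j, v⟩) none = v.1 := fun _ => rfl
    have h6 : ∀ (v : ↥(Set.range j)ᶜ) i,
        ((Function.Embedding.optionEmbeddingEquiv α V).symm ⟨j, v⟩) (some i) = j i := fun _ _ => rfl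
    simp only [Option.forall, h3, h5, h6]
    have h7 : ∀ f : V → MvPolynomial ℕ ℝ, ∑ v : ↥(Set.range j)ᶜ, f v.1 =
        ∑ v with v ∉ Set.range j, f v := fun f => (Finset.sum_subtype _ (by simp) f).symm
    rw [h7 fun v => if a v = k none ∧ ∀ i, a (j i) = k (some i) then
      ∏ w with w ∉ insert v (Set.range j), MvPolynomial.X (a w) else (0 : MvPolynomial ℕ ℝ)]
    split_ifs with h
    · refine Finset.sum_congr rfl fun v hv => ?_
      rw [MvPolynomial.pderiv_X, Pi.single_apply]
      have h4 : (Finset.univ.filter fun w => w ∉ insert v (Set.range j)) =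
          (Finset.univ.filter fun w => w ∉ Set.range j).erase v := by
        ext w
        simp
      rw [h4]
      simp [h]
    · symm
      refine Finset.sum_eq_zero fun v hv => ?_
      simp [h]

lemma Graph.exp_count (G : Graph) : G.diagram.count.exp = fiberCount G.arity := G.countExp_diagram

lemma insertM_eq_sum_embedding (t : MForest) (H : Graph) :
    insertM t H.diagram.count = ∑ j : Members t ↪ H.V,
      (∏ i, (fun p => derivD p)^[H.arity (j i)] (MvPolynomial.monomial i.1.1.exp 1)) *
        ∏ v with v ∉ Set.range j, MvPolynomial.X (H.arity v) := by
  have hexp := H.exp_count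
  have hmem : ∀ v, H.arity v ∈ H.diagram.count.exp.support := fun v => by
    rw [hexp, Finsupp.mem_support_iff, fiberCount_apply]
    have : Nonempty {i // H.arity i = H.arity v} := ⟨⟨v, rfl⟩⟩
    exact Nat.card_pos.ne'
  have hm : MvPolynomial.monomial H.diagram.count.exp (1 : ℝ) = zMonomial H.arity := by
    rw [hexp, monomial_fiberCount]
  rw [insertM, hm]
  simp only [iterPderiv_zMonomial, Finset.mul_sum]
  rw [Finset.sum_comm]
  refine Finset.sum_congr rfl fun j _ => ?_
  -- the vertices of `H` to be replaced determine the orders of differentiation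
  rw [Finset.sum_eq_single fun i => ⟨H.arity (j i), hmem _⟩]
  · simp
  · intro k _ hk
    rw [if_neg, mul_zero]
    intro h
    exact hk (funext fun i => Subtype.ext (h i).symm)
  · simp

lemma Insertion.zMonomial_arity {I : Type} [Fintype I] {Γ : I → Graph} {H : Graph}
    (s : Insertion Γ H) : zMonomial s.graph.arity =
      (∏ i, zMonomial fun u => (Γ i).arity u + Nat.card {x // s.2 i x = u}) *
        ∏ v with v ∉ Set.range s.1, MvPolynomial.X (H.arity v) := by
  have h4 : zMonomial s.graph.arity = ∏ w : s.Vert, MvPolynomial.X (s.graph.arity w) :=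
    Fintype.prod_equiv (Equiv.refl _) _ _ fun _ => rfl
  rw [h4, Fintype.prod_sum_type, Fintype.prod_sigma]
  congr 1
  · refine Finset.prod_congr rfl fun i _ => ?_
    exact Finset.prod_congr rfl fun u _ => by rw [s.arity_inl]
  · rw [Finset.prod_subtype (p := fun v => v ∉ Set.range s.1) _ (by simp)]
    exact Finset.prod_congr rfl fun u _ => by rw [s.arity_inr]

lemma insertM_eq_sum_embedding_of_equiv {I : Type} [Fintype I] (Γ : I → Graph) (t : MForest)
    (e : I ≃ Members t) (he : ∀ i, (e i).1.1 = (Γ i).diagram.count) (H : Graph) :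
    insertM t H.diagram.count = ∑ j : I ↪ H.V,
      (∏ i, (fun p => derivD p)^[H.arity (j i)] (zMonomial (Γ i).arity)) *
        ∏ v with v ∉ Set.range j, MvPolynomial.X (H.arity v) := by
  have hmon : ∀ i, MvPolynomial.monomial ((e i).1.1.exp) (1 : ℝ) = zMonomial (Γ i).arity := by
    intro i
    rw [he i, ← monomial_fiberCount, Graph.exp_count]
  rw [insertM_eq_sum_embedding]
  refine (Fintype.sum_equiv (Equiv.embeddingCongr e (Equiv.refl H.V)) _ _ fun j => ?_).symm
  have h2 : Set.range ((Equiv.embeddingCongr e (Equiv.refl H.V)) j) = Set.range j := by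
    ext v
    simp [e.symm.surjective.exists]
  have h5 : ∀ i, (Equiv.embeddingCongr e (Equiv.refl H.V)) j (e i) = j i := fun i => by simp
  rw [← e.prod_comp]
  simp only [h5, hmon, h2]

lemma sum_sigma_eq {A M : Type*} {B : A → Type*} [AddCommMonoid M] [Fintype A]
    [∀ a, Fintype (B a)] [Fintype (Σ a, B a)] (f : (Σ a, B a) → M) :
    ∑ x, f x = ∑ a, ∑ b, f ⟨a, b⟩ := by
  convert Fintype.sum_sigma f

instance {I : Type} [Fintype I] (Γ : I → Graph) (H : Graph) : Fintype (Insertion Γ H) :=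
  Fintype.ofFinite _

/-- The insertion of multi-indices enumerates the insertions of diagrams. -/
theorem insertM_eq_sum {I : Type} [Fintype I] (Γ : I → Graph) (H : Graph) :
    insertM (fiberCount fun i => (Γ i).diagram.count) H.diagram.count =
      ∑ s : Insertion Γ H, zMonomial s.graph.arity := by
  obtain ⟨e, he⟩ := exists_equiv_of_fiberCount (f := fun i => (Γ i).diagram.count)
    (g := fun i : Members (fiberCount fun i => (Γ i).diagram.count) => i.1.1)
    (by rw [fiberCount_members])
  have h3 : ∀ (j : I ↪ H.V) i, (fun p => derivD p)^[H.arity (j i)] (zMonomial (Γ i).arity) =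
      ∑ f : {e : H.E // H.src e = j i ∨ H.tgt e = j i} → (Γ i).V,
        zMonomial fun u => (Γ i).arity u + Nat.card {x // f x = u} := fun j i => by
    rw [Graph.arity]
    exact iterate_derivD_zMonomial' _
  rw [insertM_eq_sum_embedding_of_equiv Γ _ e he H, sum_sigma_eq]
  refine Finset.sum_congr rfl fun j _ => ?_
  rw [Finset.prod_congr rfl fun i _ => h3 j i, Finset.prod_univ_sum, Fintype.piFinset_univ,
    Finset.sum_mul]
  exact Finset.sum_congr rfl fun f _ => (Insertion.zMonomial_arity ⟨j, f⟩).symm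

end Expansion

/-! ### Multiplicativity of the lift -/

section Lift

lemma prod_add_single {D M : Type*} [DecidableEq D] [CommMonoid M] (F : D →₀ ℕ) (d : D)
    (g : D → ℕ → M) (h0 : ∀ e, g e 0 = 1) (c : M) (hc : g d (F d + 1) = c * g d (F d)) :
    (F + Finsupp.single d 1).prod g = c * F.prod g := by
  have h1 : (F + Finsupp.single d 1).support ⊆ insert d F.support := by
    intro e he
    by_contra h
    simp only [Finset.mem_insert, not_or, Finsupp.mem_support_iff, not_not] at h he
    simp [h.2, h.1] at he
  rw [Finsupp.prod_of_support_subset _ h1 g fun e _ => h0 e,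
    Finsupp.prod_of_support_subset F (Finset.subset_insert d _) g fun e _ => h0 e,
    ← Finset.mul_prod_erase _ _ (Finset.mem_insert_self d _),
    ← Finset.mul_prod_erase _ (fun e => g e (F e)) (Finset.mem_insert_self d _), ← mul_assoc, ← hc]
  congr 1
  · simp
  · refine Finset.prod_congr rfl fun e he => ?_
    have hne : d ≠ e := (Finset.ne_of_mem_erase he).symm
    simp [hne]

lemma symmF_add_single (F : DiagramForest) (Γ : Diagram) :
    symmF (F + Finsupp.single Γ 1) = (F Γ + 1) * Γ.symm * symmF F :=
  prod_add_single _ _ _ (by simp) _ (by rw [Nat.factorial_succ, pow_succ]; ring)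

lemma symmM_add_single (s : MForest) (β : MIndex) :
    symmM (s + Finsupp.single β 1) = (s β + 1) * β.symm * symmM s :=
  prod_add_single _ _ _ (by simp) _ (by rw [Nat.factorial_succ, pow_succ]; ring)

lemma MIndex.symm_pos (β : MIndex) : 0 < β.symm :=
  Finset.prod_pos fun _ _ =>
    Nat.mul_pos (Nat.factorial_pos _) (pow_pos (Nat.factorial_pos _) _)

lemma symmM_pos (s : MForest) : 0 < symmM s :=
  Finset.prod_pos fun β _ => Nat.mul_pos (Nat.factorial_pos _) (pow_pos β.symm_pos _)

/-- The diagrams above a multi-index. -/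
def MIndex.diagrams (β : MIndex) : Finset Diagram := (Diagram.finite_count β).toFinset

lemma MIndex.mem_diagrams {β : MIndex} {Γ : Diagram} : Γ ∈ β.diagrams ↔ Γ.count = β := by
  simp [MIndex.diagrams]

/-- The lift of a single multi-index. -/
def liftX (β : MIndex) : MvPolynomial Diagram ℝ :=
  ∑ Γ ∈ β.diagrams, ((β.symm : ℝ) / Γ.symm) • MvPolynomial.X Γ

/-- The lift as an algebra morphism. -/
def liftAlg : MvPolynomial MIndex ℝ →ₐ[ℝ] MvPolynomial Diagram ℝ := MvPolynomial.aeval liftX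

lemma liftAlg_X (β : MIndex) : liftAlg (MvPolynomial.X β) = liftX β := MvPolynomial.aeval_X _ _

lemma liftP_monomial (s : MForest) : liftP (MvPolynomial.monomial s 1) =
    ∑ F : lifts s, ((symmM s : ℝ) / (symmF F.1 : ℝ)) • MvPolynomial.monomial F.1 (1 : ℝ) := by
  have h : MvPolynomial.monomial s (1 : ℝ) = MvPolynomial.basisMonomials MIndex ℝ s := by
    rw [MvPolynomial.coe_basisMonomials]
  rw [h, liftP, Module.Basis.constr_basis]

lemma sum_diagrams_apply {s : MForest} {F : DiagramForest} (hF : F ∈ lifts s) (β : MIndex) :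
    ∑ Γ ∈ β.diagrams, F Γ = s β := by
  classical
  change F.mapDomain Diagram.count = s at hF
  have h : (F.mapDomain Diagram.count) β = ∑ Γ ∈ F.support with Γ.count = β, F Γ := by
    rw [Finsupp.mapDomain, Finsupp.sum, Finsupp.finsetSum_apply, Finset.sum_filter]
    exact Finset.sum_congr rfl fun Γ _ => Finsupp.single_apply
  rw [← hF, h]
  symm
  refine Finset.sum_subset_zero_on_sdiff (fun Γ h => ?_) (fun Γ h => ?_) fun _ _ => rfl
  · exact MIndex.mem_diagrams.2 (Finset.mem_filter.1 h).2
  · rw [Finset.mem_sdiff, MIndex.mem_diagrams] at h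
    by_contra h0
    exact h.2 (Finset.mem_filter.2 ⟨Finsupp.mem_support_iff.2 h0, h.1⟩)

lemma add_single_mem_lifts {s : MForest} {F : DiagramForest} {Γ : Diagram} {β : MIndex}
    (hΓ : Γ.count = β) : F + Finsupp.single Γ 1 ∈ lifts (s + Finsupp.single β 1) ↔
      F ∈ lifts s := by
  change Finsupp.mapDomain _ _ = _ ↔ Finsupp.mapDomain _ _ = _
  rw [Finsupp.mapDomain_add, Finsupp.mapDomain_single, hΓ, add_left_inj]

lemma liftP_monomial_add_single (s : MForest) (β : MIndex) :
    liftP (MvPolynomial.monomial (s + Finsupp.single β 1) 1) =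
      liftX β * liftP (MvPolynomial.monomial s 1) := by
  classical
  set S : Finset DiagramForest := (lifts_finite (s + Finsupp.single β 1)).toFinset
  have hS : ∀ F, F ∈ S ↔ F ∈ lifts (s + Finsupp.single β 1) := fun F => by simp [S]
  set T : Finset DiagramForest := (lifts_finite s).toFinset
  have hT : ∀ F, F ∈ T ↔ F ∈ lifts s := fun F => by simp [T]
  have e1 : ∀ (s : MForest) (T : Finset DiagramForest), (∀ F, F ∈ T ↔ F ∈ lifts s) →
      ∀ f : DiagramForest → MvPolynomial Diagram ℝ, ∑ F : lifts s, f F.1 = ∑ F ∈ T, f F :=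
    fun s T hT f => (Finset.sum_subtype T hT f).symm
  rw [liftP_monomial, liftP_monomial, e1 _ S hS fun F => ((symmM (s + Finsupp.single β 1) : ℝ) /
    (symmF F : ℝ)) • MvPolynomial.monomial F (1 : ℝ), e1 _ T hT fun F => ((symmM s : ℝ) /
    (symmF F : ℝ)) • MvPolynomial.monomial F (1 : ℝ), liftX, Finset.sum_mul]
  -- remove one component `Γ` of type `β`, in all possible ways
  have h1 : ∀ Γ ∈ β.diagrams, ((β.symm : ℝ) / Γ.symm) • MvPolynomial.X Γ *
      ∑ F ∈ T, ((symmM s : ℝ) / (symmF F : ℝ)) • MvPolynomial.monomial F (1 : ℝ) =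
      ∑ F ∈ S, ((F Γ : ℝ) * β.symm * symmM s / symmF F) • MvPolynomial.monomial F (1 : ℝ) := by
    intro Γ hΓ
    have hc := MIndex.mem_diagrams.1 hΓ
    rw [Finset.mul_sum, ← Finset.sum_filter_add_sum_filter_not S (fun F => F Γ ≠ 0)]
    have h0 : ∑ F ∈ S with ¬ F Γ ≠ 0, ((F Γ : ℝ) * β.symm * symmM s / symmF F) •
        MvPolynomial.monomial F (1 : ℝ) = 0 :=
      Finset.sum_eq_zero fun F hF => by
        have := (Finset.mem_filter.1 hF).2
        rw [not_not] at this
        simp [this]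
    rw [h0, add_zero]
    refine Finset.sum_bij' (fun F _ => F + Finsupp.single Γ 1) (fun F _ => F - Finsupp.single Γ 1)
      ?_ ?_ ?_ ?_ ?_
    · intro F hF
      rw [Finset.mem_filter, hS, add_single_mem_lifts hc, ← hT]
      exact ⟨hF, by simp⟩
    · intro F hF
      rw [Finset.mem_filter, hS] at hF
      have hle : Finsupp.single Γ 1 ≤ F := by
        rw [Finsupp.single_le_iff]; exact Nat.one_le_iff_ne_zero.2 hF.2
      rw [hT, ← add_single_mem_lifts hc, tsub_add_cancel_of_le hle]
      exact hF.1
    · intro F _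
      simp
    · intro F hF
      rw [Finset.mem_filter] at hF
      have hle : Finsupp.single Γ 1 ≤ F := by
        rw [Finsupp.single_le_iff]; exact Nat.one_le_iff_ne_zero.2 hF.2
      exact tsub_add_cancel_of_le hle
    · intro F _
      have p1 : (symmF F : ℝ) ≠ 0 := by exact_mod_cast (symmF_pos F).ne'
      have p2 : (Γ.symm : ℝ) ≠ 0 := by exact_mod_cast Γ.symm_pos.ne'
      have p3 : ((F Γ : ℝ) + 1) ≠ 0 := by positivity
      rw [smul_mul_smul_comm, MvPolynomial.X, MvPolynomial.monomial_mul, one_mul,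
        add_comm (Finsupp.single Γ 1) F, symmF_add_single]
      congr 1
      simp only [Finsupp.add_apply, Finsupp.single_eq_same]
      push_cast
      field_simp
  rw [Finset.sum_congr rfl h1, Finset.sum_comm]
  refine Finset.sum_congr rfl fun F hF => ?_
  rw [← Finset.sum_smul]
  congr 1
  rw [← Finset.sum_div, ← Finset.sum_mul, ← Finset.sum_mul, ← Nat.cast_sum,
    sum_diagrams_apply ((hS F).1 hF), symmM_add_single]
  simp

lemma liftP_zero : liftP (MvPolynomial.monomial 0 1) = 1 := by
  have hl : ∀ F : DiagramForest, F ∈ lifts 0 ↔ F = 0 := by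
    intro F
    constructor
    · intro hF
      ext Γ
      have h := sum_diagrams_apply hF Γ.count
      simp only [Finsupp.coe_zero, Pi.zero_apply, Finset.sum_eq_zero_iff] at h
      exact h Γ (MIndex.mem_diagrams.2 rfl)
    · rintro rfl
      exact Finsupp.mapDomain_zero
  have : Unique (lifts 0) :=
    { default := ⟨0, (hl 0).2 rfl⟩
      uniq := fun F => Subtype.ext ((hl F.1).1 F.2) }
  rw [liftP_monomial, Fintype.sum_unique]
  have hd : ((default : lifts 0) : DiagramForest) = 0 := (hl _).1 (default : lifts 0).2
  rw [hd]
  simp [symmM, symmF]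

theorem liftP_eq_liftAlg : liftP = liftAlg.toLinearMap := by
  refine (MvPolynomial.basisMonomials MIndex ℝ).ext fun s => ?_
  rw [MvPolynomial.coe_basisMonomials]
  change liftP (MvPolynomial.monomial s 1) = liftAlg (MvPolynomial.monomial s 1)
  have hstep : ∀ (s : MForest) β,
      liftP (MvPolynomial.monomial s 1) = liftAlg (MvPolynomial.monomial s 1) →
      liftP (MvPolynomial.monomial (s + Finsupp.single β 1) 1) =
        liftAlg (MvPolynomial.monomial (s + Finsupp.single β 1) 1) := by
    intro s β ih
    rw [liftP_monomial_add_single, ih, ← liftAlg_X, ← map_mul, MvPolynomial.X,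
      MvPolynomial.monomial_mul, one_mul, add_comm s]
  induction s using Finsupp.induction with
  | zero => rw [liftP_zero]; exact (map_one liftAlg).symm
  | single_add β n s _ _ ih =>
    clear * - hstep ih
    induction n with
    | zero => simpa using ih
    | succ n ihn =>
      rw [Finsupp.single_add, add_right_comm]
      exact hstep _ _ ihn

lemma liftP_eq (z : MvPolynomial MIndex ℝ) : liftP z = liftAlg z := by
  rw [liftP_eq_liftAlg]; rfl

end Lift

/-! ### The lift intertwines the coproducts -/

section Coproduct

lemma mem_support_fiberCount {I D : Type*} [Fintype I] {f : I → D} {d : D} :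
    d ∈ (fiberCount f).support ↔ ∃ i, f i = d := by
  rw [Finsupp.mem_support_iff, fiberCount_apply, Nat.card_ne_zero]
  exact ⟨fun h => ⟨h.1.some.1, h.1.some.2⟩, fun ⟨i, hi⟩ => ⟨⟨⟨i, hi⟩⟩, inferInstance⟩⟩

lemma mapDomain_fiberCount {I D D' : Type*} [Fintype I] (f : I → D) (g : D → D') :
    (fiberCount f).mapDomain g = fiberCount fun i => g (f i) := by
  rw [fiberCount, Finsupp.mapDomain_finsetSum]
  exact Finset.sum_congr rfl fun i _ => Finsupp.mapDomain_single

lemma exists_fiberCount_eq {D : Type*} (F : D →₀ ℕ) :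
    ∃ (n : ℕ) (δ : Fin n → D), fiberCount δ = F :=
  ⟨_, fun i => ((Fintype.equivFin (Members F)).symm i).1.1,
    (fiberCount_comp_equiv (fun i : Members F => i.1.1) _).trans (fiberCount_members F)⟩

/-- The handshake lemma. -/
lemma Graph.sum_arity (G : Graph) : ∑ v, G.arity v = 2 * Fintype.card G.E := by
  classical
  have h : ∀ v, G.arity v = ∑ e : G.E, if G.src e = v ∨ G.tgt e = v then 1 else 0 := fun v => by
    rw [Graph.arity, Nat.card_eq_fintype_card, Fintype.card_subtype, Finset.card_filter]
  simp only [h]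
  rw [Finset.sum_comm]
  have h2 : ∀ e : G.E, (∑ v : G.V, if G.src e = v ∨ G.tgt e = v then 1 else 0) = 2 := fun e => by
    rw [← Finset.card_filter]
    have : (Finset.univ.filter fun v : G.V => G.src e = v ∨ G.tgt e = v) = {G.src e, G.tgt e} := by
      ext v
      simp [eq_comm]
    rw [this, Finset.card_pair (G.src_ne_tgt e)]
  simp [h2, mul_comm]

lemma Graph.deg_eq_of_iso {G H : Graph} (f : G.Iso H) (l : ℝ) (d : ℕ) : G.deg l d = H.deg l d := by
  rw [Graph.deg, Graph.deg, f.card_E, Fintype.card_congr f.onV]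

lemma Diagram.deg_count (l : ℝ) (d : ℕ) (Γ : Diagram) : Γ.count.deg l d = Γ.deg l d := by
  rw [MIndex.deg, Diagram.deg, Graph.deg, Γ.norm_count, Γ.halfEdges_count, Graph.sum_arity]
  push_cast
  ring

lemma Graph.deg_diagram (l : ℝ) (d : ℕ) (G : Graph) : G.diagram.deg l d = G.deg l d := by
  obtain ⟨f⟩ := G.diagram_graph_iso
  exact Graph.deg_eq_of_iso f l d

lemma Graph.componentForest_eq_zero {G : Graph} {A : Finset G.E} :
    G.componentForest A = 0 ↔ A = ∅ := by
  rw [← Finsupp.support_eq_empty, Finset.eq_empty_iff_forall_notMem,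
    Finset.eq_empty_iff_forall_notMem]
  simp only [Graph.componentForest, mem_support_fiberCount, not_exists]
  constructor
  · intro h e he
    exact h _ ⟨_, e, he, rfl⟩ rfl
  · intro h _ c
    obtain ⟨e, he, _⟩ := c.2
    exact absurd he (h e)

lemma Graph.forall_deg_iff {G : Graph} {A : Finset G.E} (l : ℝ) (d : ℕ) :
    (∀ c : G.Component A, (G.component A c).deg l d ≤ 0) ↔
      ∀ γ ∈ ((G.componentForest A).mapDomain Diagram.count).support, γ.deg l d ≤ 0 := by
  simp only [Graph.componentForest, mapDomain_fiberCount, mem_support_fiberCount]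
  constructor
  · rintro h _ ⟨c, rfl⟩
    rw [Diagram.deg_count, Graph.deg_diagram]
    exact h c
  · intro h c
    have := h _ ⟨c, rfl⟩
    rwa [Diagram.deg_count, Graph.deg_diagram] at this

lemma ForestEmb.isEmpty_of_forest {I : Type*} [Fintype I] {Γ : I → Graph} {G : Graph}
    {A : Finset G.E} (h : fiberCount (fun i => (Γ i).diagram) ≠ G.componentForest A) :
    IsEmpty (ForestEmb Γ G A) := by
  refine ⟨fun φ => h ?_⟩
  obtain ⟨⟨e, f⟩, _⟩ := ForestEmb.ofIso_surjective φ
  rw [Graph.componentForest, ← fiberCount_comp_equiv _ e]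
  exact congrArg fiberCount (funext fun i => (f i).diagram_eq)

/-- The number of ways to extract the forest `F` from `G` and be left with `Γ'`. -/
def Graph.extractions (G : Graph) (F : DiagramForest) (Γ' : Diagram) : ℕ :=
  Nat.card {A : G.Contractible // G.componentForest A.1 = F ∧ A.quot.diagram = Γ'}

instance (G : Graph) : Finite G.Contractible := Subtype.finite

lemma Graph.card_iso_eq_ite (G H : Graph) [Decidable (G.diagram = H.diagram)] :
    Nat.card (G.Iso H) = if G.diagram = H.diagram then H.diagram.symm else 0 := by
  split_ifs with h
  · rw [Graph.card_iso G H h, h]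
  · have := Graph.isEmpty_iso G H h
    exact Nat.card_of_isEmpty

instance {I : Type*} [Finite I] (Γ : I → Graph) (G : Graph) (A : Finset G.E) :
    Finite (ForestEmb Γ G A) :=
  Finite.of_injective (fun φ => (φ.onV, φ.onE)) fun _ _ h =>
    ForestEmb.ext (congrArg Prod.fst h) (congrArg Prod.snd h)

lemma card_extractions_mul {I : Type} [Fintype I] (Γ : I → Graph) (H G : Graph) :
    Nat.card (Σ s : Insertion Γ H, s.graph.Iso G) =
      G.extractions (fiberCount fun i => (Γ i).diagram) H.diagram *
        (symmF (fiberCount fun i => (Γ i).diagram) * H.diagram.symm) := by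
  classical
  have := Fintype.ofFinite G.Contractible
  rw [card_insertion_eq, Nat.card_sigma, Graph.extractions, Nat.card_eq_fintype_card,
    Fintype.card_subtype, ← smul_eq_mul, ← Finset.sum_const, Finset.sum_filter]
  refine Finset.sum_congr rfl fun A _ => ?_
  rw [Nat.card_prod]
  split_ifs with h
  · rw [ForestEmb.card_eq_of_forest Γ G A.1 h.1.symm, h.1, Graph.card_iso _ _ h.2.symm]
  · rw [not_and_or] at h
    rcases h with h | h
    · have := ForestEmb.isEmpty_of_forest (Γ := Γ) (Ne.symm h)
      rw [Nat.card_of_isEmpty, zero_mul]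
    · have := Graph.isEmpty_iso H A.quot (Ne.symm h)
      rw [Nat.card_of_isEmpty (α := H.Iso A.quot), mul_zero]

/-- The duality of insertion and extraction, for all diagrams above `z^β` at once. -/
theorem sum_extractions (β : MIndex) (F : DiagramForest) (Γ' : Diagram) :
    ∑ Γ ∈ β.diagrams, (Γ.graph.extractions F Γ' : ℝ) / Γ.symm =
      (insertM (F.mapDomain Diagram.count) Γ'.count).coeff β.exp / (symmF F * Γ'.symm) := by
  classical
  obtain ⟨n, δ, rfl⟩ := exists_fiberCount_eq F
  set Γs : Fin n → Graph := fun i => (δ i).graph with hΓs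
  have hδ : ∀ i, (Γs i).diagram = δ i := fun i => (δ i).diagram_graph
  have h1 : (insertM ((fiberCount δ).mapDomain Diagram.count) Γ'.count).coeff β.exp =
      ∑ s : Insertion Γs Γ'.graph, if s.graph.diagram.count = β then (1 : ℝ) else 0 := by
    have h := insertM_eq_sum Γs Γ'.graph
    simp only [hδ, Diagram.diagram_graph] at h
    rw [mapDomain_fiberCount, h, MvPolynomial.coeff_sum]
    refine Finset.sum_congr rfl fun s _ => ?_
    rw [← monomial_fiberCount, MvPolynomial.coeff_monomial]
    have h5 : s.graph.diagram.count.exp = fiberCount s.graph.arity := by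
      rw [Graph.exp_count]
      congr 1
      exact Subsingleton.elim _ _
    rw [← h5]
    exact if_congr Subtype.ext_iff.symm rfl rfl
  have hp : ((symmF (fiberCount δ) : ℝ) * Γ'.symm) ≠ 0 := by
    exact_mod_cast (Nat.mul_pos (symmF_pos _) Γ'.symm_pos).ne'
  rw [h1, eq_div_iff hp, Finset.sum_mul]
  have h2 : ∀ Γ ∈ β.diagrams, (Γ.graph.extractions (fiberCount δ) Γ' : ℝ) / Γ.symm *
      (symmF (fiberCount δ) * Γ'.symm) =
      ∑ s : Insertion Γs Γ'.graph, if s.graph.diagram = Γ then (1 : ℝ) else 0 := by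
    intro Γ _
    have h3 := card_extractions_mul Γs Γ'.graph Γ.graph
    simp only [hδ, Diagram.diagram_graph] at h3
    have hq : (Γ.symm : ℝ) ≠ 0 := by exact_mod_cast Γ.symm_pos.ne'
    rw [div_mul_eq_mul_div, div_eq_iff hq, Finset.sum_mul]
    rw [Nat.card_sigma] at h3
    have h4 := congrArg (Nat.cast (R := ℝ)) h3
    push_cast at h4
    rw [← h4]
    refine Finset.sum_congr rfl fun s _ => ?_
    rw [Graph.card_iso_eq_ite, Diagram.diagram_graph]
    split_ifs <;> simp
  rw [Finset.sum_congr rfl h2, Finset.sum_comm]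
  refine Finset.sum_congr rfl fun s _ => ?_
  rw [Finset.sum_ite_eq]
  exact if_congr MIndex.mem_diagrams rfl rfl

/-- The pairs of diagrams above the terms of the coproduct of `z^β`. -/
abbrev LiftedTerms (l : ℝ) (d : ℕ) (β : MIndex) : Type 1 :=
  Σ p : termsM l d β, lifts p.1.1 × p.1.2.diagrams

lemma coeffE_ne_zero {Γ : Diagram} {β : MIndex} (hΓ : Γ ∈ β.diagrams)
    (A : Γ.graph.Contractible) :
    coeffE ((Γ.graph.componentForest A.1).mapDomain Diagram.count) A.quot.diagram.count β ≠ 0 := by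
  set F := Γ.graph.componentForest A.1
  have hpos : 0 < Γ.graph.extractions F A.quot.diagram := by
    have : Nonempty {A' : Γ.graph.Contractible // Γ.graph.componentForest A'.1 = F ∧
      A'.quot.diagram = A.quot.diagram} := ⟨⟨A, rfl, rfl⟩⟩
    exact Nat.card_pos
  have h := sum_extractions β F A.quot.diagram
  have h1 : 0 < ∑ Γ ∈ β.diagrams,
      (Γ.graph.extractions F A.quot.diagram : ℝ) / Γ.symm := by
    refine Finset.sum_pos' (fun _ _ => by positivity) ⟨Γ, hΓ, ?_⟩
    have := Γ.symm_pos
    positivity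
  rw [h] at h1
  refine mul_ne_zero (div_ne_zero ?_ (mul_ne_zero ?_ ?_)) fun h0 => ?_
  · exact_mod_cast β.symm_pos.ne'
  · exact_mod_cast (symmM_pos _).ne'
  · exact_mod_cast (MIndex.symm_pos _).ne'
  · rw [h0, zero_div] at h1
    exact lt_irrefl _ h1

/-- The term of the coproduct of `z^β` to which an extraction belongs. -/
def toLiftedTerms {l : ℝ} {d : ℕ} {Γ : Diagram} {β : MIndex} (hΓ : Γ ∈ β.diagrams)
    (A : Γ.graph.Extraction l d) : LiftedTerms l d β :=
  ⟨⟨(A.forest.mapDomain Diagram.count, A.quot.count),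
    by
      refine ⟨fun h => ?_, (Graph.forall_deg_iff l d).1 A.2.2.2.2,
        coeffE_ne_zero hΓ ⟨A.1, A.2.2.1, A.2.2.2.1⟩⟩
      have h1 : A.forest ≠ 0 := fun h0 =>
        A.2.1.ne_empty (Graph.componentForest_eq_zero.1 h0)
      obtain ⟨Δ, hΔ⟩ := Finsupp.ne_iff.1 h1
      have h2 := sum_diagrams_apply (s := A.forest.mapDomain Diagram.count) (F := A.forest) rfl
        Δ.count
      change A.forest.mapDomain Diagram.count = 0 at h
      rw [h, Finsupp.coe_zero, Pi.zero_apply, Finset.sum_eq_zero_iff] at h2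
      exact hΔ (h2 Δ (MIndex.mem_diagrams.2 rfl))⟩,
    ⟨A.forest, rfl⟩, ⟨A.quot, MIndex.mem_diagrams.2 rfl⟩⟩

lemma toLiftedTerms_eq_iff {l : ℝ} {d : ℕ} {Γ : Diagram} {β : MIndex} (hΓ : Γ ∈ β.diagrams)
    (A : Γ.graph.Extraction l d) (t : LiftedTerms l d β) :
    toLiftedTerms hΓ A = t ↔ A.forest = t.2.1.1 ∧ A.quot = t.2.2.1 := by
  constructor
  · rintro rfl
    exact ⟨rfl, rfl⟩
  · obtain ⟨⟨⟨s, α⟩, hp⟩, ⟨F, hF⟩, ⟨Γ', hΓ'⟩⟩ := t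
    rintro ⟨h1, h2⟩
    obtain rfl : A.forest = F := h1
    obtain rfl : A.quot = Γ' := h2
    obtain rfl : _ = s := hF
    obtain rfl : _ = α := MIndex.mem_diagrams.1 hΓ'
    rfl

lemma card_toLiftedTerms {l : ℝ} {d : ℕ} {Γ : Diagram} {β : MIndex} (hΓ : Γ ∈ β.diagrams)
    (t : LiftedTerms l d β) : Nat.card {A : Γ.graph.Extraction l d // toLiftedTerms hΓ A = t} =
      Γ.graph.extractions t.2.1.1 t.2.2.1 := by
  refine Nat.card_congr
    { toFun := fun A => ⟨⟨A.1.1, A.1.2.2.1, A.1.2.2.2.1⟩, (toLiftedTerms_eq_iff hΓ A.1 t).1 A.2⟩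
      invFun := fun A => ⟨⟨A.1.1, ?_, A.1.2.1, A.1.2.2, ?_⟩,
        (toLiftedTerms_eq_iff hΓ _ t).2 A.2⟩
      left_inv := fun A => rfl
      right_inv := fun A => rfl }
  · rw [Finset.nonempty_iff_ne_empty, Ne, ← Graph.componentForest_eq_zero, A.2.1]
    intro h0
    have := t.2.1.2
    rw [h0] at this
    exact t.1.2.1 (Eq.symm this)
  · rw [Graph.forall_deg_iff, A.2.1]
    have h : t.2.1.1.mapDomain Diagram.count = t.1.1.1 := t.2.1.2
    rw [h]
    exact t.1.2.2.1

lemma coprodF_eq_sum (l : ℝ) (d : ℕ) {Γ : Diagram} {β : MIndex} (hΓ : Γ ∈ β.diagrams) :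
    coprodF l d Γ = ∑ t : LiftedTerms l d β, (Γ.graph.extractions t.2.1.1 t.2.2.1 : ℝ) •
      (MvPolynomial.monomial t.2.1.1 (1 : ℝ) ⊗ₜ[ℝ] MvPolynomial.X t.2.2.1) := by
  classical
  rw [coprodF, ← Fintype.sum_fiberwise (toLiftedTerms (l := l) (d := d) hΓ)]
  refine Finset.sum_congr rfl fun t _ => ?_
  have h : ∀ A : {A : Γ.graph.Extraction l d // toLiftedTerms hΓ A = t},
      MvPolynomial.monomial A.1.forest (1 : ℝ) ⊗ₜ[ℝ] MvPolynomial.X (R := ℝ) A.1.quot =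
      MvPolynomial.monomial t.2.1.1 (1 : ℝ) ⊗ₜ[ℝ] MvPolynomial.X t.2.2.1 := fun A => by
    obtain ⟨h1, h2⟩ := (toLiftedTerms_eq_iff hΓ A.1 t).1 A.2
    rw [h1, h2]
  rw [Finset.sum_congr rfl fun A _ => h A, Finset.sum_const, Finset.card_univ,
    ← Nat.card_eq_fintype_card, card_toLiftedTerms hΓ t, Nat.cast_smul_eq_nsmul]

/-- The lift intertwines the reduced coproducts. -/
theorem map_liftAlg_coprodM (l : ℝ) (d : ℕ) (β : MIndex) :
    Algebra.TensorProduct.map liftAlg liftAlg (coprodM l d β) =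
      ∑ Γ ∈ β.diagrams, ((β.symm : ℝ) / Γ.symm) • coprodF l d Γ := by
  classical
  rw [Finset.sum_congr rfl fun Γ hΓ => by rw [coprodF_eq_sum l d hΓ, Finset.smul_sum],
    Finset.sum_comm, Fintype.sum_sigma, coprodM, map_sum]
  refine Finset.sum_congr rfl fun p _ => ?_
  rw [map_smul, Algebra.TensorProduct.map_tmul, liftAlg_X, ← liftP_eq, liftP_monomial, liftX,
    TensorProduct.sum_tmul, Fintype.sum_prod_type, Finset.smul_sum]
  refine Finset.sum_congr rfl fun F _ => ?_
  rw [TensorProduct.tmul_sum, Finset.smul_sum, ← Finset.sum_coe_sort p.1.2.diagrams]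
  refine Finset.sum_congr rfl fun Γ' _ => ?_
  simp only [smul_smul]
  rw [← Finset.sum_smul, TensorProduct.smul_tmul', TensorProduct.tmul_smul, smul_smul, TensorProduct.smul_tmul', smul_smul]
  congr 2
  have h := sum_extractions β F.1 Γ'.1
  have hF : F.1.mapDomain Diagram.count = p.1.1 := F.2
  rw [hF, MIndex.mem_diagrams.1 Γ'.2] at h
  have h1 : ∀ Γ ∈ β.diagrams, (β.symm : ℝ) / Γ.symm * (Γ.graph.extractions F.1 Γ'.1 : ℝ) =
      β.symm * ((Γ.graph.extractions F.1 Γ'.1 : ℝ) / Γ.symm) := fun Γ _ => by ring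
  rw [Finset.sum_congr rfl h1, ← Finset.mul_sum, h, coeffE]
  have p1 : (symmM p.1.1 : ℝ) ≠ 0 := by exact_mod_cast (symmM_pos _).ne'
  have p2 : (p.1.2.symm : ℝ) ≠ 0 := by exact_mod_cast (MIndex.symm_pos _).ne'
  field_simp

end Coproduct

/-! ### The lift intertwines the renormalisation maps -/

section Renormalisation

lemma map_liftAlg_fullCoprodM (l : ℝ) (d : ℕ) (z : MvPolynomial MIndex ℝ) :
    Algebra.TensorProduct.map liftAlg liftAlg (fullCoprodM l d z) =
      fullCoprodF l d (liftAlg z) := by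
  suffices h : (Algebra.TensorProduct.map liftAlg liftAlg).comp (fullCoprodM l d) =
      (fullCoprodF l d).comp liftAlg from DFunLike.congr_fun h z
  refine MvPolynomial.algHom_ext fun β => ?_
  rw [AlgHom.comp_apply, AlgHom.comp_apply, fullCoprodM, MvPolynomial.aeval_X, map_add, map_add,
    map_liftAlg_coprodM, Algebra.TensorProduct.map_tmul, Algebra.TensorProduct.map_tmul, map_one,
    liftAlg_X, liftX, map_sum, TensorProduct.tmul_sum, TensorProduct.sum_tmul,
    ← Finset.sum_add_distrib, ← Finset.sum_add_distrib]
  refine Finset.sum_congr rfl fun Γ _ => ?_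
  rw [map_smul, fullCoprodF, MvPolynomial.aeval_X, smul_add, smul_add, TensorProduct.tmul_smul,
    ← TensorProduct.smul_tmul']

lemma antipodeF_X_of_pos {l : ℝ} {d : ℕ} {Γ : Diagram} (h : ¬ Γ.deg l d ≤ 0) :
    antipodeF l d (MvPolynomial.X Γ) = 0 := by
  rw [antipodeF, MvPolynomial.aeval_X, antipodeFAux, if_neg h]

lemma antipodeM_X_of_pos {l : ℝ} {d : ℕ} {β : MIndex} (h : ¬ β.deg l d ≤ 0) :
    antipodeM l d (MvPolynomial.X β) = 0 := by
  rw [antipodeM, MvPolynomial.aeval_X, antipodeMAux, if_neg h]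

lemma algHom_monomial_congr {σ A : Type*} [CommRing A] [Algebra ℝ A]
    {f g : MvPolynomial σ ℝ →ₐ[ℝ] A} {s : σ →₀ ℕ}
    (h : ∀ i ∈ s.support, f (MvPolynomial.X i) = g (MvPolynomial.X i)) :
    f (MvPolynomial.monomial s 1) = g (MvPolynomial.monomial s 1) := by
  rw [MvPolynomial.monomial_eq, MvPolynomial.C_1, one_mul, Finsupp.prod, map_prod, map_prod]
  exact Finset.prod_congr rfl fun i hi => by rw [map_pow, map_pow, h i hi]

lemma liftAlg_antipodeM_X (l : ℝ) (d : ℕ) (β : MIndex) :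
    liftAlg (antipodeM l d (MvPolynomial.X β)) = antipodeF l d (liftX β) := by
  induction hn : β.halfEdges using Nat.strong_induction_on generalizing β with
  | _ n ih =>
  have hX : antipodeF l d (liftX β) = ∑ Γ ∈ β.diagrams, ((β.symm : ℝ) / Γ.symm) •
      antipodeF l d (MvPolynomial.X Γ) := by
    rw [liftX, map_sum]
    exact Finset.sum_congr rfl fun Γ _ => map_smul _ _ _
  have hdeg : ∀ Γ ∈ β.diagrams, Γ.deg l d = β.deg l d := fun Γ hΓ => by
    rw [← Diagram.deg_count, MIndex.mem_diagrams.1 hΓ]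
  by_cases hβ : β.deg l d ≤ 0
  · have hterm : Algebra.TensorProduct.lmul' ℝ (Algebra.TensorProduct.map (antipodeF l d)
        (AlgHom.id ℝ (MvPolynomial Diagram ℝ))
        (Algebra.TensorProduct.map liftAlg liftAlg (coprodM l d β))) =
        liftAlg (Algebra.TensorProduct.lmul' ℝ (Algebra.TensorProduct.map (antipodeM l d)
        (AlgHom.id ℝ (MvPolynomial MIndex ℝ)) (coprodM l d β))) := by
      simp only [coprodM, map_sum, map_smul, Algebra.TensorProduct.map_tmul,
        Algebra.TensorProduct.lmul'_apply_tmul, map_mul, AlgHom.id_apply]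
      refine Finset.sum_congr rfl fun p _ => ?_
      congr 2
      refine algHom_monomial_congr (f := (antipodeF l d).comp liftAlg)
        (g := liftAlg.comp (antipodeM l d)) fun γ hγ => ?_
      rw [AlgHom.comp_apply, AlgHom.comp_apply, liftAlg_X]
      exact (ih _ (hn ▸ termsM_lt p ⟨γ, hγ⟩) γ rfl).symm
    rw [antipodeM_X l d β hβ, map_sub, map_neg, liftAlg_X, ← hterm, map_liftAlg_coprodM, hX]
    simp only [map_sum, map_smul]
    rw [liftX, ← Finset.sum_neg_distrib, ← Finset.sum_sub_distrib]
    refine Finset.sum_congr rfl fun Γ hΓ => ?_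
    rw [antipodeF_X l d Γ ((hdeg Γ hΓ).trans_le hβ), smul_sub, smul_neg]
  · rw [antipodeM_X_of_pos hβ, map_zero, hX]
    refine (Finset.sum_eq_zero fun Γ hΓ => ?_).symm
    rw [antipodeF_X_of_pos (by rwa [hdeg Γ hΓ]), smul_zero]

lemma liftAlg_antipodeM (l : ℝ) (d : ℕ) (z : MvPolynomial MIndex ℝ) :
    liftAlg (antipodeM l d z) = antipodeF l d (liftAlg z) := by
  suffices h : liftAlg.comp (antipodeM l d) = (antipodeF l d).comp liftAlg from
    DFunLike.congr_fun h z
  refine MvPolynomial.algHom_ext fun β => ?_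
  rw [AlgHom.comp_apply, AlgHom.comp_apply, liftAlg_X, liftAlg_antipodeM_X]

/-- Once the valuations are intertwined by the lift, so are the renormalised valuations. -/
theorem liftAlg_renormM {Λ Ω : Type*} [AddCommGroup Λ] [MeasurableSpace Λ] [MeasurableSpace Ω]
    {μ : Measure Λ} {P : Measure Ω} {X : Λ → Ω → ℝ} {K : Λ → ℝ}
    (h : ∀ z, valuationM μ P X z = valuationF μ K (liftAlg z)) (l : ℝ) (d : ℕ)
    (z : MvPolynomial MIndex ℝ) :
    liftAlg (renormM μ P X l d z) = renormF μ K l d (liftAlg z) := by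
  have key : liftAlg.comp ((Algebra.TensorProduct.lid ℝ (MvPolynomial MIndex ℝ)).toAlgHom.comp
      (Algebra.TensorProduct.map ((valuationM μ P X).comp (antipodeM l d))
        (AlgHom.id ℝ (MvPolynomial MIndex ℝ)))) =
      ((Algebra.TensorProduct.lid ℝ (MvPolynomial Diagram ℝ)).toAlgHom.comp
      (Algebra.TensorProduct.map ((valuationF μ K).comp (antipodeF l d))
        (AlgHom.id ℝ (MvPolynomial Diagram ℝ)))).comp
        (Algebra.TensorProduct.map liftAlg liftAlg) := by
    refine Algebra.TensorProduct.ext' fun a b => ?_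
    change liftAlg (valuationM μ P X (antipodeM l d a) • b) =
      valuationF μ K (antipodeF l d (liftAlg a)) • liftAlg b
    rw [map_smul, h, liftAlg_antipodeM]
  rw [renormF, AlgHom.comp_apply, AlgHom.comp_apply, ← map_liftAlg_fullCoprodM]
  exact DFunLike.congr_fun key (fullCoprodM l d z)

end Renormalisation

/-! ### Pairings of legs, and the forests of diagrams they form -/

section Pairing

variable {V E : Type}

/-- An ordered pair of distinct vertices for each `e : E`: one summand in the expansion of a power
of the off-diagonal quadratic form. -/
abbrev Pairing (V E : Type) : Type := E → {p : V × V // p.1 ≠ p.2}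

/-- The number of edges of a pairing at a vertex. -/
def Pairing.arity (L : Pairing V E) (v : V) : ℕ :=
  Nat.card {e : E // (L e).1.1 = v ∨ (L e).1.2 = v}

/-- A pairing with vertices of prescribed arities `a`, identified with a disjoint union of graphs. -/
@[ext]
structure PairingIso {I : Type} (Γ : I → Graph) (E : Type) (a : V → ℕ) where
  pairing : Pairing V E
  onV : (Σ i, (Γ i).V) ≃ V
  onE : (Σ i, (Γ i).E) ≃ E
  arity_eq : ∀ x, a (onV x) = (Γ x.1).arity x.2
  ends : ∀ x, s((pairing (onE x)).1.1, (pairing (onE x)).1.2) =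
    s(onV ⟨x.1, (Γ x.1).src x.2⟩, onV ⟨x.1, (Γ x.1).tgt x.2⟩)

namespace PairingIso

variable {I : Type} {Γ : I → Graph} {a : V → ℕ}

lemma arity_onV {L : Pairing V E} (onV : (Σ i, (Γ i).V) ≃ V) (onE : (Σ i, (Γ i).E) ≃ E)
    (ends : ∀ x, s((L (onE x)).1.1, (L (onE x)).1.2) =
      s(onV ⟨x.1, (Γ x.1).src x.2⟩, onV ⟨x.1, (Γ x.1).tgt x.2⟩)) (x : Σ i, (Γ i).V) :
    L.arity (onV x) = (Γ x.1).arity x.2 := by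
  have h1 : ∀ {T : Type} (a b c : T), (a = c ∨ b = c) ↔ c ∈ s(a, b) := fun a b c => by
    rw [Sym2.mem_iff, eq_comm, @eq_comm _ b]
  obtain ⟨i, u⟩ := x
  symm
  refine Nat.card_congr (Equiv.ofBijective (fun e => ⟨onE ⟨i, e.1⟩, ?_⟩) ⟨?_, ?_⟩)
  · rw [h1, ends, Sym2.mem_iff, onV.injective.eq_iff, onV.injective.eq_iff]
    rcases e.2 with h | h
    · exact Or.inl (by rw [h])
    · exact Or.inr (by rw [h])
  · intro e e' h
    have := onE.injective (Subtype.ext_iff.1 h)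
    exact Subtype.ext (by simpa using this)
  · rintro ⟨e, he⟩
    obtain ⟨⟨j, y⟩, rfl⟩ := onE.surjective e
    rw [h1, ends, Sym2.mem_iff, onV.injective.eq_iff, onV.injective.eq_iff] at he
    rcases he with h | h
    · obtain ⟨rfl, h⟩ := Sigma.mk.inj_iff.1 h
      exact ⟨⟨y, Or.inl (eq_of_heq h).symm⟩, rfl⟩
    · obtain ⟨rfl, h⟩ := Sigma.mk.inj_iff.1 h
      exact ⟨⟨y, Or.inr (eq_of_heq h).symm⟩, rfl⟩

/-- The pairing is recovered from the identification and an orientation of each edge. -/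
def equivOrientations : PairingIso Γ E a ≃
    Σ t : {ψ : (Σ i, (Γ i).V) ≃ V // ∀ x, a (ψ x) = (Γ x.1).arity x.2} × ((Σ i, (Γ i).E) ≃ E),
      ∀ x : Σ i, (Γ i).E, {p : {p : V × V // p.1 ≠ p.2} // s(p.1.1, p.1.2) =
        s(t.1.1 ⟨x.1, (Γ x.1).src x.2⟩, t.1.1 ⟨x.1, (Γ x.1).tgt x.2⟩)} where
  toFun t := ⟨(⟨t.onV, t.arity_eq⟩, t.onE), fun x => ⟨t.pairing (t.onE x), t.ends x⟩⟩
  invFun t :=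
    { pairing := fun e => (t.2 (t.1.2.symm e)).1
      onV := t.1.1.1
      onE := t.1.2
      arity_eq := t.1.1.2
      ends := fun x => by rw [Equiv.symm_apply_apply]; exact (t.2 x).2 }
  left_inv t := PairingIso.ext (funext fun e => by simp) rfl rfl
  right_inv t := by
    refine congrArg (Sigma.mk _) (funext fun x => Subtype.ext ?_)
    exact congrArg (fun y => (t.2 y).1) (Equiv.symm_apply_apply _ _)

lemma card_orientations {u v : V} (h : u ≠ v) :
    Nat.card {p : {p : V × V // p.1 ≠ p.2} // s(p.1.1, p.1.2) = s(u, v)} = 2 := by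
  rw [Nat.card_eq_two_iff]
  refine ⟨⟨⟨(u, v), h⟩, rfl⟩, ⟨⟨(v, u), h.symm⟩, Sym2.eq_swap⟩, fun h0 => ?_, ?_⟩
  · exact h (congrArg (fun p => p.1.1.1) h0)
  · rw [Set.eq_univ_iff_forall]
    rintro ⟨⟨⟨p, q⟩, hp⟩, hpq⟩
    rcases Sym2.eq_iff.1 hpq with ⟨rfl, rfl⟩ | ⟨rfl, rfl⟩
    · exact Or.inl rfl
    · exact Or.inr rfl

lemma card_eq [Fintype V] [Fintype E] [Fintype I] (hV : fiberCount (fun x : Σ i, (Γ i).V => (Γ x.1).arity x.2) = fiberCount a)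
    (hE : Fintype.card (Σ i, (Γ i).E) = Fintype.card E) :
    Nat.card (PairingIso Γ E a) = ((fiberCount a).prod fun _ r => r.factorial) *
      (Fintype.card E).factorial * 2 ^ Fintype.card E := by
  classical
  have h1 : ∀ t : {ψ : (Σ i, (Γ i).V) ≃ V // ∀ x, a (ψ x) = (Γ x.1).arity x.2} ×
      ((Σ i, (Γ i).E) ≃ E), Nat.card (∀ x : Σ i, (Γ i).E, {p : {p : V × V // p.1 ≠ p.2} //
        s(p.1.1, p.1.2) = s(t.1.1 ⟨x.1, (Γ x.1).src x.2⟩, t.1.1 ⟨x.1, (Γ x.1).tgt x.2⟩)}) =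
      2 ^ Fintype.card E := fun t => by
    rw [Nat.card_pi, Finset.prod_congr rfl fun x _ => card_orientations ?_, Finset.prod_const,
      Finset.card_univ, hE]
    intro h
    have h2 := t.1.1.injective h
    simp only [Sigma.mk.injEq, heq_eq_eq, true_and] at h2
    exact (Γ x.1).src_ne_tgt x.2 h2
  have := Fintype.ofFinite {ψ : (Σ i, (Γ i).V) ≃ V // ∀ x, a (ψ x) = (Γ x.1).arity x.2}
  have h2 : Nat.card ((Σ i, (Γ i).E) ≃ E) = (Fintype.card E).factorial := by
    rw [Nat.card_eq_fintype_card, Fintype.card_equiv (Fintype.equivOfCardEq hE), hE]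
  rw [Nat.card_congr equivOrientations, Nat.card_sigma, Finset.sum_congr rfl fun t _ => h1 t,
    Finset.sum_const, smul_eq_mul, Finset.card_univ, Fintype.card_prod, ← Nat.card_eq_fintype_card,
    ← Nat.card_eq_fintype_card, h2, card_equiv_of_fiberCount hV, hV]

end PairingIso

variable [Fintype V] [Fintype E] [Nonempty E]

/-- The edges of a pairing together with one further edge for every ordered pair of distinct
vertices. The additional edges only serve to make the graph connected. -/
abbrev Pairing.graph (L : Pairing V E) : Graph where
  V := V
  E := E ⊕ {p : V × V // p.1 ≠ p.2}
  fintypeE := Fintype.ofFinite _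
  src := Sum.elim (fun e => (L e).1.1) fun p => p.1.1
  tgt := Sum.elim (fun e => (L e).1.2) fun p => p.1.2
  src_ne_tgt e := match e with
    | .inl e => (L e).2
    | .inr p => p.2
  connected u v := by
    by_cases h : u = v
    · rw [h]; exact Relation.EqvGen.refl _
    · exact Relation.EqvGen.rel _ _ ⟨.inr ⟨(u, v), h⟩, rfl, rfl⟩
  nonempty_E := inferInstance

/-- The edges of `Pairing.graph` that belong to the pairing. -/
abbrev Pairing.edges (L : Pairing V E) : Finset L.graph.E := Finset.univ.map Function.Embedding.inl

/-- The forest of the connected components of a pairing. -/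
def Pairing.forest (L : Pairing V E) : DiagramForest := L.graph.componentForest L.edges

lemma Pairing.mem_edges (L : Pairing V E) (e : L.graph.E) : e ∈ L.edges ↔ ∃ e', Sum.inl e' = e := by
  simp [Pairing.edges]

namespace PairingIso

variable {I : Type} {Γ : I → Graph} {a : V → ℕ}

/-- The embedding of a forest underlying an identification with a pairing. -/
def toForestEmb (t : PairingIso Γ E a) : ForestEmb Γ t.pairing.graph t.pairing.edges where
  onV := t.onV
  onE x := Sum.inl (t.onE x)
  injV := t.onV.injective
  injE := Sum.inl_injective.comp t.onE.injective
  mem_iff e := by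
    rw [Pairing.mem_edges]
    constructor
    · rintro ⟨e, rfl⟩
      exact ⟨t.onE.symm e, by simp⟩
    · rintro ⟨x, rfl⟩
      exact ⟨_, rfl⟩
  ends i e := t.ends ⟨i, e⟩

lemma exists_of_forestEmb {L : Pairing V E} (hL : ∀ v, 0 < L.arity v)
    (φ : ForestEmb Γ L.graph L.edges) : ∃ (onV : (Σ i, (Γ i).V) ≃ V) (onE : (Σ i, (Γ i).E) ≃ E),
      (∀ x, onV x = φ.onV x) ∧ (∀ x, Sum.inl (onE x) = φ.onE x) ∧
      ∀ x, s((L (onE x)).1.1, (L (onE x)).1.2) =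
        s(onV ⟨x.1, (Γ x.1).src x.2⟩, onV ⟨x.1, (Γ x.1).tgt x.2⟩) := by
  have hE : ∀ x, ∃ e, Sum.inl e = φ.onE x := fun x => (L.mem_edges _).1 (φ.onE_mem x)
  choose η hη using hE
  have hends : ∀ x : Σ i, (Γ i).E, s((L (η x)).1.1, (L (η x)).1.2) =
      s(φ.onV ⟨x.1, (Γ x.1).src x.2⟩, φ.onV ⟨x.1, (Γ x.1).tgt x.2⟩) := fun x => by
    have := φ.ends x.1 x.2
    rw [← hη] at this
    exact this
  have hbij : Function.Bijective η := by
    refine ⟨fun x y h => φ.injE (by rw [← hη, ← hη, h]), fun e => ?_⟩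
    obtain ⟨x, hx⟩ := (φ.mem_iff (Sum.inl e)).1 ((L.mem_edges _).2 ⟨e, rfl⟩)
    exact ⟨x, Sum.inl_injective ((hη x).trans hx)⟩
  have hV : Function.Bijective φ.onV := by
    refine ⟨φ.injV, fun v => ?_⟩
    obtain ⟨⟨⟨e, he⟩⟩, _⟩ := Nat.card_pos_iff.1 (hL v)
    obtain ⟨x, rfl⟩ := hbij.2 e
    have hm : v ∈ s((L (η x)).1.1, (L (η x)).1.2) := by
      rw [Sym2.mem_iff]
      exact he.imp Eq.symm Eq.symm
    rw [hends, Sym2.mem_iff] at hm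
    rcases hm with h | h <;> exact ⟨_, h.symm⟩
  exact ⟨Equiv.ofBijective _ hV, Equiv.ofBijective _ hbij, fun _ => rfl, hη, hends⟩

lemma card_eq_sigma (ha : ∀ v, 0 < a v) : Nat.card (PairingIso Γ E a) =
    Nat.card (Σ L : {L : Pairing V E // ∀ v, L.arity v = a v}, ForestEmb Γ L.1.graph L.1.edges) := by
  have har : ∀ (t : PairingIso Γ E a) v, t.pairing.arity v = a v := fun t v => by
    obtain ⟨x, rfl⟩ := t.onV.surjective v
    rw [t.arity_eq, arity_onV t.onV t.onE t.ends]
  refine Nat.card_congr (Equiv.ofBijective (fun t => ⟨⟨t.pairing, har t⟩, t.toForestEmb⟩) ⟨?_, ?_⟩)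
  · intro t t' h
    have h1 := congrArg (fun x => x.1.1) h
    have h2 := congrArg (fun x => (x.2.onV : (Σ i, (Γ i).V) → V)) h
    have h3 := congrArg (fun x => (x.2.onE : (Σ i, (Γ i).E) → E ⊕ {p : V × V // p.1 ≠ p.2})) h
    refine PairingIso.ext h1 (Equiv.ext fun x => congrFun h2 x) (Equiv.ext fun x => ?_)
    exact Sum.inl_injective (congrFun h3 x)
  · rintro ⟨⟨L, hL⟩, φ⟩
    obtain ⟨onV, onE, h1, h2, h3⟩ := exists_of_forestEmb (fun v => (ha v).trans_eq (hL v).symm) φ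
    refine ⟨⟨L, onV, onE, fun x => ?_, h3⟩, ?_⟩
    · rw [← hL, arity_onV onV onE h3]
    · exact congrArg (Sigma.mk _) (ForestEmb.ext (funext h1) (funext h2))

end PairingIso

/-- The vertices of a forest of diagrams, counted by arity. -/
def totalCount (F : DiagramForest) : ℕ →₀ ℕ := F.sum fun Γ r => r • Γ.countExp

lemma totalCount_fiberCount {I : Type*} [Fintype I] (δ : I → Diagram) :
    totalCount (fiberCount δ) =
      fiberCount fun x : Σ i, (δ i).graph.V => (δ x.1).graph.arity x.2 := by
  rw [totalCount, fiberCount, ← Finsupp.sum_finsetSum_index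
    (h := fun (Γ : Diagram) (r : ℕ) => r • Γ.countExp) (fun _ => zero_smul _ _)
    fun _ _ _ => add_smul _ _ _, fiberCount, Fintype.sum_sigma]
  refine Finset.sum_congr rfl fun i _ => ?_
  exact (Finsupp.sum_single_index (h := fun (Γ : Diagram) (r : ℕ) => r • Γ.countExp)
    (zero_smul _ _)).trans (one_smul _ _)

lemma sum_mapDomain_count (F : DiagramForest) :
    ((F.mapDomain Diagram.count).sum fun γ r => r • γ.exp) = totalCount F :=
  Finsupp.sum_mapDomain_index (fun _ => zero_smul _ _) fun _ _ _ => add_smul _ _ _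

lemma Pairing.exists_iso {L : Pairing V E} (hL : ∀ v, 0 < L.arity v) :
    ∃ (n : ℕ) (δ : Fin n → Diagram) (onV : (Σ i, (δ i).graph.V) ≃ V)
      (onE : (Σ i, (δ i).graph.E) ≃ E), fiberCount δ = L.forest ∧
      ∀ x, s((L (onE x)).1.1, (L (onE x)).1.2) =
        s(onV ⟨x.1, (δ x.1).graph.src x.2⟩, onV ⟨x.1, (δ x.1).graph.tgt x.2⟩) := by
  obtain ⟨n, δ, hδ⟩ := exists_fiberCount_eq L.forest
  have h1 : Nat.card (ForestEmb (fun i => (δ i).graph) L.graph L.edges) = symmF L.forest :=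
    ForestEmb.card_eq_of_forest _ _ _ (by simp only [Diagram.diagram_graph]; exact hδ)
  have h2 : 0 < Nat.card (ForestEmb (fun i => (δ i).graph) L.graph L.edges) :=
    h1 ▸ symmF_pos _
  obtain ⟨⟨φ⟩, _⟩ := Nat.card_pos_iff.1 h2
  obtain ⟨onV, onE, _, _, h⟩ := PairingIso.exists_of_forestEmb hL φ
  exact ⟨n, δ, onV, onE, hδ, h⟩

lemma Pairing.totalCount_forest {L : Pairing V E} (hL : ∀ v, 0 < L.arity v) :
    totalCount L.forest = fiberCount L.arity := by
  obtain ⟨n, δ, onV, onE, hδ, h⟩ := Pairing.exists_iso hL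
  rw [← hδ, totalCount_fiberCount, ← fiberCount_comp_equiv _ onV]
  exact congrArg fiberCount (funext fun x =>
    (PairingIso.arity_onV (Γ := fun i => (δ i).graph) onV onE h x).symm)

/-- The number of pairings with prescribed arities forming a given forest: they are obtained by
labelling the vertices, labelling the edges, and orienting the edges. -/
theorem Pairing.card_forest_eq {a : V → ℕ} (ha : ∀ v, 0 < a v)
    (hE : ∑ v, a v = 2 * Fintype.card E) {F : DiagramForest} (hF : totalCount F = fiberCount a) :
    Nat.card {L : Pairing V E // (∀ v, L.arity v = a v) ∧ L.forest = F} * symmF F =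
      ((fiberCount a).prod fun _ r => r.factorial) *
      (Fintype.card E).factorial * 2 ^ Fintype.card E := by
  classical
  obtain ⟨n, δ, rfl⟩ := exists_fiberCount_eq F
  rw [totalCount_fiberCount] at hF
  have hE' : Fintype.card (Σ i, (δ i).graph.E) = Fintype.card E := by
    obtain ⟨e, he⟩ := exists_equiv_of_fiberCount hF
    have h1 : ∑ x : Σ i, (δ i).graph.V, (δ x.1).graph.arity x.2 = ∑ v, a v :=
      Fintype.sum_equiv e _ _ fun x => (he x).symm
    rw [Fintype.sum_sigma, hE] at h1
    simp only [Graph.sum_arity] at h1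
    rw [← Finset.mul_sum, ← Fintype.card_sigma] at h1
    exact Nat.eq_of_mul_eq_mul_left two_pos h1
  rw [← PairingIso.card_eq (Γ := fun i => (δ i).graph) hF hE', PairingIso.card_eq_sigma ha]
  have := Fintype.ofFinite {L : Pairing V E // ∀ v, L.arity v = a v}
  have h2 : ∀ L : {L : Pairing V E // ∀ v, L.arity v = a v},
      Nat.card (ForestEmb (fun i => (δ i).graph) L.1.graph L.1.edges) =
        if L.1.forest = fiberCount δ then symmF (fiberCount δ) else 0 := fun L => by
    have h3 : fiberCount (fun i => (δ i).graph.diagram) = fiberCount δ := by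
      simp only [Diagram.diagram_graph]
    split_ifs with h
    · rw [ForestEmb.card_eq_of_forest _ _ _ (h3.trans h.symm)]
      exact congrArg symmF h
    · have := ForestEmb.isEmpty_of_forest (Γ := fun i => (δ i).graph) (G := L.1.graph)
        (A := L.1.edges) fun h4 => h (h4.symm.trans h3)
      exact Nat.card_of_isEmpty
  rw [Nat.card_sigma, Finset.sum_congr rfl fun L _ => h2 L, ← Finset.sum_filter, Finset.sum_const,
    smul_eq_mul, ← Fintype.card_subtype, ← Nat.card_eq_fintype_card]
  congr 1
  exact Nat.card_congr (Equiv.subtypeSubtypeEquivSubtypeInter _ _).symm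

end Pairing

/-! ### Integrals over the vertices of a pairing -/

section Valuation

variable {Λ : Type*} [MeasurableSpace Λ]

/-- Fubini's theorem for functions of disjoint groups of variables. -/
lemma integral_prod_sigma {I V : Type*} {W : I → Type*} [Fintype I] [∀ i, Fintype (W i)]
    [Fintype V] (ψ : (Σ i, W i) ≃ V) (μ : Measure Λ) [SigmaFinite μ] (f : ∀ i, (W i → Λ) → ℝ) :
    ∫ x : V → Λ, ∏ i, f i (fun u => x (ψ ⟨i, u⟩)) ∂(Measure.pi fun _ => μ) =
      ∏ i, ∫ y : W i → Λ, f i y ∂(Measure.pi fun _ => μ) := by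
  let e : (∀ i, W i → Λ) ≃ᵐ (V → Λ) :=
    { toFun := fun y v => y (ψ.symm v).1 (ψ.symm v).2
      invFun := fun x i u => x (ψ ⟨i, u⟩)
      left_inv := fun y => by
        funext i u
        exact congrArg (fun z : Σ i, W i => y z.1 z.2) (ψ.symm_apply_apply ⟨i, u⟩)
      right_inv := fun x => by
        funext v
        exact congrArg x (ψ.apply_symm_apply v)
      measurable_toFun := by
        rw [Equiv.coe_fn_mk]
        exact measurable_pi_lambda _ fun v => (measurable_pi_apply _).comp (measurable_pi_apply _)
      measurable_invFun := by
        rw [Equiv.coe_fn_symm_mk]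
        exact measurable_pi_lambda _ fun i => measurable_pi_lambda _ fun u => measurable_pi_apply _ }
  have he : MeasurePreserving e (Measure.pi fun i => Measure.pi fun _ : W i => μ)
      (Measure.pi fun _ => μ) := by
    refine ⟨e.measurable, (Measure.pi_eq fun s hs => ?_).symm⟩
    have hpre : e ⁻¹' (Set.univ.pi s) =
        Set.univ.pi fun i => Set.univ.pi fun u => s (ψ ⟨i, u⟩) := by
      ext y
      simp only [Set.mem_preimage, Set.mem_univ_pi]
      constructor
      · intro h i u
        have := h (ψ ⟨i, u⟩)
        change y (ψ.symm _).1 (ψ.symm _).2 ∈ _ at this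
        rwa [Equiv.symm_apply_apply] at this
      · intro h v
        have := h (ψ.symm v).1 (ψ.symm v).2
        rwa [Sigma.eta, Equiv.apply_symm_apply] at this
    rw [e.map_apply, hpre, Measure.pi_pi]
    simp only [Measure.pi_pi]
    rw [← Fintype.prod_sigma' fun i u => μ (s (ψ ⟨i, u⟩))]
    exact Fintype.prod_equiv ψ _ _ fun _ => rfl
  rw [← integral_fintype_prod_eq_prod, ← he.integral_comp']
  refine integral_congr_ae (Filter.Eventually.of_forall fun y => ?_)
  refine Finset.prod_congr rfl fun i _ => congrArg (f i) (funext fun u => ?_)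
  change y (ψ.symm _).1 (ψ.symm _).2 = _
  rw [Equiv.symm_apply_apply]

/-- The integral of a product of kernels along the edges of a pairing factorizes over the connected
components of the pairing. -/
lemma Pairing.integral_prod_kernel {V E : Type} [Fintype V] [Fintype E] [Nonempty E]
    [AddCommGroup Λ] (μ : Measure Λ) [SigmaFinite μ] {K : Λ → ℝ} (hK : ∀ x, K (-x) = K x)
    {L : Pairing V E} (hL : ∀ v, 0 < L.arity v) :
    ∫ x : V → Λ, ∏ e, K (x (L e).1.1 - x (L e).1.2) ∂(Measure.pi fun _ => μ) =
      valuationF μ K (MvPolynomial.monomial L.forest 1) := by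
  obtain ⟨n, δ, onV, onE, hδ, h⟩ := Pairing.exists_iso hL
  have hR : valuationF μ K (MvPolynomial.monomial L.forest 1) =
      ∏ i, Diagram.valuation μ K (δ i) := by
    rw [← hδ, fiberCount, MvPolynomial.monomial_sum_one, map_prod]
    exact Finset.prod_congr rfl fun i _ => MvPolynomial.aeval_X _ _
  rw [hR]
  simp only [Diagram.valuation]
  rw [← integral_prod_sigma onV μ fun i (y : (δ i).graph.V → Λ) =>
    ∏ e, K (y ((δ i).graph.src e) - y ((δ i).graph.tgt e))]
  refine integral_congr_ae (Filter.Eventually.of_forall fun x => ?_)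
  simp only
  rw [← Fintype.prod_sigma' fun i e => K (x (onV ⟨i, (δ i).graph.src e⟩) -
    x (onV ⟨i, (δ i).graph.tgt e⟩))]
  refine (Fintype.prod_equiv onE _ _ fun y => ?_).symm
  rcases Sym2.eq_iff.1 (h y) with ⟨h1, h2⟩ | ⟨h1, h2⟩
  · rw [h1, h2]
  · rw [h1, h2, ← hK, neg_sub]

end Valuation

/-! ### Wick's formula for the moments -/

section Moment

open Classical in
/-- The expansion of a power of the off-diagonal quadratic form over pairings. -/
lemma coeff_quadForm_pow {V E : Type} [Fintype V] [Fintype E] (B : V → V → ℝ)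
    (hB : ∀ v, B v v = 0) (a : V →₀ ℕ) :
    (quadForm B ^ Fintype.card E).coeff a =
      ∑ L : {L : Pairing V E // ∀ v, L.arity v = a v},
        (∏ e, B (L.1 e).1.1 (L.1 e).1.2) / 2 ^ Fintype.card E := by
  have h1 : quadForm B = ∑ p : {p : V × V // p.1 ≠ p.2}, MvPolynomial.monomial
      (Finsupp.single p.1.1 1 + Finsupp.single p.1.2 1) (B p.1.1 p.1.2 / 2) := by
    have h2 : ∀ p : V × V, MvPolynomial.C (B p.1 p.2 / 2) *
        (MvPolynomial.X p.1 * MvPolynomial.X p.2) = MvPolynomial.monomial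
        (Finsupp.single p.1 1 + Finsupp.single p.2 1) (B p.1 p.2 / 2) := fun p => by
      rw [MvPolynomial.X, MvPolynomial.X, MvPolynomial.monomial_mul, one_mul,
        MvPolynomial.C_mul_monomial, mul_one]
    rw [quadForm, Finset.sum_congr rfl fun p _ => h2 p,
      ← Fintype.sum_subtype_add_sum_subtype fun p : V × V => p.1 ≠ p.2]
    refine (congrArg _ (Finset.sum_eq_zero fun p _ => ?_)).trans (add_zero _)
    rw [not_not.1 p.2, hB, zero_div, map_zero]
  have h3 : ∀ (L : Pairing V E), ∑ e, (Finsupp.single (L e).1.1 1 + Finsupp.single (L e).1.2 1) =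
      a ↔ ∀ v, L.arity v = a v := fun L => by
    rw [DFunLike.ext_iff]
    refine forall_congr' fun v => ?_
    rw [Pairing.arity, Nat.card_eq_fintype_card, Fintype.card_subtype, Finset.card_filter,
      Finsupp.finsetSum_apply]
    refine Eq.congr_left (Finset.sum_congr rfl fun e _ => ?_)
    have hne := (L e).2
    rw [Finsupp.add_apply, Finsupp.single_apply, Finsupp.single_apply]
    grind
  have hpow : quadForm B ^ Fintype.card E = ∑ L : Pairing V E, MvPolynomial.monomial
      (∑ e, (Finsupp.single (L e).1.1 1 + Finsupp.single (L e).1.2 1))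
      ((∏ e, B (L e).1.1 (L e).1.2) / 2 ^ Fintype.card E) := by
    rw [h1, ← Finset.card_univ, ← Finset.prod_const, Finset.prod_univ_sum, Fintype.piFinset_univ]
    refine Finset.sum_congr rfl fun L _ => ?_
    rw [← Finset.prod_const, ← Finset.prod_div_distrib]
    exact (MvPolynomial.monomial_sum_prod _ _ _).symm
  rw [hpow, MvPolynomial.coeff_sum,
    ← Fintype.sum_subtype_add_sum_subtype fun L : Pairing V E => ∀ v, L.arity v = a v]
  refine Eq.trans (congrArg₂ _ (Finset.sum_congr rfl fun L _ => ?_)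
    (Finset.sum_eq_zero fun L _ => ?_)) (add_zero _)
  · rw [MvPolynomial.coeff_monomial, if_pos ((h3 _).2 L.2)]
  · rw [MvPolynomial.coeff_monomial, if_neg ((h3 _).not.2 L.2)]

variable {Λ Ω : Type*} [AddCommGroup Λ] [MeasurableSpace Ω] {P : Measure Ω}
  {X : Λ → Ω → ℝ} {K : Λ → ℝ}

lemma kernel_neg (hcov : ∀ x y, P[fun ω => X x ω * X y ω] = K (x - y)) (x : Λ) :
    K (-x) = K x := by
  have h1 := hcov 0 x
  have h2 := hcov x 0
  rw [zero_sub] at h1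
  rw [sub_zero] at h2
  rw [← h1, ← h2]
  exact integral_congr_ae (Filter.Eventually.of_forall fun ω => mul_comm _ _)

lemma variance_eq_kernel (hgauss : IsGaussianProcess X P) (hmean : ∀ x, P[X x] = 0)
    (hcov : ∀ x y, P[fun ω => X x ω * X y ω] = K (x - y)) (x : Λ) : Var[X x; P] = K 0 := by
  rw [variance_of_integral_eq_zero (hgauss.aemeasurable x) (hmean x), ← sub_self x, ← hcov]
  exact integral_congr_ae (Filter.Eventually.of_forall fun ω => pow_two _)

lemma map_eq_gaussianReal_kernel (hgauss : IsGaussianProcess X P) (hmean : ∀ x, P[X x] = 0)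
    (hcov : ∀ x y, P[fun ω => X x ω * X y ω] = K (x - y)) (x : Λ) :
    P.map (X x) = gaussianReal 0 (K 0).toNNReal := by
  rw [(hgauss.hasGaussianLaw_eval x).map_eq_gaussianReal, hmean,
    variance_eq_kernel hgauss hmean hcov]

lemma abs_kernel_le (hgauss : IsGaussianProcess X P)
    (hcov : ∀ x y, P[fun ω => X x ω * X y ω] = K (x - y)) (x y : Λ) : |K (x - y)| ≤ K 0 := by
  have hL : ∀ x, MemLp (X x) 2 P := fun x => (hgauss.hasGaussianLaw_eval x).memLp_two
  have hi : ∀ x y, Integrable (fun ω => X x ω * X y ω) P := fun x y => (hL x).integrable_mul (hL y)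
  have hxx : ∀ x, ∫ ω, X x ω * X x ω ∂P = K 0 := fun x => by rw [hcov, sub_self]
  rw [← hcov]
  calc |∫ ω, X x ω * X y ω ∂P| ≤ ∫ ω, |X x ω * X y ω| ∂P := abs_integral_le_integral_abs
    _ ≤ ∫ ω, (X x ω * X x ω + X y ω * X y ω) / 2 ∂P := by
        refine integral_mono (hi x y).abs (((hi x x).add (hi y y)).div_const 2) fun ω => ?_
        simp only
        rw [abs_le]
        constructor
        · nlinarith [sq_nonneg (X x ω + X y ω)]
        · nlinarith [sq_nonneg (X x ω - X y ω)]
    _ = K 0 := by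
        rw [integral_div, integral_add (hi x x) (hi y y), hxx, hxx, add_self_div_two]

lemma integral_prod_hermiteVar_eq (hgauss : IsGaussianProcess X P)
    (hcov : ∀ x y, P[fun ω => X x ω * X y ω] = K (x - y)) {V : Type*} [Fintype V] [Nonempty V]
    {a : V →₀ ℕ} (ha : ∀ v, 0 < a v) (x : V → Λ) :
    ∫ ω, ∏ v, hermiteVar (a v) (K 0) (X (x v) ω) ∂P =
      ∫ ω, MvPolynomial.eval (fun v => X (x v) ω) (hermiteProd (K 0) a) ∂P := by
  by_cases hK : K 0 = 0
  · -- the field vanishes almost surely, and `hermitePoly 0 n` is the monomial of degree `n`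
    obtain ⟨v⟩ := ‹Nonempty V›
    have h0 : X (x v) =ᵐ[P] 0 := by
      have h1 : ∫ ω, X (x v) ω * X (x v) ω ∂P = 0 := by rw [hcov, sub_self, hK]
      have hL := (hgauss.hasGaussianLaw_eval (x v)).memLp_two
      rw [integral_eq_zero_iff_of_nonneg (fun ω => mul_self_nonneg _) (hL.integrable_mul hL)] at h1
      filter_upwards [h1] with ω hω
      exact mul_self_eq_zero.1 hω
    have hpoly : ∀ n, hermitePoly 0 n = Polynomial.X ^ n := fun n => by
      induction n with
      | zero => rfl
      | succ n ih => rw [hermitePoly, ih, pow_succ', Polynomial.C_0, zero_mul, sub_zero]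
    refine integral_congr_ae ?_
    filter_upwards [h0] with ω hω
    rw [eval_hermiteProd, hK, Finset.prod_eq_zero (Finset.mem_univ v) (hermiteVar_zero _
      (ha v).ne' _), Finset.prod_eq_zero (Finset.mem_univ v)]
    rw [hpoly, Polynomial.eval_pow, Polynomial.eval_X, hω, Pi.zero_apply, zero_pow (ha v).ne']
  · simp only [hermiteVar_eq_eval hK, eval_hermiteProd]

variable [MeasurableSpace Λ] [IsProbabilityMeasure P]

lemma measurable_kernel_sub (hmeas : Measurable (Function.uncurry X))
    (hcov : ∀ x y, P[fun ω => X x ω * X y ω] = K (x - y)) :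
    Measurable fun p : Λ × Λ => K (p.1 - p.2) := by
  have h1 : Measurable fun q : (Λ × Λ) × Ω => X q.1.1 q.2 * X q.1.2 q.2 :=
    (hmeas.comp ((measurable_fst.comp measurable_fst).prodMk measurable_snd)).mul
      (hmeas.comp ((measurable_snd.comp measurable_fst).prodMk measurable_snd))
  have h2 := (h1.stronglyMeasurable.integral_prod_right' (ν := P)).measurable
  simp only [hcov] at h2
  exact h2

/-- The field and hence products of polynomials in it are integrable over space and randomness,
because the law of the field is the same Gaussian law at all points. -/
lemma integrable_prod_polynomial (hmeas : Measurable (Function.uncurry X))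
    (hgauss : IsGaussianProcess X P) (hmean : ∀ x, P[X x] = 0)
    (hcov : ∀ x y, P[fun ω => X x ω * X y ω] = K (x - y)) {V : Type*} [Fintype V] [Nonempty V]
    (ν : Measure (V → Λ)) [IsFiniteMeasure ν] (p : V → Polynomial ℝ) :
    Integrable (fun z : (V → Λ) × Ω => ∏ v, (p v).eval (X (z.1 v) z.2)) (ν.prod P) := by
  set n := Fintype.card V
  have hX : ∀ v : V, Measurable fun z : (V → Λ) × Ω => X (z.1 v) z.2 := fun v => by
    have h : Measurable fun z : (V → Λ) × Ω => (z.1 v, z.2) := by fun_prop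
    exact hmeas.comp h
  have hp : ∀ v, Measurable fun z : (V → Λ) × Ω => (p v).eval (X (z.1 v) z.2) := fun v =>
    (p v).continuous.measurable.comp (hX v)
  have hint : ∀ v, Integrable (fun z : (V → Λ) × Ω => |(p v).eval (X (z.1 v) z.2)| ^ n)
      (ν.prod P) := by
    intro v
    have hg : Integrable (fun y : ℝ => |(p v).eval y| ^ n)
        (gaussianReal 0 (K 0).toNNReal) := by
      have h1 := integrable_eval (P := gaussianReal 0 (K 0).toNNReal) (Y := fun _ : Unit => id)
        (fun _ q hq => memLp_id_gaussianReal' q hq)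
        ((Polynomial.aeval (MvPolynomial.X ()) (p v)) ^ n)
      have h2 : ∀ y : ℝ, MvPolynomial.eval (fun _ : Unit => y)
          ((Polynomial.aeval (MvPolynomial.X ()) (p v)) ^ n) = (p v).eval y ^ n := fun y => by
        rw [map_pow, ← MvPolynomial.coe_aeval_eq_eval, RingHom.coe_coe,
          ← Polynomial.aeval_algHom_apply, MvPolynomial.aeval_X, Polynomial.coe_aeval_eq_eval]
      have h3 := h1.abs
      simp only [id, h2, abs_pow] at h3
      exact h3
    have hmp : ∀ x, MeasurePreserving (X x) P (gaussianReal 0 (K 0).toNNReal) := fun x =>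
      ⟨hmeas.comp measurable_prodMk_left, map_eq_gaussianReal_kernel hgauss hmean hcov x⟩
    rw [integrable_prod_iff ((hp v).abs.pow_const n).aestronglyMeasurable]
    refine ⟨Filter.Eventually.of_forall fun x => (hmp (x v)).integrable_comp_of_integrable hg, ?_⟩
    have hc : ∀ x : V → Λ, ∫ ω, ‖|(p v).eval (X (x v) ω)| ^ n‖ ∂P =
        ∫ y, ‖|(p v).eval y| ^ n‖ ∂(gaussianReal 0 (K 0).toNNReal) := fun x => by
      rw [← (hmp (x v)).map_eq, integral_map (hmp (x v)).measurable.aemeasurable]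
      exact (((p v).continuous.abs.pow n).norm).aestronglyMeasurable
    simp only [hc]
    exact integrable_const _
  refine Integrable.mono' (integrable_finsetSum Finset.univ fun v _ => hint v)
    (Finset.measurable_prod _ fun v _ => hp v).aestronglyMeasurable
    (Filter.Eventually.of_forall fun z => ?_)
  -- a product of `n` numbers is at most the `n`-th power of the largest one
  obtain ⟨w, hw⟩ := Finite.exists_max fun v => |(p v).eval (X (z.1 v) z.2)|
  rw [Real.norm_eq_abs, Finset.abs_prod]
  calc ∏ v, |(p v).eval (X (z.1 v) z.2)| ≤ ∏ _v : V, |(p w).eval (X (z.1 w) z.2)| :=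
        Finset.prod_le_prod (fun _ _ => abs_nonneg _) fun v _ => hw v
    _ = |(p w).eval (X (z.1 w) z.2)| ^ n := by rw [Finset.prod_const, Finset.card_univ]
    _ ≤ _ := Finset.single_le_sum (f := fun v => |(p v).eval (X (z.1 v) z.2)| ^ n)
        (fun _ _ => by positivity) (Finset.mem_univ w)

lemma integrable_prod_hermiteVar (hmeas : Measurable (Function.uncurry X))
    (hgauss : IsGaussianProcess X P) (hmean : ∀ x, P[X x] = 0)
    (hcov : ∀ x y, P[fun ω => X x ω * X y ω] = K (x - y)) {V : Type*} [Fintype V] [Nonempty V]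
    (ν : Measure (V → Λ)) [IsFiniteMeasure ν] {a : V → ℕ} (ha : ∀ v, 0 < a v) :
    Integrable (fun z : (V → Λ) × Ω => ∏ v, hermiteVar (a v) (K 0) (X (z.1 v) z.2))
      (ν.prod P) := by
  by_cases hK : K 0 = 0
  · have h0 : ∀ z : (V → Λ) × Ω, ∏ v, hermiteVar (a v) (K 0) (X (z.1 v) z.2) = 0 := fun z => by
      obtain ⟨v⟩ := ‹Nonempty V›
      exact Finset.prod_eq_zero (Finset.mem_univ v) (by rw [hK, hermiteVar_zero _ (ha v).ne'])
    simp only [h0]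
    exact integrable_zero _ _ _
  · simp only [hermiteVar_eq_eval hK]
    exact integrable_prod_polynomial hmeas hgauss hmean hcov ν _

open Classical in
/-- Wick's formula for the moments of the integrated Hermite polynomials of the field: the pairings
of the legs contribute the valuations of the forests of diagrams that they form. -/
theorem integral_prod_integral_hermiteVar (hmeas : Measurable (Function.uncurry X))
    (hgauss : IsGaussianProcess X P) (hmean : ∀ x, P[X x] = 0)
    (hcov : ∀ x y, P[fun ω => X x ω * X y ω] = K (x - y)) (μ : Measure Λ) [IsFiniteMeasure μ]
    {V E : Type} [Fintype V] [Fintype E] [Nonempty E] {a : V → ℕ} (ha : ∀ v, 0 < a v)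
    (hE : ∑ v, a v = 2 * Fintype.card E) :
    ∫ ω, ∏ v, ∫ x, hermiteVar (a v) (K 0) (X x ω) ∂μ ∂P =
      (∏ v, ((a v).factorial : ℝ)) / (2 ^ Fintype.card E * (Fintype.card E).factorial) *
        ∑ L : {L : Pairing V E // ∀ v, L.arity v = a v},
          valuationF μ K (MvPolynomial.monomial L.1.forest 1) := by
  have hV : Nonempty V := by
    by_contra h
    rw [not_nonempty_iff] at h
    rw [Fintype.sum_empty] at hE
    have := Fintype.card_pos (α := E)
    omega
  set a' : V →₀ ℕ := Finsupp.equivFunOnFinite.symm a with ha'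
  have h1 : ∀ ω, ∏ v, ∫ x, hermiteVar (a v) (K 0) (X x ω) ∂μ =
      ∫ x : V → Λ, ∏ v, hermiteVar (a v) (K 0) (X (x v) ω) ∂(Measure.pi fun _ => μ) := fun ω =>
    (integral_fintype_prod_eq_prod (fun v x => hermiteVar (a v) (K 0) (X x ω))).symm
  simp only [h1]
  rw [← integral_integral_swap (f := fun (x : V → Λ) ω =>
    ∏ v, hermiteVar (a v) (K 0) (X (x v) ω))
    (integrable_prod_hermiteVar hmeas hgauss hmean hcov _ ha)]
  have h2 : ∀ x : V → Λ, ∫ ω, ∏ v, hermiteVar (a v) (K 0) (X (x v) ω) ∂P =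
      (∏ v, ((a v).factorial : ℝ)) / (2 ^ Fintype.card E * (Fintype.card E).factorial) *
        ∑ L : {L : Pairing V E // ∀ v, L.arity v = a v},
          ∏ e, K (x (L.1 e).1.1 - x (L.1 e).1.2) := fun x => by
    refine (integral_prod_hermiteVar_eq (a := a') hgauss hcov ha x).trans ?_
    rw [integral_hermiteProd (Y := fun v => X (x v)) (hgauss.comp_right x) (fun v => hmean (x v)) (σ := K 0)
        (fun v => (hcov _ _).trans (by rw [sub_self])) (Fintype.card E) a' hE,
      coeff_quadForm_pow (E := E) (fun v w => if v = w then 0 else ∫ ω, X (x v) ω * X (x w) ω ∂P)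
        (fun v => if_pos rfl), ← Finset.sum_div]
    have h3 : ∀ L : {L : Pairing V E // ∀ v, L.arity v = a' v},
        (∏ e, if (L.1 e).1.1 = (L.1 e).1.2 then 0 else
          ∫ ω, X (x (L.1 e).1.1) ω * X (x (L.1 e).1.2) ω ∂P) =
        ∏ e, K (x (L.1 e).1.1 - x (L.1 e).1.2) := fun L =>
      Finset.prod_congr rfl fun e _ => by rw [if_neg (L.1 e).2]; exact hcov _ _
    rw [Finset.sum_congr rfl fun L _ => h3 L]
    change (∏ v, ((a v).factorial : ℝ)) * _ = _
    field_simp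
    rfl
  have hi : ∀ L : Pairing V E, Integrable
      (fun x : V → Λ => ∏ e, K (x (L e).1.1 - x (L e).1.2)) (Measure.pi fun _ => μ) := fun L => by
    have hm : ∀ e, Measurable fun x : V → Λ => K (x (L e).1.1 - x (L e).1.2) := fun e => by
      have h : Measurable fun x : V → Λ => (x (L e).1.1, x (L e).1.2) := by fun_prop
      exact (measurable_kernel_sub hmeas hcov).comp h
    refine Integrable.mono' (integrable_const (K 0 ^ Fintype.card E))
      (Finset.measurable_prod _ fun e _ => hm e).aestronglyMeasurable
      (Filter.Eventually.of_forall fun x => ?_)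
    rw [Real.norm_eq_abs, Finset.abs_prod]
    refine (Finset.prod_le_prod (fun _ _ => abs_nonneg _) fun e _ =>
      abs_kernel_le hgauss hcov _ _).trans_eq ?_
    rw [Finset.prod_const, Finset.card_univ]
  simp only [h2]
  rw [integral_const_mul, integral_finsetSum _ fun L _ => hi L.1]
  congr 1
  refine Finset.sum_congr rfl fun L _ => ?_
  exact L.1.integral_prod_kernel μ (kernel_neg hcov) fun v => (ha v).trans_eq (L.2 v).symm

end Moment

/-! ### The valuations are intertwined by the lift -/

section Cumulant

/-- The forests `s` of multi-indices with `∑ β_i = β`, including `β` itself. -/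
def splittings (β : MIndex) : Finset MForest :=
  insert (Finsupp.single β 1) (decomps_finite β).toFinset

lemma mem_splittings {β : MIndex} {s : MForest} :
    s ∈ splittings β ↔ (s.sum fun γ r => r • γ.exp) = β.exp := by
  rw [splittings, Finset.mem_insert, Set.Finite.mem_toFinset]
  constructor
  · rintro (rfl | h)
    · exact (Finsupp.sum_single_index (h := fun (γ : MIndex) (r : ℕ) => r • γ.exp)
        (zero_smul _ _)).trans (one_smul _ _)
    · exact h.2
  · intro h
    obtain ⟨n, δ, rfl⟩ := exists_fiberCount_eq s
    have hn : ((fiberCount δ).sum fun _ r => r) = n := by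
      rw [fiberCount, ← Finsupp.sum_finsetSum_index (h := fun (_ : MIndex) (r : ℕ) => r)
        (fun _ => rfl) fun _ _ _ => rfl]
      simp
    have hsum : ((fiberCount δ).sum fun γ r => r • γ.exp) = ∑ i, (δ i).exp := by
      rw [fiberCount, ← Finsupp.sum_finsetSum_index
        (h := fun (γ : MIndex) (r : ℕ) => r • γ.exp) (fun _ => zero_smul _ _)
        fun _ _ _ => add_smul _ _ _]
      exact Finset.sum_congr rfl fun i _ =>
        (Finsupp.sum_single_index (h := fun (γ : MIndex) (r : ℕ) => r • γ.exp)
          (zero_smul _ _)).trans (one_smul _ _)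
    match n with
    | 0 =>
      rw [hsum, Fin.sum_univ_zero] at h
      have := β.halfEdges_pos
      rw [MIndex.halfEdges, ← h] at this
      simp at this
    | 1 =>
      left
      rw [hsum, Fin.sum_univ_one] at h
      rw [fiberCount, Fin.sum_univ_one, Subtype.ext h]
    | n + 2 =>
      right
      exact ⟨by rw [hn]; omega, h⟩

lemma single_notMem_decomps (β : MIndex) : Finsupp.single β 1 ∉ decomps β := by
  intro h
  have h1 := h.1
  rw [Finsupp.sum_single_index rfl] at h1
  omega

lemma MIndex.symm_eq_mul (β : MIndex) :
    β.symm = β.expFactorial * β.exp.prod fun k r => k.factorial ^ r :=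
  Finset.prod_mul_distrib

lemma groupings_mul_symmM {β : MIndex} {s : MForest} (hs : s ∈ splittings β) :
    groupings β s * symmM s = β.symm := by
  have h1 : symmM s = (s.prod fun γ r => r.factorial * γ.expFactorial ^ r) *
      s.prod fun γ r => (γ.exp.prod fun k r => k.factorial ^ r) ^ r := by
    rw [symmM, ← Finsupp.prod_mul]
    refine Finset.prod_congr rfl fun γ _ => ?_
    simp only
    rw [MIndex.symm_eq_mul, mul_pow, mul_assoc]
  have h2 : (s.prod fun γ r => (γ.exp.prod fun k r => k.factorial ^ r) ^ r) =
      β.exp.prod fun k r => k.factorial ^ r := by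
    rw [← mem_splittings.1 hs, Finsupp.sum, ← Finsupp.prod_finsetSum_index (fun _ => pow_zero _)
      fun _ _ _ => pow_add _ _ _]
    refine Finset.prod_congr rfl fun γ _ => ?_
    simp only
    rw [Finsupp.prod_of_support_subset _ Finsupp.support_smul _ fun _ _ => pow_zero _,
      Finsupp.prod, ← Finset.prod_pow]
    refine Finset.prod_congr rfl fun k _ => ?_
    rw [Finsupp.smul_apply, smul_eq_mul, mul_comm, pow_mul]
  have h3 : (s.prod fun γ r => (r.factorial : ℝ) * (γ.expFactorial : ℝ) ^ r) =
      ((s.prod fun γ r => r.factorial * γ.expFactorial ^ r : ℕ) : ℝ) := by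
    rw [Finsupp.prod, Finsupp.prod]
    push_cast
    rfl
  have h4 : 0 < s.prod fun γ r => r.factorial * γ.expFactorial ^ r :=
    Finset.prod_pos fun γ _ => Nat.mul_pos (Nat.factorial_pos _)
      (pow_pos (Finset.prod_pos fun _ _ => Nat.factorial_pos _) _)
  have h5 : ((s.prod fun γ r => r.factorial * γ.expFactorial ^ r : ℕ) : ℝ) ≠ 0 := by
    exact_mod_cast h4.ne'
  rw [groupings, h1, h2, h3, MIndex.symm_eq_mul, Nat.cast_mul, Nat.cast_mul, ← mul_assoc,
    div_mul_cancel₀ _ h5]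

lemma groupings_single (β : MIndex) : groupings β (Finsupp.single β 1) = 1 := by
  have h := groupings_mul_symmM (β := β) (mem_splittings.2 <|
    (Finsupp.sum_single_index (h := fun (γ : MIndex) (r : ℕ) => r • γ.exp)
        (zero_smul _ _)).trans (one_smul _ _))
  have h1 : symmM (Finsupp.single β 1) = β.symm := by
    rw [symmM, Finsupp.prod_single_index (by simp)]
    simp
  rw [h1] at h
  have h2 : (β.symm : ℝ) ≠ 0 := by exact_mod_cast β.symm_pos.ne'
  exact mul_right_cancel₀ h2 (h.trans (one_mul _).symm)

variable {Λ Ω : Type*} [AddCommGroup Λ] [MeasurableSpace Λ] [MeasurableSpace Ω] {P : Measure Ω}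
  [IsProbabilityMeasure P] {X : Λ → Ω → ℝ} {K : Λ → ℝ}

/-- The moments are the sums over all forests of diagrams above the splittings of `β`. -/
theorem moment_eq_sum (hmeas : Measurable (Function.uncurry X))
    (hgauss : IsGaussianProcess X P) (hmean : ∀ x, P[X x] = 0)
    (hcov : ∀ x y, P[fun ω => X x ω * X y ω] = K (x - y)) (μ : Measure Λ) [IsFiniteMeasure μ]
    (β : MIndex) : moment μ P X β = ∑ s ∈ splittings β,
      groupings β s * valuationF μ K (liftAlg (MvPolynomial.monomial s 1)) := by
  classical
  obtain ⟨b, Γ, rfl⟩ := β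
  set β : MIndex := ⟨Γ.countExp, Γ, rfl⟩ with hβ
  have hexp : β.exp = fiberCount Γ.graph.arity := rfl
  have hE := Γ.graph.sum_arity
  have ha := Γ.graph.arity_pos
  have := Γ.graph.nonempty_E
  -- the forests of the pairings of the legs of `Γ` are those above the splittings of `β`
  have hmem : ∀ L : {L : Pairing Γ.graph.V Γ.graph.E // ∀ v, L.arity v = Γ.graph.arity v},
      L.1.forest.mapDomain Diagram.count ∈ splittings β := fun L => by
    rw [mem_splittings, sum_mapDomain_count,
      Pairing.totalCount_forest fun v => (ha v).trans_eq (L.2 v).symm, hexp, funext L.2]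
  let g : {L : Pairing Γ.graph.V Γ.graph.E // ∀ v, L.arity v = Γ.graph.arity v} →
      Σ s : splittings β, lifts s.1 := fun L => ⟨⟨_, hmem L⟩, ⟨L.1.forest, rfl⟩⟩
  have hg : ∀ L t, g L = t ↔ L.1.forest = t.2.1 := fun L t => by
    constructor
    · rintro rfl
      rfl
    · obtain ⟨⟨s, hs⟩, ⟨F, hF⟩⟩ := t
      intro h
      obtain rfl : L.1.forest = F := h
      obtain rfl : _ = s := hF
      rfl
  have hcard : ∀ t : Σ s : splittings β, lifts s.1, (Nat.card {L // g L = t} : ℝ) *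
      symmF t.2.1 = β.expFactorial * (Fintype.card Γ.graph.E).factorial *
        2 ^ Fintype.card Γ.graph.E := fun t => by
    have hF : totalCount t.2.1 = fiberCount Γ.graph.arity := by
      rw [← sum_mapDomain_count, ← hexp, ← mem_splittings.1 t.1.2]
      exact congrArg (fun s : MForest => s.sum fun γ r => r • γ.exp) t.2.2
    have h1 := Pairing.card_forest_eq ha hE hF
    have h2 : Nat.card {L // g L = t} = Nat.card {L : Pairing Γ.graph.V Γ.graph.E //
        (∀ v, L.arity v = Γ.graph.arity v) ∧ L.forest = t.2.1} :=
      (Nat.card_congr (Equiv.subtypeEquivRight fun L => hg L t)).trans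
        (Nat.card_congr (Equiv.subtypeSubtypeEquivSubtypeInter
          (fun L : Pairing Γ.graph.V Γ.graph.E => ∀ v, L.arity v = Γ.graph.arity v)
          fun L => L.forest = t.2.1))
    rw [h2]
    exact_mod_cast h1
  have hsymm : (β.symm : ℝ) = β.expFactorial * ∏ v, ((Γ.graph.arity v).factorial : ℝ) := by
    rw [MIndex.symm_eq_mul, hexp, prod_fiberCount]
    push_cast
    rfl
  have hmom : moment μ P X β = ∫ ω, ∏ v, ∫ x, hermiteVar (Γ.graph.arity v) (K 0) (X x ω) ∂μ ∂P := by
    simp only [moment, variance_eq_kernel hgauss hmean hcov, hexp]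
    exact integral_congr_ae (Filter.Eventually.of_forall fun ω =>
      prod_fiberCount _ fun k => ∫ x, hermiteVar k (K 0) (X x ω) ∂μ)
  rw [hmom, integral_prod_integral_hermiteVar hmeas hgauss hmean hcov μ ha hE,
    ← Fintype.sum_fiberwise g, Fintype.sum_sigma, Finset.mul_sum, ← Finset.sum_coe_sort (splittings β) fun s =>
      groupings β s * valuationF μ K (liftAlg (MvPolynomial.monomial s 1))]
  refine Finset.sum_congr rfl fun s _ => ?_
  rw [← liftP_eq, liftP_monomial, map_sum, Finset.mul_sum, Finset.mul_sum]
  refine Finset.sum_congr rfl fun F _ => ?_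
  have h1 : ∀ L : {L // g L = ⟨s, F⟩}, valuationF μ K (MvPolynomial.monomial L.1.1.forest 1) =
      valuationF μ K (MvPolynomial.monomial F.1 1) := fun L => by rw [(hg _ _).1 L.2]
  rw [Finset.sum_congr rfl fun L _ => h1 L, Finset.sum_const, Finset.card_univ,
    nsmul_eq_mul, map_smul, smul_eq_mul, ← mul_assoc, ← mul_assoc]
  congr 1
  have p1 : (symmF F.1 : ℝ) ≠ 0 := by exact_mod_cast (symmF_pos _).ne'
  have p2 : ((Fintype.card Γ.graph.E).factorial : ℝ) ≠ 0 := by positivity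
  have hc := hcard ⟨s, F⟩
  rw [Nat.card_eq_fintype_card] at hc
  rw [← mul_div_assoc, groupings_mul_symmM s.2, hsymm, eq_div_iff p1, mul_assoc, hc]
  field_simp

/-- The valuation of a multi-index, as a joint cumulant, retains only the connected diagrams. -/
theorem MIndex.valuation_eq (hmeas : Measurable (Function.uncurry X))
    (hgauss : IsGaussianProcess X P) (hmean : ∀ x, P[X x] = 0)
    (hcov : ∀ x y, P[fun ω => X x ω * X y ω] = K (x - y)) (μ : Measure Λ) [IsFiniteMeasure μ]
    (β : MIndex) : MIndex.valuation μ P X β = valuationF μ K (liftX β) := by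
  induction hn : β.halfEdges using Nat.strong_induction_on generalizing β with
  | _ n ih =>
  have h1 : ∀ s : decomps β, ∏ γ : s.1.support, MIndex.valuation μ P X γ.1 ^ s.1 γ.1 =
      valuationF μ K (liftAlg (MvPolynomial.monomial s.1 1)) := fun s => by
    rw [MvPolynomial.monomial_eq, MvPolynomial.C_1, one_mul, Finsupp.prod, map_prod, map_prod,
      ← Finset.prod_coe_sort s.1.support]
    refine Finset.prod_congr rfl fun γ _ => ?_
    rw [map_pow, map_pow, liftAlg_X, ih _ (hn ▸ decomps_lt s γ) γ.1 rfl]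
  have h2 : ∑ s : decomps β, groupings β s.1 *
      valuationF μ K (liftAlg (MvPolynomial.monomial s.1 1)) =
      ∑ s ∈ (decomps_finite β).toFinset, groupings β s *
        valuationF μ K (liftAlg (MvPolynomial.monomial s 1)) :=
    (Finset.sum_subtype _ (fun s => (decomps_finite β).mem_toFinset)
      fun s => groupings β s * valuationF μ K (liftAlg (MvPolynomial.monomial s 1))).symm
  rw [MIndex.valuation, Finset.sum_congr rfl fun s _ => congrArg (groupings β s.1 * ·) (h1 s), h2,
    moment_eq_sum hmeas hgauss hmean hcov μ β, splittings, Finset.sum_insert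
      (by rw [Set.Finite.mem_toFinset]; exact single_notMem_decomps β), add_sub_cancel_right,
    groupings_single, one_mul, ← MvPolynomial.X, liftAlg_X]

theorem valuationM_eq (hmeas : Measurable (Function.uncurry X))
    (hgauss : IsGaussianProcess X P) (hmean : ∀ x, P[X x] = 0)
    (hcov : ∀ x y, P[fun ω => X x ω * X y ω] = K (x - y)) (μ : Measure Λ) [IsFiniteMeasure μ]
    (z : MvPolynomial MIndex ℝ) : valuationM μ P X z = valuationF μ K (liftAlg z) := by
  suffices h : valuationM μ P X = (valuationF μ K).comp liftAlg from DFunLike.congr_fun h z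
  refine MvPolynomial.algHom_ext fun β => ?_
  rw [AlgHom.comp_apply, liftAlg_X, ← MIndex.valuation_eq hmeas hgauss hmean hcov]
  exact MvPolynomial.aeval_X _ _

end Cumulant

end FeynmanRenorm

end

theorem theorem4p3 {Λ Ω : Type*} [AddCommGroup Λ] [MeasurableSpace Λ] [MeasurableSpace Ω]
    (μ : Measure Λ) [IsFiniteMeasure μ] (P : Measure Ω) [IsProbabilityMeasure P]
    (X : Λ → Ω → ℝ) (K : Λ → ℝ)
    (hmeas : Measurable (Function.uncurry X))
    (hgauss : IsGaussianProcess X P)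
    (hmean : ∀ x, P[X x] = 0)
    (hcov : ∀ x y, P[fun ω => X x ω * X y ω] = K (x - y))
    (l : ℝ) (d : ℕ) (z : MvPolynomial FeynmanRenorm.MIndex ℝ) :
    FeynmanRenorm.valuationM μ P X (FeynmanRenorm.renormM μ P X l d z) =
      FeynmanRenorm.valuationF μ K
        (FeynmanRenorm.renormF μ K l d (FeynmanRenorm.liftP z)) := by
  have h := FeynmanRenorm.valuationM_eq hmeas hgauss hmean hcov μ
  rw [FeynmanRenorm.liftP_eq, ← FeynmanRenorm.liftAlg_renormM h, h]
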